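/- Call the convex hull of $m\ge 3$ points of $\mathbb{R}^2$ in convex position a convex $m$-gon, and let $\mathcal{P}_m$ be the family of all convex $m$-gons. For a set $\mathcal{S}$ of isometries of $\mathbb{R}^2$ and $K\in\mathcal{P}_m$ let $$c(K|\mathcal{S})=\frac{1}{\operatorname{area}(K)}\max\{\operatorname{area}(\operatorname{conv}(K\cup\sigma(K))) : \sigma\in\mathcal{S},\ K\cap\sigma(K)\neq\emptyset\},$$ and let $c^{tr}(K)$, $c_0(K)$ and $c_1(K)$ be the value of $c(K|\mathcal{S})$ when $\mathcal{S}$ is the set of all translations, of all reflections about points, and of all reflections about lines, respectively. Let $t_m$, $p_m$ and $l_m$ be the minima of $c^{tr}(P)$, $c_0(P)$ and $c_1(P)$ over $P\in\mathcal{P}_m$. An affine regular $m$-gon is the image of a regular $m$-gon under an invertible affine map. Then the following minima exist and have the stated values. (1) $t_3=t_4=3$ and $t_5=\frac{10+\sqrt5}{5}$. Moreover $c^{tr}(P)=3$ for every triangle and every convex quadrangle $P$, and if $c^{tr}(P)=t_5$ for some $P\in\mathcal{P}_5$, then $P$ is an affine regular pentagon. (2) $p_3=4$, $p_4=3$ and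 $p_5=2+\frac{8}{5}\sin^2\frac{\pi}{5}=3-\frac{\sqrt5}{5}$. Moreover, for $m=3,4,5$, if $c_0(P)=p_m$ for some $P\in\mathcal{P}_m$, then $P$ is an affine regular $m$-gon. (3) $l_3=4$ and $l_4=3$. Moreover, if $c_1(P)=l_3$ for some $P\in\mathcal{P}_3$, then $P$ is an equilateral triangle, and if $c_1(P)=l_4$ for some $P\in\mathcal{P}_4$, then $P$ is a rhombus. -/

import Mathlib

open MeasureTheory

noncomputable section

/-- Euclidean `n`-space. -/
abbrev Euc (n : ℕ) : Type := EuclideanSpace ℝ (Fin n)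

/-- The volumes of `conv (K ∪ K')`, where `K'` runs over the images `σ(K)`, `σ ∈ S`,
that meet `K`. -/
def hullVolumes {n : ℕ} (S : Set (Euc n ≃ᵢ Euc n)) (K : Set (Euc n)) : Set ℝ :=
  {x | ∃ σ ∈ S, (K ∩ σ '' K).Nonempty ∧ x = volume.real (convexHull ℝ (K ∪ σ '' K))}

/-- The quantity `c(K|S)`: the largest volume of `conv (K ∪ σ(K))` over all `σ ∈ S` for which
`K` and `σ(K)` intersect, divided by the volume of `K`. -/
def relHull {n : ℕ} (S : Set (Euc n ≃ᵢ Euc n)) (K : Set (Euc n)) : ℝ :=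
  1 / volume.real K * sSup (hullVolumes S K)

/-- For a bounded set `K` the supremum defining `c(K|S)` is taken over a bounded set. -/
theorem bddAbove_hullVolumes {n : ℕ} (S : Set (Euc n ≃ᵢ Euc n)) {K : Set (Euc n)}
    (hK : Bornology.IsBounded K) : BddAbove (hullVolumes S K) := by
  rcases K.eq_empty_or_nonempty with rfl | ⟨p, hp⟩
  · refine ⟨0, ?_⟩
    rintro x ⟨σ, -, h, -⟩
    simp at h
  refine ⟨volume.real (Metric.closedBall p (2 * Metric.diam K)), ?_⟩
  rintro x ⟨σ, -, ⟨y, hy, z, hz, rfl⟩, rfl⟩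
  have hd : 0 ≤ Metric.diam K := Metric.diam_nonneg
  refine measureReal_mono (convexHull_min ?_ (convex_closedBall _ _))
    measure_closedBall_lt_top.ne
  rintro w (hw | ⟨w, hw, rfl⟩)
  · have := Metric.dist_le_diam_of_mem hK hw hp
    simp only [Metric.mem_closedBall]
    linarith
  · have h1 := Metric.dist_le_diam_of_mem hK hw hz
    have h2 := Metric.dist_le_diam_of_mem hK hy hp
    have h3 := dist_triangle (σ w) (σ z) p
    rw [σ.dist_eq] at h3
    simp only [Metric.mem_closedBall]
    linarith

/-- The translations of Euclidean `n`-space. -/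
def translations (n : ℕ) : Set (Euc n ≃ᵢ Euc n) :=
  {σ | ∃ v : Euc n, σ = IsometryEquiv.addRight v}

/-- The reflections about the `i`-flats of Euclidean `n`-space. -/
def flatReflections (n i : ℕ) : Set (Euc n ≃ᵢ Euc n) :=
  {σ | ∃ (F : AffineSubspace ℝ (Euc n)) (_ : Nonempty F),
    Module.finrank ℝ F.direction = i ∧ σ = (EuclideanGeometry.reflection F).toIsometryEquiv}

/-- `c^{tr}(K)`. -/
def cTr {n : ℕ} (K : Set (Euc n)) : ℝ := relHull (translations n) K

/-- `c_i(K)`. -/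
def cRefl {n : ℕ} (i : ℕ) (K : Set (Euc n)) : ℝ := relHull (flatReflections n i) K

/-- The family of convex `m`-gons in the plane: convex hulls of `m` points in convex position. -/
def convexGons (m : ℕ) : Set (Set (Euc 2)) :=
  {P | 3 ≤ m ∧ ∃ v : Fin m → Euc 2, ConvexIndependent ℝ v ∧ P = convexHull ℝ (Set.range v)}

/-- The regular `m`-gon inscribed in the unit circle, with a vertex at `(1, 0)`. -/
def stdRegularGon (m : ℕ) : Set (Euc 2) :=
  convexHull ℝ (Set.range fun k : Fin m =>
    !₂[Real.cos (2 * Real.pi * (k : ℝ) / m), Real.sin (2 * Real.pi * (k : ℝ) / m)])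

/-- Affine regular `m`-gons: the images of a regular `m`-gon under invertible affine maps. -/
def IsAffineRegularGon (m : ℕ) (P : Set (Euc 2)) : Prop :=
  ∃ f : Euc 2 ≃ᵃ[ℝ] Euc 2, P = f '' stdRegularGon m

/-- Equilateral triangles. -/
def IsEquilateralTriangle (P : Set (Euc 2)) : Prop :=
  ∃ a b c : Euc 2, AffineIndependent ℝ ![a, b, c] ∧ P = convexHull ℝ {a, b, c} ∧
    dist a b = dist b c ∧ dist b c = dist c a

/-- Rhombi: nondegenerate convex quadrangles with four equal sides. (Four equal distances
`ab`, `bc`, `cd`, `da` between points in convex position force `a, b, c, d` to be their cyclic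
order.) -/
def IsRhombus (P : Set (Euc 2)) : Prop :=
  ∃ a b c d : Euc 2, ConvexIndependent ℝ ![a, b, c, d] ∧ P = convexHull ℝ {a, b, c, d} ∧
    dist a b = dist b c ∧ dist b c = dist c d ∧ dist c d = dist d a

end

/-! Translations. For convex compact `K`, the hull of `K` and `K + v` has area `area K` plus the
maximum of `dd v (x - y)` over `x, y ∈ K` (`area_hull_translate_ge`, `area_hull_translate_le`), and
`K` meets `K + v` exactly when `v` is a difference of two points of `K`. So the problem is to
maximize `dd (p - q) (x - y)` over four points of `K`. This never exceeds twice the area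
(`four_point_area`), and two sides of a triangle or the two diagonals of a quadrangle attain the
bound. In a pentagon, the diagonals of the quadrangle left after removing an ear give `3 - 2 T / A`,
with `T` the area of the ear and `A` that of the pentagon, so some ear must be shown to be small.

Pentagons. Gauss's relation `gauss_pentagon` ties `A` to the five ears. If all ears equal `t A`, it
reads `1 - 5 t + 5 t ^ 2 = 0`, and the relevant root is `t = (3 - phi) / 5`. The ears cannot all be
at least `t A`, nor all at most `t A`, unless all are equal (`ears_eq_of_ge`, `ears_eq_of_le`), and
equal ears characterize affine regular pentagons (`pentagon_of_ears_eq`).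

Point reflections. The hull area is a convex function of the centre (`convexOn_area_hull`), so its
maximum over the polygon is attained at a vertex. Reflecting about a vertex adds to the two copies
of the polygon two triangles congruent to the one formed by the vertex and its neighbours
(`area_hull_pointReflection_ge`). This gives 4 for triangles. In a quadrangle opposite corner
triangles together fill the quadrangle, so one has at least half of its area, and the value 3 forces
a parallelogram. In a pentagon the corner triangles are the ears, and the largest has area at least
`t A`.

Line reflections. For a fixed direction the hull area is convex in the offset of the line, so only
supporting lines matter for upper bounds (`cRefl_one_le_of_support`); these are computed for the
equilateral triangle and the square. For lower bounds a line through a vertex is chosen. For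
triangles and parallelograms a suitable direction gives 4 and 3 plus a positive multiple of the
squared difference of the squared side lengths at that vertex, which settles the equality cases. For
general quadrangles, a line through a corner parallel to the opposite diagonal yields the same
corner inequality as for point reflections and so reduces equality to parallelograms. -/

/-! ### Determinants, null lines and cutting areas along a line -/

/-- The determinant of two plane vectors. -/
def dd (p q : Euc 2) : ℝ := p 0 * q 1 - p 1 * q 0

/-- Twice the signed area of the triangle `abc`. -/
def tri (a b c : Euc 2) : ℝ := dd (b - a) (c - a)

theorem euc_ext {p q : Euc 2} (h0 : p 0 = q 0) (h1 : p 1 = q 1) : p = q := by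
  ext i; fin_cases i <;> assumption

theorem tri_def (a b c : Euc 2) :
    tri a b c = (b 0 - a 0) * (c 1 - a 1) - (b 1 - a 1) * (c 0 - a 0) := by
  simp [tri, dd]

theorem tri_rotate (a b c : Euc 2) : tri b c a = tri a b c := by
  simp only [tri_def]; ring

theorem tri_swap (a b c : Euc 2) : tri a c b = -tri a b c := by
  simp only [tri_def]; ring

/-- `dd u` as a linear functional. -/
def ddL (u : Euc 2) : Euc 2 →ₗ[ℝ] ℝ where
  toFun := dd u
  map_add' x y := by simp [dd]; ring
  map_smul' c x := by simp [dd]; ring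

@[simp] theorem ddL_apply (u x : Euc 2) : ddL u x = dd u x := rfl

theorem dd_sub (u x y : Euc 2) : dd u (x - y) = dd u x - dd u y := (ddL u).map_sub x y

theorem ddL_ne_zero {u : Euc 2} (hu : u ≠ 0) : ddL u ≠ 0 := by
  intro h
  apply hu
  have h0 := LinearMap.congr_fun h !₂[1, 0]
  have h1 := LinearMap.congr_fun h !₂[0, 1]
  simp [dd] at h0 h1
  exact euc_ext (by simpa using h1) (by simpa using h0)

theorem line_null {f : Euc 2 →ₗ[ℝ] ℝ} (hf : f ≠ 0) (c : ℝ) :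
    volume {x | f x = c} = 0 := by
  rcases Set.eq_empty_or_nonempty {x | f x = c} with h | ⟨p, hp⟩
  · rw [h]; simp
  · have : {x | f x = c} = (AffineSubspace.mk' p (LinearMap.ker f) : Set (Euc 2)) := by
      ext x
      simp only [Set.mem_ofPred_eq] at hp
      simp [AffineSubspace.mem_mk', hp, sub_eq_zero]
    rw [this]
    apply Measure.addHaar_affineSubspace
    intro h
    apply hf
    have : (AffineSubspace.mk' p (LinearMap.ker f)).direction = ⊤ := by
      rw [h, AffineSubspace.direction_top]
    rw [AffineSubspace.direction_mk'] at this
    exact LinearMap.ker_eq_top.1 this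

theorem measurableSet_lt_fun (f : Euc 2 →ₗ[ℝ] ℝ) (c : ℝ) : MeasurableSet {x | f x < c} :=
  measurableSet_lt f.continuous_of_finiteDimensional.measurable measurable_const

/-- Two parts of a set on different sides of a line. -/
theorem area_add_le {f : Euc 2 →ₗ[ℝ] ℝ} (hf : f ≠ 0) (c : ℝ) {C S T : Set (Euc 2)}
    (hC : volume C ≠ ⊤) (hSC : S ⊆ C) (hTC : T ⊆ C) (hS : ∀ x ∈ S, f x ≤ c)
    (hT : ∀ x ∈ T, c ≤ f x) : volume.real S + volume.real T ≤ volume.real C := by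
  have h1 := measureReal_inter_add_sdiff (μ := volume) (s := C) (measurableSet_lt_fun f c) hC
  have h2 : volume.real S ≤ volume.real (C ∩ {x | f x < c}) := by
    have : S ⊆ (C ∩ {x | f x < c}) ∪ {x | f x = c} := by
      intro x hx
      rcases (hS x hx).lt_or_eq with h | h
      · exact Or.inl ⟨hSC hx, h⟩
      · exact Or.inr h
    calc volume.real S ≤ volume.real ((C ∩ {x | f x < c}) ∪ {x | f x = c}) := by
          refine measureReal_mono this ?_
          exact (measure_union_lt_top ((measure_mono Set.inter_subset_left).trans_lt hC.lt_top)
            (by rw [line_null hf]; simp)).ne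
      _ ≤ volume.real (C ∩ {x | f x < c}) + volume.real {x | f x = c} :=
          measureReal_union_le _ _
      _ = _ := by simp [Measure.real, line_null hf]
  have h3 : volume.real T ≤ volume.real (C \ {x | f x < c}) := by
    refine measureReal_mono (fun x hx => ⟨hTC hx, ?_⟩) ?_
    · simpa using hT x hx
    · exact ((measure_mono Set.sdiff_subset).trans_lt hC.lt_top).ne
  linarith

/-- A set cut by a line. -/
theorem area_le_cut {C S T : Set (Euc 2)}
    (hS' : volume S ≠ ⊤) (hT' : volume T ≠ ⊤) (h : C ⊆ S ∪ T) :
    volume.real C ≤ volume.real S + volume.real T :=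
  (measureReal_mono h (measure_union_lt_top hS'.lt_top hT'.lt_top).ne).trans
    (measureReal_union_le _ _)

/-! ### Area of a triangle -/

/-- The linear map with columns `p`, `q`. -/
def frameL (p q : Euc 2) : Euc 2 →ₗ[ℝ] Euc 2 where
  toFun x := x 0 • p + x 1 • q
  map_add' x y := by simp [add_smul]; abel
  map_smul' c x := by simp [mul_smul]

@[simp] theorem frameL_apply (p q x : Euc 2) : frameL p q x = x 0 • p + x 1 • q := rfl

theorem frameL_det (p q : Euc 2) : LinearMap.det (frameL p q) = dd p q := by
  rw [← LinearMap.det_toMatrix (EuclideanSpace.basisFun (Fin 2) ℝ).toBasis, Matrix.det_fin_two]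
  simp [LinearMap.toMatrix_apply, dd]
  ring

theorem Convex.mem₃ {C : Set (Euc 2)} (hC : Convex ℝ C) {a b c : Euc 2} (ha : a ∈ C) (hb : b ∈ C)
    (hc : c ∈ C) {α β γ : ℝ} (hα : 0 ≤ α) (hβ : 0 ≤ β) (hγ : 0 ≤ γ) (h : α + β + γ = 1) :
    α • a + β • b + γ • c ∈ C := by
  have := hC.sum_mem (t := Finset.univ) (w := ![α, β, γ]) (z := ![a, b, c])
    (by intro i _; fin_cases i <;> simpa) (by simpa [Fin.sum_univ_three] using h)
    (by intro i _; fin_cases i <;> simpa)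
  simpa [Fin.sum_univ_three] using this

theorem unit_square_area :
    volume {x : Euc 2 | 0 ≤ x 0 ∧ x 0 ≤ 1 ∧ 0 ≤ x 1 ∧ x 1 ≤ 1} = 1 := by
  have h := (PiLp.volume_preserving_ofLp (Fin 2)).measure_preimage
    (s := Set.Icc (0 : Fin 2 → ℝ) 1) measurableSet_Icc.nullMeasurableSet
  rw [Real.volume_Icc_pi] at h
  simp only [Pi.one_apply, Pi.zero_apply, sub_zero, ENNReal.ofReal_one, Finset.prod_const_one] at h
  rw [← h]
  congr 1
  ext x
  simp [Pi.le_def, Fin.forall_fin_two]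
  tauto

theorem finite_hull_ne_top {S : Set (Euc 2)} (hS : S.Finite) : volume (convexHull ℝ S) ≠ ⊤ :=
  (hS.isCompact_convexHull (𝕜 := ℝ)).measure_lt_top.ne

/-- The unit square is the union of this triangle and its image under `x ↦ (1, 1) - x`, and the two
overlap only on a diagonal of the square; hence twice the area is 1. -/
theorem std_triangle_area :
    volume.real (convexHull ℝ {(0 : Euc 2), !₂[1, 0], !₂[0, 1]}) = 1 / 2 := by
  set T := convexHull ℝ {(0 : Euc 2), !₂[1, 0], !₂[0, 1]} with hT
  have hTeq : T = {x | 0 ≤ x 0 ∧ 0 ≤ x 1 ∧ x 0 + x 1 ≤ 1} := by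
    apply Set.Subset.antisymm
    · apply convexHull_min
      · rintro x (rfl | rfl | rfl) <;> simp
      · intro x hx y hy a b ha hb hab
        simp only [Set.mem_ofPred_eq] at *
        simp only [PiLp.add_apply, PiLp.smul_apply, smul_eq_mul]
        obtain ⟨x0, x1, x2⟩ := hx
        obtain ⟨y0, y1, y2⟩ := hy
        refine ⟨by positivity, by positivity, by nlinarith⟩
    · rintro x ⟨h0, h1, h2⟩
      have := (convex_convexHull ℝ {(0 : Euc 2), !₂[1, 0], !₂[0, 1]}).mem₃
        (subset_convexHull ℝ _ (by simp : (0 : Euc 2) ∈ _))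
        (subset_convexHull ℝ _ (by simp : (!₂[1, 0] : Euc 2) ∈ _))
        (subset_convexHull ℝ _ (by simp : (!₂[0, 1] : Euc 2) ∈ _))
        (sub_nonneg.2 h2) h0 h1 (by ring)
      convert this using 1
      apply euc_ext <;> simp
  have hTtop : volume T ≠ ⊤ := finite_hull_ne_top (by simp)
  let c : Euc 2 := !₂[1, 1]
  have hmp := Measure.measurePreserving_sub_left (volume : Measure (Euc 2)) c
  have hTm : MeasurableSet T := ((Set.toFinite _).isCompact_convexHull (𝕜 := ℝ)).measurableSet
  have hT' : volume.real ((fun x => c - x) ⁻¹' T) = volume.real T := by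
    simp only [Measure.real]; rw [hmp.measure_preimage hTm.nullMeasurableSet]
  have hT't : volume ((fun x => c - x) ⁻¹' T) ≠ ⊤ := by
    rw [hmp.measure_preimage hTm.nullMeasurableSet]; exact hTtop
  have hSq : volume.real {x : Euc 2 | 0 ≤ x 0 ∧ x 0 ≤ 1 ∧ 0 ≤ x 1 ∧ x 1 ≤ 1} = 1 := by
    simp [Measure.real, unit_square_area]
  have hu : (!₂[1, -1] : Euc 2) ≠ 0 := by
    intro h; have := congrArg (fun x : Euc 2 => x 0) h; simp at this
  have h1 := area_add_le (ddL_ne_zero hu) 1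
    (C := {x : Euc 2 | 0 ≤ x 0 ∧ x 0 ≤ 1 ∧ 0 ≤ x 1 ∧ x 1 ≤ 1}) (S := T)
    (T := (fun x => c - x) ⁻¹' T) (by rw [unit_square_area]; simp)
    (by
      rw [hTeq]; rintro x ⟨h0, h1, h2⟩
      exact ⟨h0, by linarith, h1, by linarith⟩)
    (by
      rw [hTeq]; rintro x ⟨h0, h1, h2⟩
      simp [c] at h0 h1 h2
      exact ⟨by linarith, by linarith, by linarith, by linarith⟩)
    (by rw [hTeq]; rintro x ⟨h0, h1, h2⟩; simp [dd]; linarith)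
    (by
      rw [hTeq]; rintro x ⟨h0, h1, h2⟩
      simp [c] at h0 h1 h2
      simp [dd]; linarith)
  have h2 := area_le_cut
    (C := {x : Euc 2 | 0 ≤ x 0 ∧ x 0 ≤ 1 ∧ 0 ≤ x 1 ∧ x 1 ≤ 1}) hTtop hT't
    (by
      rw [hTeq]; rintro x ⟨h0, h1, h2, h3⟩
      rcases le_total (x 0 + x 1) 1 with h | h
      · left; exact ⟨h0, h2, h⟩
      · right; simp [c]; exact ⟨by linarith, by linarith, by linarith⟩)
  rw [hSq, hT'] at h1 h2
  linarith

theorem triangle_area (a b c : Euc 2) :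
    volume.real (convexHull ℝ {a, b, c}) = |tri a b c| / 2 := by
  have h : convexHull ℝ {a, b, c} =
      (fun x => a + x) '' (frameL (b - a) (c - a) '' convexHull ℝ {(0 : Euc 2), !₂[1, 0], !₂[0, 1]}) := by
    rw [LinearMap.image_convexHull]
    have := (AffineEquiv.constVAdd ℝ (Euc 2) a).toAffineMap.image_convexHull
      (frameL (b - a) (c - a) '' {(0 : Euc 2), !₂[1, 0], !₂[0, 1]})
    simp only [AffineEquiv.coe_toAffineMap, AffineEquiv.constVAdd_apply, vadd_eq_add] at this
    rw [this]
    congr 1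
    simp [Set.image_insert_eq]
  rw [h, Measure.real, Set.image_add_left, measure_preimage_add, Measure.addHaar_image_linearMap,
    ENNReal.toReal_mul, frameL_det]
  change _ * volume.real _ = _
  rw [std_triangle_area, ENNReal.toReal_ofReal (abs_nonneg _), tri]
  ring

/-! ### Half-planes of a directed line and the four-point bound -/

theorem tri_self₁ (p q : Euc 2) : tri p q p = 0 := by simp [tri_def]

theorem tri_self₂ (p q : Euc 2) : tri p q q = 0 := by simp only [tri_def]; ring

theorem tri_self₃ (p q : Euc 2) : tri p p q = 0 := by simp [tri_def]

theorem tri_eq_ddL (a b z : Euc 2) : tri a b z = ddL (b - a) z - ddL (b - a) a := by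
  simp [tri, dd]; ring

theorem tri_combo (a b x y : Euc 2) {s t : ℝ} (h : s + t = 1) :
    tri a b (s • x + t • y) = s * tri a b x + t * tri a b y := by
  simp only [tri_def, PiLp.add_apply, PiLp.smul_apply, smul_eq_mul]
  obtain rfl : s = 1 - t := by linarith
  ring

theorem tri_nonneg_of_mem_hull {a b : Euc 2} {T : Set (Euc 2)} (h : ∀ s ∈ T, 0 ≤ tri a b s) :
    ∀ s ∈ convexHull ℝ T, 0 ≤ tri a b s := by
  intro s hs
  refine convexHull_min (t := {z | 0 ≤ tri a b z}) h ?_ hs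
  intro x hx y hy s t hs ht hst
  simp only [Set.mem_ofPred_eq] at *
  rw [tri_combo _ _ _ _ hst]; positivity

theorem tri_nonpos_of_mem_hull {a b : Euc 2} {T : Set (Euc 2)} (h : ∀ s ∈ T, tri a b s ≤ 0) :
    ∀ s ∈ convexHull ℝ T, tri a b s ≤ 0 := by
  intro s hs
  have := tri_nonneg_of_mem_hull (a := b) (b := a) (T := T) (fun s hs => by
    have := h s hs; simp only [tri_def] at *; linarith) s hs
  simp only [tri_def] at *; linarith

theorem area_hull_eq_zero {a b : Euc 2} (hab : a ≠ b) {T : Set (Euc 2)}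
    (h : ∀ s ∈ T, tri a b s = 0) : volume.real (convexHull ℝ T) = 0 := by
  have h2 : volume (convexHull ℝ T) = 0 := by
    refine measure_mono_null ?_ (line_null (ddL_ne_zero (sub_ne_zero.2 hab.symm)) (ddL (b - a) a))
    intro z hz
    have h1 := tri_nonneg_of_mem_hull (fun s hs => (h s hs).ge) z hz
    have h2 := tri_nonpos_of_mem_hull (fun s hs => (h s hs).le) z hz
    rw [tri_eq_ddL] at h1 h2
    simp only [Set.mem_ofPred_eq]; linarith
  simp [Measure.real, h2]

/-- Two convex hulls on different sides of the line `ab`. -/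
theorem area_add_le_of_line {a b : Euc 2} (hab : a ≠ b) {C S T : Set (Euc 2)} (hC : Convex ℝ C)
    (hC' : volume C ≠ ⊤) (hSC : S ⊆ C) (hTC : T ⊆ C) (hS : ∀ x ∈ S, tri a b x ≤ 0)
    (hT : ∀ x ∈ T, 0 ≤ tri a b x) :
    volume.real (convexHull ℝ S) + volume.real (convexHull ℝ T) ≤ volume.real C := by
  refine area_add_le (ddL_ne_zero (sub_ne_zero.2 hab.symm)) (ddL (b - a) a) hC'
    (convexHull_min hSC hC) (convexHull_min hTC hC) ?_ ?_
  · intro z hz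
    have := tri_nonpos_of_mem_hull hS z hz
    rw [tri_eq_ddL] at this; linarith
  · intro z hz
    have := tri_nonneg_of_mem_hull hT z hz
    rw [tri_eq_ddL] at this; linarith

/-- The determinant is a difference of two signed triangles over the common base `ab`. If `x` and
`y` lie on the same side of the base, the larger triangle alone bounds it; if on opposite sides, the
two triangles do not overlap and both fit into `C`. -/
theorem four_point_area {C : Set (Euc 2)} (hC : Convex ℝ C) (hC' : volume C ≠ ⊤)
    {a b x y : Euc 2} (ha : a ∈ C) (hb : b ∈ C) (hx : x ∈ C) (hy : y ∈ C) :
    |dd (a - b) (x - y)| ≤ 2 * volume.real C := by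
  by_cases hab : a = b
  · subst hab; simp [dd]
  have key : ∀ z ∈ C, convexHull ℝ {b, a, z} ⊆ C := by
    intro z hz
    apply convexHull_min _ hC
    rintro p (rfl | rfl | rfl) <;> assumption
  have mono : ∀ z ∈ C, |tri b a z| / 2 ≤ volume.real C := by
    intro z hz
    rw [← triangle_area]
    exact measureReal_mono (key z hz) hC'
  have side : ∀ p q : Euc 2, p ∈ C → q ∈ C → tri b a p ≤ 0 → 0 ≤ tri b a q →
      |tri b a p| / 2 + |tri b a q| / 2 ≤ volume.real C := by
    intro p q hp hq h1 h2
    rw [← triangle_area, ← triangle_area]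
    refine area_add_le_of_line (Ne.symm hab) hC hC' ((subset_convexHull ℝ _).trans (key p hp))
      ((subset_convexHull ℝ _).trans (key q hq)) ?_ ?_
    · rintro z (rfl | rfl | rfl)
      · exact (tri_self₁ _ _).le
      · exact (tri_self₂ _ _).le
      · exact h1
    · rintro z (rfl | rfl | rfl)
      · exact (tri_self₁ _ _).ge
      · exact (tri_self₂ _ _).ge
      · exact h2
  have e : dd (a - b) (x - y) = tri b a x - tri b a y := by simp [tri, dd]; ring
  rw [e]
  have hx' := mono x hx
  have hy' := mono y hy
  rcases le_total (tri b a x) 0 with h1 | h1 <;> rcases le_total (tri b a y) 0 with h2 | h2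
  · rw [abs_of_nonpos h1] at hx'; rw [abs_of_nonpos h2] at hy'
    rw [abs_le]; constructor <;> linarith
  · have := side x y hx hy h1 h2
    rw [abs_of_nonpos h1, abs_of_nonneg h2] at this
    rw [abs_le]; constructor <;> linarith
  · have := side y x hy hx h2 h1
    rw [abs_of_nonneg h1, abs_of_nonpos h2] at this
    rw [abs_le]; constructor <;> linarith
  · rw [abs_of_nonneg h1] at hx'; rw [abs_of_nonneg h2] at hy'
    rw [abs_le]; constructor <;> linarith

/-! ### Ears and the shoelace formula -/

theorem barycentric (a b c z : Euc 2) :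
    tri a b c • z = tri b c z • a + tri c a z • b + tri a b z • c := by
  apply euc_ext <;> simp [tri_def] <;> ring

/-- Cutting off an ear. -/
theorem hull_ear_subset {a b c : Euc 2} {T : Set (Euc 2)} (ha : a ∈ T) (hc : c ∈ T)
    (habc : 0 < tri a b c) (h1 : ∀ s ∈ T, 0 ≤ tri a b s) (h2 : ∀ s ∈ T, 0 ≤ tri b c s)
    (h3 : ∀ s ∈ T, tri c a s ≤ 0) :
    convexHull ℝ (insert b T) ⊆ convexHull ℝ {a, b, c} ∪ convexHull ℝ T := by
  intro x hx
  rw [convexHull_insert ⟨a, ha⟩, convexJoin_singleton_left] at hx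
  simp only [Set.mem_iUnion, exists_prop] at hx
  obtain ⟨y, hy, hxy⟩ := hx
  obtain ⟨s, t, hs, ht, hst, rfl⟩ := hxy
  set D := tri a b c with hD
  have hDb : tri c a b = D := by rw [hD, ← tri_rotate, ← tri_rotate, ← tri_rotate]
  have hy1 := tri_nonneg_of_mem_hull h1 y hy
  have hy2 := tri_nonneg_of_mem_hull h2 y hy
  have hy3 := tri_nonpos_of_mem_hull h3 y hy
  have hden : 0 < D - tri c a y := by linarith
  -- Along the segment from `b` to `y` the affine function `tri c a` goes from `D` to a nonpositive
  -- value. It vanishes at parameter `τ`, where the segment crosses `ac` at `z`: the part before `z`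
  -- lies in the ear, the part after it in the hull of `T`.
  set τ := D / (D - tri c a y) with hτ
  have hτ0 : 0 < τ := by positivity
  have hτ1 : τ ≤ 1 := by rw [hτ, div_le_one hden]; linarith
  have hτe : τ * (D - tri c a y) = D := by rw [hτ]; field_simp
  let z : Euc 2 := (1 - τ) • b + τ • y
  have hz0 : tri c a z = 0 := by
    rw [tri_combo _ _ _ _ (by ring), hDb]; linarith
  have hz1 : 0 ≤ tri a b z := by
    rw [tri_combo _ _ _ _ (by ring)]
    have : tri a b b = 0 := by simp [tri_def]; ring
    rw [this]; nlinarith [mul_nonneg hτ0.le hy1]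
  have hz2 : 0 ≤ tri b c z := by
    rw [tri_combo _ _ _ _ (by ring)]
    have : tri b c b = 0 := by simp [tri_def]
    rw [this]; nlinarith [mul_nonneg hτ0.le hy2]
  have hzsum : tri b c z + tri a b z = D := by
    have : tri a b z + tri b c z + tri c a z = D := by simp only [hD, tri_def]; ring
    linarith
  have hzeq : z = (tri b c z / D) • a + (tri a b z / D) • c := by
    have := barycentric a b c z
    rw [hz0, zero_smul, add_zero, ← hD] at this
    have h := congrArg (fun v => D⁻¹ • v) this
    simp only [smul_add, smul_smul, inv_mul_cancel₀ habc.ne', one_smul] at h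
    calc z = _ := h
      _ = _ := by rw [div_eq_inv_mul, div_eq_inv_mul]
  have hzac : ∀ C : Set (Euc 2), Convex ℝ C → a ∈ C → c ∈ C → z ∈ C := by
    intro C hC ha hc
    rw [hzeq]
    exact hC ha hc (by positivity) (by positivity) (by rw [← add_div, hzsum, div_self habc.ne'])
  rcases le_total t τ with h | h
  · left
    have hzT := hzac _ (convex_convexHull ℝ {a, b, c}) (subset_convexHull ℝ _ (by simp))
      (subset_convexHull ℝ _ (by simp))
    have hbT : b ∈ convexHull ℝ {a, b, c} := subset_convexHull ℝ _ (by simp)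
    have := (convex_convexHull ℝ {a, b, c}) hbT hzT (a := 1 - t / τ) (b := t / τ)
      (by rw [sub_nonneg, div_le_one hτ0]; exact h) (by positivity) (by ring)
    convert this using 1
    obtain rfl : s = 1 - t := by linarith
    have hh : t / τ * τ = t := by field_simp
    simp only [z, smul_add, smul_smul, hh, mul_sub, mul_one, ← add_assoc, ← add_smul]
    congr 2; ring
  · right
    have hzT := hzac _ (convex_convexHull ℝ T) (subset_convexHull ℝ _ ha)
      (subset_convexHull ℝ _ hc)
    rcases hτ1.lt_or_eq with hlt | heq
    · have hpos : 0 < 1 - τ := by linarith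
      have := (convex_convexHull ℝ T) hzT hy (a := s / (1 - τ)) (b := 1 - s / (1 - τ))
        (by positivity) (by rw [sub_nonneg, div_le_one hpos]; linarith) (by ring)
      convert this using 1
      obtain rfl : t = 1 - s := by linarith
      have hh : s / (1 - τ) * (1 - τ) = s := by field_simp
      simp only [z, smul_add, smul_smul, hh, add_assoc, ← add_smul]
      congr 2
      linear_combination hh
    · have : t = 1 := by linarith
      obtain rfl : s = 0 := by linarith
      simpa [this] using hy

/-- A nondegenerate ear is separated from the hull of `T` by the line `ca`. A flat ear must add no
area: either `b` already lies in the hull of `T`, or all the points are collinear. Allowing it lets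
the shoelace formula hold under weak inequalities. -/
theorem area_ear {a b c : Euc 2} {T : Set (Euc 2)} (hTf : T.Finite) (ha : a ∈ T) (hc : c ∈ T)
    (h1 : ∀ s ∈ T, 0 ≤ tri a b s) (h2 : ∀ s ∈ T, 0 ≤ tri b c s) (h3 : ∀ s ∈ T, tri c a s ≤ 0) :
    volume.real (convexHull ℝ (insert b T)) =
      tri a b c / 2 + volume.real (convexHull ℝ T) := by
  have hfin : volume (convexHull ℝ (insert b T)) ≠ ⊤ := finite_hull_ne_top (hTf.insert b)
  have hmono : volume.real (convexHull ℝ T) ≤ volume.real (convexHull ℝ (insert b T)) :=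
    measureReal_mono (convexHull_mono (Set.subset_insert b T)) hfin
  have hD := h1 c hc
  rcases hD.lt_or_eq with habc | h0
  · have htri : volume.real (convexHull ℝ {a, b, c}) = tri a b c / 2 := by
      rw [triangle_area, abs_of_pos habc]
    apply le_antisymm
    · rw [← htri]
      exact area_le_cut (finite_hull_ne_top (by simp)) (finite_hull_ne_top hTf)
        (hull_ear_subset ha hc habc h1 h2 h3)
    · rw [← htri, add_comm]
      have hca : c ≠ a := by rintro rfl; simp [tri_def] at habc
      refine area_add_le_of_line hca (convex_convexHull ℝ _) hfin
        ((Set.subset_insert b T).trans (subset_convexHull ℝ _)) ?_ h3 ?_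
      · rintro p (rfl | rfl | rfl)
        · exact subset_convexHull ℝ _ (Set.mem_insert_of_mem _ ha)
        · exact subset_convexHull ℝ _ (Set.mem_insert _ _)
        · exact subset_convexHull ℝ _ (Set.mem_insert_of_mem _ hc)
      · rintro p (rfl | rfl | rfl)
        · exact (tri_self₂ _ _).ge
        · rw [tri_rotate] ; rw [tri_rotate] ; exact habc.le
        · simp [tri_def]
  · rw [← h0]
    simp only [zero_div, zero_add]
    refine le_antisymm ?_ hmono
    have hmem : b ∈ convexHull ℝ T → volume.real (convexHull ℝ (insert b T)) ≤
        volume.real (convexHull ℝ T) := fun hb =>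
      measureReal_mono (convexHull_min (Set.insert_subset hb (subset_convexHull ℝ T))
        (convex_convexHull ℝ T)) (finite_hull_ne_top hTf)
    have hzero : ∀ p q : Euc 2, p ≠ q → tri p q b = 0 → (∀ s ∈ T, tri p q s = 0) →
        volume.real (convexHull ℝ (insert b T)) ≤ volume.real (convexHull ℝ T) := by
      intro p q hpq hb hT
      rw [area_hull_eq_zero hpq (T := insert b T)]
      · exact measureReal_nonneg
      · rintro s (rfl | hs)
        exacts [hb, hT s hs]
    by_cases hac : a = c
    · subst hac
      by_cases hab : a = b
      · subst hab; exact hmem (subset_convexHull ℝ _ ha)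
      · refine hzero a b hab (by simp [tri_def]; ring) fun s hs => ?_
        have e1 := h1 s hs
        have e2 := h2 s hs
        simp only [tri_def] at *; linarith
    · have hex : ∃ t : ℝ, b = a + t • (c - a) := by
        have : (c - a) 0 ≠ 0 ∨ (c - a) 1 ≠ 0 := by
          by_contra! h
          exact hac (sub_eq_zero.1 (euc_ext h.1 h.2)).symm
        simp only [tri_def] at h0
        rcases this with h | h
        · refine ⟨(b 0 - a 0) / (c - a) 0, euc_ext ?_ ?_⟩
          · simp at h ⊢; field_simp; ring
          · simp at h ⊢; field_simp; linarith
        · refine ⟨(b 1 - a 1) / (c - a) 1, euc_ext ?_ ?_⟩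
          · simp at h ⊢; field_simp; linarith
          · simp at h ⊢; field_simp; ring
      obtain ⟨t, ht⟩ := hex
      -- When `b` lies on the line `ac` but outside the segment, one of `h1`, `h2` reverses the sign
      -- condition `h3`, which puts all of `T` on that line.
      by_cases h01 : 0 ≤ t ∧ t ≤ 1
      · apply hmem
        have := (convex_convexHull ℝ T) (subset_convexHull ℝ _ ha) (subset_convexHull ℝ _ hc)
          (sub_nonneg.2 h01.2) h01.1 (by ring)
        rw [ht]
        convert this using 1
        module
      · have e1 : ∀ s, tri a b s = -t * tri c a s := by
          intro s; rw [ht]; simp [tri_def]; ring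
        have e2 : ∀ s, tri b c s = (t - 1) * tri c a s := by
          intro s; rw [ht]; simp [tri_def]; ring
        refine hzero c a (Ne.symm hac) (by rw [ht]; simp [tri_def]; ring) fun s hs => ?_
        have f1 := h1 s hs
        have f2 := h2 s hs
        have f3 := h3 s hs
        rw [e1] at f1
        rw [e2] at f2
        rcases not_and_or.1 h01 with h | h
        · push Not at h; nlinarith
        · push Not at h; nlinarith

/-- The area formula for a convex polygon given by its vertices in counterclockwise order. -/
theorem shoelace : ∀ (n : ℕ) (w : Fin (n + 2) → Euc 2)
    (_ : ∀ i j k, i < j → j < k → 0 ≤ tri (w i) (w j) (w k)),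
    volume.real (convexHull ℝ (Set.range w)) =
      (∑ i : Fin n, tri (w 0) (w i.succ.castSucc) (w i.succ.succ)) / 2 := by
  intro n
  induction n with
  | zero =>
    intro w _
    have : Set.range w = {w 0, w 1, w 1} := by
      ext x; simp [Fin.exists_fin_two, eq_comm]
    rw [this, triangle_area]
    simp [tri_def, mul_comm]
  | succ n ih =>
    intro w hw
    -- The last vertex is cut off as an ear whose neighbours are its predecessor and vertex 0; this
    -- ear is the last term of the fan of triangles from `w 0`.
    have hr : Set.range w = insert (w (Fin.last (n + 2))) (Set.range (w ∘ Fin.castSucc)) := by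
      ext x
      simp [Fin.exists_fin_succ', or_comm, eq_comm]
    have h0 : w 0 ∈ Set.range (w ∘ Fin.castSucc) := ⟨0, rfl⟩
    have hn : w (Fin.last (n + 1)).castSucc ∈ Set.range (w ∘ Fin.castSucc) := ⟨_, rfl⟩
    rw [hr, area_ear (Set.finite_range _) hn h0, ih (w ∘ Fin.castSucc), Fin.sum_univ_castSucc]
    · rw [← tri_rotate (w (Fin.last (n + 1)).castSucc), ← tri_rotate]
      simp only [Function.comp, Fin.succ_last, Fin.castSucc_zero, Fin.succ_castSucc]
      ring
    · intro i j k hij hjk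
      exact hw _ _ _ (by simpa) (by simpa)
    · rintro _ ⟨j, rfl⟩
      simp only [Function.comp]
      rcases (Fin.le_last j).lt_or_eq with h | rfl
      · rw [tri_rotate]
        exact hw _ _ _ (by simpa) (by simp [Fin.lt_def])
      · rw [tri_self₁]
    · rintro _ ⟨j, rfl⟩
      simp only [Function.comp]
      rcases (Fin.zero_le j).lt_or_eq with h | rfl
      · rw [← tri_rotate]
        exact hw _ _ _ h (Fin.castSucc_lt_last j)
      · rw [Fin.castSucc_zero, tri_self₂]
    · rintro _ ⟨j, rfl⟩
      simp only [Function.comp]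
      rcases (Fin.zero_le j).lt_or_eq with h | rfl
      · rcases (Fin.le_last j).lt_or_eq with h' | rfl
        · rw [tri_swap]
          exact neg_nonpos.2 (hw _ _ _ h h')
        · rw [tri_self₂]
      · rw [Fin.castSucc_zero, tri_self₁]

/-! ### Counterclockwise order of points in convex position -/

theorem convexIndependent_of_separated {ι : Type*} {w : ι → Euc 2}
    (h : ∀ i, ∃ a b, tri a b (w i) < 0 ∧ ∀ j, j ≠ i → 0 ≤ tri a b (w j)) :
    ConvexIndependent ℝ w := by
  intro s i hi
  by_contra his
  obtain ⟨a, b, h1, h2⟩ := h i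
  have := tri_nonneg_of_mem_hull (T := w '' s) (a := a) (b := b) (by
    rintro _ ⟨j, hj, rfl⟩
    exact h2 j (by rintro rfl; exact his hj)) _ hi
  linarith

theorem ConvexIndependent.not_mem_triangle {ι : Type*} {v : ι → Euc 2}
    (hv : ConvexIndependent ℝ v) {i j k l : ι} (hj : i ≠ j) (hk : i ≠ k) (hl : i ≠ l) :
    v i ∉ convexHull ℝ {v j, v k, v l} := by
  intro h
  have := hv {j, k, l} i (by simpa [Set.image_insert_eq] using h)
  simp [hj, hk, hl] at this

theorem mem_triangle_of_tri {a b c z : Euc 2} (h : 0 < tri a b c) (h1 : 0 ≤ tri b c z)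
    (h2 : 0 ≤ tri c a z) (h3 : 0 ≤ tri a b z) : z ∈ convexHull ℝ {a, b, c} := by
  have := (convex_convexHull ℝ {a, b, c}).mem₃
    (subset_convexHull ℝ _ (by simp : a ∈ _)) (subset_convexHull ℝ _ (by simp : b ∈ _))
    (subset_convexHull ℝ _ (by simp : c ∈ _)) (div_nonneg h1 h.le) (div_nonneg h2 h.le)
    (div_nonneg h3 h.le) (by
      rw [← add_div, ← add_div, div_eq_one_iff_eq h.ne']
      simp only [tri_def]; ring)
  convert this using 1
  have hb := congrArg (fun x => (tri a b c)⁻¹ • x) (barycentric a b c z)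
  simp only [smul_add, smul_smul, inv_mul_cancel₀ h.ne', one_smul] at hb
  rw [div_eq_inv_mul, div_eq_inv_mul, div_eq_inv_mul]
  exact hb

/-- A linear functional separates `v 0` from the other points, so seen from `v 0` they lie in an
open half-plane and can be sorted by slope. Convex position makes the slopes distinct, since
otherwise the nearer of two points would lie on a segment from `v 0`, and it also fixes the
orientation of triples that avoid `v 0`. -/
theorem exists_ccw {n : ℕ} {v : Fin (n + 1) → Euc 2} (hv : ConvexIndependent ℝ v) :
    ∃ w : Fin (n + 1) → Euc 2, ConvexIndependent ℝ w ∧ Set.range w = Set.range v ∧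
      ∀ i j k, i < j → j < k → 0 < tri (w i) (w j) (w k) := by
  have h0 : v 0 ∉ convexHull ℝ (v '' {0}ᶜ) := fun h => by simpa using hv _ _ h
  obtain ⟨f, u, hu, hf⟩ := geometric_hahn_banach_point_closed (convex_convexHull ℝ (v '' {0}ᶜ))
    ((Set.toFinite _).isCompact_convexHull (𝕜 := ℝ)).isClosed h0
  have hpos : ∀ i : Fin n, 0 < f (v i.succ - v 0) := by
    intro i
    rw [map_sub]
    have := hf (v i.succ) (subset_convexHull ℝ _ ⟨i.succ, by simp, rfl⟩)
    linarith
  have hfx : ∀ x : Euc 2, f x = x 0 * f !₂[1, 0] + x 1 * f !₂[0, 1] := by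
    intro x
    rw [← smul_eq_mul, ← smul_eq_mul, ← map_smul, ← map_smul, ← map_add]
    congr 1
    apply euc_ext <;> simp
  set α := f !₂[1, 0]
  set β := f !₂[0, 1]
  let g : Euc 2 → ℝ := fun x => α * x 1 - β * x 0
  have hid : ∀ p q : Euc 2, (α ^ 2 + β ^ 2) * dd p q = f p * g q - g p * f q := by
    intro p q; rw [hfx, hfx]; simp only [g, dd]; ring
  let p : Fin n → Euc 2 := fun i => v i.succ - v 0
  -- `g` is `f` composed with a quarter turn, so this is the slope of `p i` in axes adapted to `f`;
  -- by `hid`, comparing slopes amounts to the sign of `dd`.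
  let s : Fin n → ℝ := fun i => g (p i) / f (p i)
  have hαβ : ∀ i : Fin n, 0 < α ^ 2 + β ^ 2 := by
    intro i
    have h1 := hpos i
    rw [hfx] at h1
    by_contra h
    have ha : α = 0 := by nlinarith [sq_nonneg α, sq_nonneg β]
    have hb : β = 0 := by nlinarith [sq_nonneg α, sq_nonneg β]
    simp [ha, hb] at h1
  have hs : ∀ i j, s i < s j → 0 < dd (p i) (p j) := by
    intro i j hij
    have h1 : g (p i) * f (p j) < g (p j) * f (p i) := (div_lt_div_iff₀ (hpos i) (hpos j)).1 hij
    have h2 := hid (p i) (p j)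
    have h3 := hαβ i
    by_contra h
    nlinarith
  have hdeg : ∀ i j, i ≠ j → dd (p i) (p j) = 0 → f (p i) ≤ f (p j) → False := by
    intro i j hij hd hle
    have hj := hpos j
    have hi := hpos i
    apply hv.not_mem_triangle (i := i.succ) (j := 0) (k := j.succ) (l := j.succ)
      (by simp) (by simpa using hij) (by simpa using hij)
    have heq : f (p j) • p i = f (p i) • p j := by
      rw [hfx (p i), hfx (p j)]
      unfold dd at hd
      apply euc_ext <;> simp only [PiLp.smul_apply, smul_eq_mul]
      · linear_combination β * hd
      · linear_combination -α * hd
    have := (convex_convexHull ℝ {v 0, v j.succ, v j.succ})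
      (subset_convexHull ℝ _ (by simp : v 0 ∈ _)) (subset_convexHull ℝ _ (by simp : v j.succ ∈ _))
      (a := 1 - f (p i) / f (p j)) (b := f (p i) / f (p j))
      (by rw [sub_nonneg, div_le_one hj]; exact hle) (by positivity) (by ring)
    convert this using 1
    have h3 : p i = (f (p i) / f (p j)) • p j := by
      have := congrArg (fun x => (f (p j))⁻¹ • x) heq
      simp only [smul_smul] at this
      rw [inv_mul_cancel₀ hj.ne', one_smul] at this
      rw [div_eq_inv_mul]; exact this
    have h4 : v i.succ = v 0 + p i := by simp [p]
    rw [h4, h3]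
    have h5 : v j.succ = v 0 + p j := by simp [p]
    rw [h5]
    rw [← h3]
    simp only [smul_add]
    rw [← h3]
    module
  have hinj : Function.Injective s := by
    intro i j hij
    by_contra hne
    have h1 : g (p i) * f (p j) = g (p j) * f (p i) :=
      (div_eq_div_iff (hpos i).ne' (hpos j).ne').1 hij
    have h2 := hid (p i) (p j)
    have h3 : dd (p i) (p j) = 0 := by
      have : (α ^ 2 + β ^ 2) * dd (p i) (p j) = 0 := by rw [h2]; linarith
      exact (mul_eq_zero.1 this).resolve_left (hαβ i).ne'
    rcases le_total (f (p i)) (f (p j)) with h | h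
    · exact hdeg i j hne h3 h
    · exact hdeg j i (Ne.symm hne) (by simp only [dd] at *; linarith) h
  have hmono : StrictMono (s ∘ Tuple.sort s) :=
    (Tuple.monotone_sort s).strictMono_of_injective (hinj.comp (Tuple.sort s).injective)
  let e : Fin (n + 1) → Fin (n + 1) := Fin.cons 0 (fun i => (Tuple.sort s i).succ)
  have he : Function.Injective e := by
    intro i j hij
    induction i using Fin.cases <;> induction j using Fin.cases <;>
      simp [e, Fin.succ_ne_zero, (Fin.succ_ne_zero _).symm] at hij ⊢
    exact hij
  have hw : ConvexIndependent ℝ (v ∘ e) := hv.comp_embedding ⟨e, he⟩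
  have h0jk : ∀ j k : Fin n, j < k → 0 < tri ((v ∘ e) 0) ((v ∘ e) j.succ) ((v ∘ e) k.succ) := by
    intro j k hjk
    exact hs _ _ (hmono hjk)
  refine ⟨v ∘ e, hw, (Finite.injective_iff_surjective.1 he).range_comp v, ?_⟩
  intro i j k hij hjk
  obtain ⟨j', rfl⟩ := Fin.exists_succ_eq.2 (Fin.pos_iff_ne_zero.1 ((Fin.zero_le i).trans_lt hij))
  obtain ⟨k', rfl⟩ := Fin.exists_succ_eq.2 (Fin.pos_iff_ne_zero.1 ((Fin.zero_le _).trans_lt hjk))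
  rcases (Fin.zero_le i).eq_or_lt with rfl | hi
  · exact h0jk _ _ (by simpa using hjk)
  · obtain ⟨i', rfl⟩ := Fin.exists_succ_eq.2 (Fin.pos_iff_ne_zero.1 hi)
    have a1 := h0jk i' j' (by simpa using hij)
    have a2 := h0jk j' k' (by simpa using hjk)
    have a3 := h0jk i' k' (by simpa using hij.trans hjk)
    -- With the wrong orientation the middle vertex would lie in the triangle spanned by vertex 0
    -- and the two others.
    by_contra hneg
    push Not at hneg
    refine hw.not_mem_triangle (i := j'.succ) (j := 0) (k := i'.succ) (l := k'.succ) (by simp)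
      hij.ne' hjk.ne (mem_triangle_of_tri a3 ?_ ?_ a1.le)
    · rw [tri_swap]; linarith
    · rw [← tri_rotate]
      exact a2.le

theorem exists_ccw_of_mem_convexGons {n : ℕ} {P : Set (Euc 2)} (hP : P ∈ convexGons (n + 1)) :
    ∃ w : Fin (n + 1) → Euc 2, ConvexIndependent ℝ w ∧ P = convexHull ℝ (Set.range w) ∧
      ∀ i j k, i < j → j < k → 0 < tri (w i) (w j) (w k) := by
  obtain ⟨-, v, hv, rfl⟩ := hP
  obtain ⟨w, hw, hr, hpos⟩ := exists_ccw hv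
  exact ⟨w, hw, by rw [hr], hpos⟩

/-! ### Convexity of the hull area in the translation vector -/

/-- `A` and `B` are intervals, so `M` lies in the interval whose endpoints are the same combinations
of theirs. This is the estimate for a single slice in `area_combo_le`. -/
theorem length_combo_le {A B M : Set ℝ} (hA : IsCompact A) (hA' : Convex ℝ A) (hB : IsCompact B)
    (hB' : Convex ℝ B) {s t : ℝ} (hs : 0 ≤ s) (ht : 0 ≤ t)
    (h : ∀ m ∈ M, ∃ q ∈ A, ∃ r ∈ B, m = s * q + t * r) :
    volume M ≤ ENNReal.ofReal s * volume A + ENNReal.ofReal t * volume B := by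
  rcases M.eq_empty_or_nonempty with rfl | ⟨m, hm⟩
  · simp
  obtain ⟨q, hq, r, hr, -⟩ := h m hm
  have eA := eq_Icc_of_connected_compact (hA'.isConnected ⟨q, hq⟩) hA
  have eB := eq_Icc_of_connected_compact (hB'.isConnected ⟨r, hr⟩) hB
  set a := sInf A
  set a' := sSup A
  set b := sInf B
  set b' := sSup B
  have hM : M ⊆ Set.Icc (s * a + t * b) (s * a' + t * b') := by
    intro m hm
    obtain ⟨q, hq, r, hr, rfl⟩ := h m hm
    rw [eA] at hq
    rw [eB] at hr
    constructor
    · have := mul_le_mul_of_nonneg_left hq.1 hs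
      have := mul_le_mul_of_nonneg_left hr.1 ht
      linarith
    · have := mul_le_mul_of_nonneg_left hq.2 hs
      have := mul_le_mul_of_nonneg_left hr.2 ht
      linarith
  refine (measure_mono hM).trans ?_
  have ha : a ≤ a' := by rw [eA] at hq; exact hq.1.trans hq.2
  have hb : b ≤ b' := by rw [eB] at hr; exact hr.1.trans hr.2
  rw [eA, eB, Real.volume_Icc, Real.volume_Icc, Real.volume_Icc, ← ENNReal.ofReal_mul hs,
    ← ENNReal.ofReal_mul ht, ← ENNReal.ofReal_add (mul_nonneg hs (by linarith))
    (mul_nonneg ht (by linarith))]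
  apply ENNReal.ofReal_le_ofReal
  linarith

theorem sq_norm_pos {u : Euc 2} (hu : u ≠ 0) : 0 < u 0 ^ 2 + u 1 ^ 2 := by
  by_contra h
  apply hu
  apply euc_ext
  · have : u 0 = 0 := by nlinarith [sq_nonneg (u 0), sq_nonneg (u 1)]
    simpa
  · have : u 1 = 0 := by nlinarith [sq_nonneg (u 0), sq_nonneg (u 1)]
    simpa

/-- Coordinates in which `u` is the second basis vector. -/
noncomputable def coordEquiv (u : Euc 2) (hu : u ≠ 0) : (ℝ × ℝ) ≃L[ℝ] Euc 2 :=
  LinearEquiv.toContinuousLinearEquiv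
    { toFun := fun x => x.1 • !₂[-u 1, u 0] + x.2 • u
      map_add' := fun x y => by simp only [Prod.fst_add, Prod.snd_add]; module
      map_smul' := fun c x => by simp only [Prod.smul_fst, Prod.smul_snd, RingHom.id_apply]; module
      invFun := fun x => ((u 0 * x 1 - u 1 * x 0) / (u 0 ^ 2 + u 1 ^ 2),
        (u 0 * x 0 + u 1 * x 1) / (u 0 ^ 2 + u 1 ^ 2))
      left_inv := fun x => by
        have := (sq_norm_pos hu).ne'
        ext <;> simp <;> field_simp <;> ring
      right_inv := fun x => by
        have := (sq_norm_pos hu).ne'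
        apply euc_ext <;> simp <;> field_simp <;> ring }

theorem coordEquiv_apply (u : Euc 2) (hu : u ≠ 0) (x : ℝ × ℝ) :
    coordEquiv u hu x = x.1 • !₂[-u 1, u 0] + x.2 • u := rfl

/-- The points `q`, `q + r • u` and `z` lie on one line parallel to `u`, and `z` divides the other
two in the ratio given by `s` and `t`. So `length_combo_le` applies to each slice in direction `u`,
and integrating over the slices gives the area bound. -/
theorem area_combo_le {A B M : Set (Euc 2)} (hA : IsCompact A) (hA' : Convex ℝ A)
    (hB : IsCompact B) (hB' : Convex ℝ B) (hM : MeasurableSet M) {s t : ℝ} (hs : 0 ≤ s)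
    (ht : 0 ≤ t) (hst : s + t = 1) {u : Euc 2} (hu : u ≠ 0)
    (h : ∀ z ∈ M, ∃ q ∈ A, ∃ r : ℝ, q + r • u ∈ B ∧ z = q + (t * r) • u) :
    volume M ≤ ENNReal.ofReal s * volume A + ENNReal.ofReal t * volume B := by
  let T := coordEquiv u hu
  have : (Measure.map T (volume : Measure (ℝ × ℝ))).IsAddHaarMeasure := T.isAddHaarMeasure_map _
  -- The Jacobian of the coordinate change enters only as a common factor of both sides, so
  -- uniqueness of Haar measure suffices and its value is not needed.
  obtain ⟨c, hc⟩ : ∃ c : NNReal, (volume : Measure (Euc 2)) =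
      c • Measure.map T (volume : Measure (ℝ × ℝ)) :=
    ⟨_, Measure.isAddLeftInvariant_eq_smul _ _⟩
  have hTm : Measurable T := T.continuous.measurable
  have hvol : ∀ S : Set (Euc 2), MeasurableSet S →
      volume S = c * ∫⁻ a : ℝ, volume {b : ℝ | T (a, b) ∈ S} := by
    intro S hS
    rw [hc, Measure.smul_apply, Measure.map_apply hTm hS, ENNReal.smul_def, smul_eq_mul, Measure.volume_eq_prod,
      Measure.prod_apply (hTm hS)]
    rfl
  have hslice : ∀ (S : Set (Euc 2)) (a : ℝ), IsCompact S → Convex ℝ S →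
      IsCompact {b : ℝ | T (a, b) ∈ S} ∧ Convex ℝ {b : ℝ | T (a, b) ∈ S} := by
    intro S a hS hS'
    constructor
    · have h1 : IsCompact (T ⁻¹' S) := T.toHomeomorph.isCompact_preimage.2 hS
      refine (h1.image continuous_snd).of_isClosed_subset ?_ ?_
      · exact hS.isClosed.preimage (T.continuous.comp (by fun_prop))
      · intro b hb
        exact ⟨(a, b), hb, rfl⟩
    · intro x hx y hy p q hp hq hpq
      have := hS' hx hy hp hq hpq
      simp only [Set.mem_ofPred_eq]
      convert this using 1
      simp only [T, coordEquiv_apply]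
      obtain rfl : p = 1 - q := by linarith
      simp only [smul_eq_mul]
      module
  rw [hvol M hM, hvol A hA.measurableSet, hvol B hB.measurableSet]
  have hint : ∫⁻ a : ℝ, volume {b : ℝ | T (a, b) ∈ M} ≤
      ENNReal.ofReal s * (∫⁻ a : ℝ, volume {b : ℝ | T (a, b) ∈ A}) +
      ENNReal.ofReal t * (∫⁻ a : ℝ, volume {b : ℝ | T (a, b) ∈ B}) := by
    rw [← lintegral_const_mul' _ _ ENNReal.ofReal_ne_top,
      ← lintegral_const_mul' _ _ ENNReal.ofReal_ne_top, ← lintegral_add_left']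
    · refine lintegral_mono fun a => ?_
      refine length_combo_le (hslice A a hA hA').1 (hslice A a hA hA').2 (hslice B a hB hB').1
        (hslice B a hB hB').2 hs ht ?_
      intro b hb
      obtain ⟨q, hq, r, hr, hz⟩ := h _ hb
      refine ⟨b - t * r, ?_, b - t * r + r, ?_, ?_⟩
      · have : T (a, b - t * r) = q := by
          have hz' : q = T (a, b) - (t * r) • u := by rw [hz]; module
          rw [hz']; simp only [T, coordEquiv_apply]; module
        simpa only [Set.mem_ofPred_eq, this] using hq
      · have : T (a, b - t * r + r) = q + r • u := by
          have hz' : q = T (a, b) - (t * r) • u := by rw [hz]; module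
          rw [hz']; simp only [T, coordEquiv_apply]; module
        simpa only [Set.mem_ofPred_eq, this] using hr
      · obtain rfl : s = 1 - t := by linarith
        ring
    · have : Measurable fun a : ℝ => volume {b : ℝ | T (a, b) ∈ A} :=
        measurable_measure_prodMk_left (hTm hA.measurableSet)
      exact (this.const_mul _).aemeasurable
  calc _ ≤ c * (ENNReal.ofReal s * (∫⁻ a : ℝ, volume {b : ℝ | T (a, b) ∈ A}) +
      ENNReal.ofReal t * (∫⁻ a : ℝ, volume {b : ℝ | T (a, b) ∈ B})) := by gcongr
    _ = _ := by ring

/-- The area of the convex hull of a set and a translated set is a convex function of the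
translation vector. -/
theorem convexOn_area_hull {S S' : Set (Euc 2)} (hS : S.Finite) (hS' : S'.Finite)
    (hne : S.Nonempty) (hne' : S'.Nonempty) :
    ConvexOn ℝ Set.univ
      fun v : Euc 2 => volume.real (convexHull ℝ (S ∪ (fun x => x + v) '' S')) := by
  refine ⟨convex_univ, ?_⟩
  rintro v - v' - s t hs ht hst
  have hfin : ∀ v : Euc 2, (S ∪ (fun x => x + v) '' S').Finite := fun v => hS.union (hS'.image _)
  have hcpt : ∀ v : Euc 2, IsCompact (convexHull ℝ (S ∪ (fun x => x + v) '' S')) := fun v =>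
    (hfin v).isCompact_convexHull (𝕜 := ℝ)
  have hmem : ∀ v z : Euc 2, z ∈ convexHull ℝ (S ∪ (fun x => x + v) '' S') ↔
      ∃ x ∈ convexHull ℝ S, ∃ y ∈ convexHull ℝ S', ∃ p q : ℝ, 0 ≤ p ∧ 0 ≤ q ∧ p + q = 1 ∧
        p • x + q • (y + v) = z := by
    intro v z
    have himg : convexHull ℝ ((fun x => x + v) '' S') = (fun x => x + v) '' convexHull ℝ S' :=
      ((AffineEquiv.vaddConst ℝ v).toAffineMap.image_convexHull S').symm
    rw [convexHull_union hne (hne'.image _), mem_convexJoin, himg]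
    simp only [Set.exists_mem_image]
    rfl
  by_cases hu : v' - v = 0
  · obtain rfl : v' = v := sub_eq_zero.1 hu
    have : s • v' + t • v' = v' := by rw [← add_smul, hst, one_smul]
    simp only [this, smul_eq_mul, ← add_mul, hst, one_mul, le_refl]
  -- The point `p • x + q • (y + v)` moves by `q • (v' - v)` when `v` is replaced by `v'`. All
  -- points thus move linearly in the single direction `v' - v`, with `r = q`.
  have key := area_combo_le (hcpt v) (convex_convexHull ℝ _) (hcpt v') (convex_convexHull ℝ _)
    (hcpt (s • v + t • v')).measurableSet hs ht hst hu (by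
      intro z hz
      obtain ⟨x, hx, y, hy, p, q, hp, hq, hpq, rfl⟩ := (hmem _ _).1 hz
      refine ⟨p • x + q • (y + v), (hmem _ _).2 ⟨x, hx, y, hy, p, q, hp, hq, hpq, rfl⟩, q,
        (hmem _ _).2 ⟨x, hx, y, hy, p, q, hp, hq, hpq, ?_⟩, ?_⟩
      · module
      · obtain rfl : s = 1 - t := by linarith
        module)
  have f1 := finite_hull_ne_top (hfin v)
  have f2 := finite_hull_ne_top (hfin v')
  have := ENNReal.toReal_mono (ENNReal.add_ne_top.2 ⟨ENNReal.mul_ne_top ENNReal.ofReal_ne_top f1,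
    ENNReal.mul_ne_top ENNReal.ofReal_ne_top f2⟩) key
  rw [ENNReal.toReal_add (ENNReal.mul_ne_top ENNReal.ofReal_ne_top f1)
    (ENNReal.mul_ne_top ENNReal.ofReal_ne_top f2), ENNReal.toReal_mul, ENNReal.toReal_mul,
    ENNReal.toReal_ofReal hs, ENNReal.toReal_ofReal ht] at this
  exact this

/-! ### Hull of a convex set and its translate -/

open scoped Pointwise

theorem area_quad {a b c d : Euc 2} (h1 : 0 ≤ tri a b c) (h2 : 0 ≤ tri a b d) (h3 : 0 ≤ tri a c d)
    (h4 : 0 ≤ tri b c d) :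
    volume.real (convexHull ℝ {a, b, c, d}) = (tri a b c + tri a c d) / 2 := by
  have h := shoelace 2 ![a, b, c, d] (by
    intro i j k hij hjk
    fin_cases i <;> fin_cases j <;> fin_cases k <;> simp at hij hjk ⊢ <;> assumption)
  simp only [Fin.sum_univ_two] at h
  rw [show Set.range ![a, b, c, d] = {a, b, c, d} by
    simp only [Matrix.range_cons, Matrix.range_empty, Set.singleton_union, insert_empty_eq]] at h
  exact h

theorem tri_add_right (a b x v : Euc 2) : tri a b (x + v) = tri a b x + dd (b - a) v := by
  simp [tri, dd]; ring

theorem dd_smul (u x : Euc 2) (c : ℝ) : dd u (c • x) = c * dd u x := (ddL u).map_smul c x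

theorem dd_self (u : Euc 2) : dd u u = 0 := by simp [dd]; ring

theorem dd_neg_comm (u v : Euc 2) : dd u v = -dd v u := by simp [dd]; ring

theorem area_translate (K : Set (Euc 2)) (v : Euc 2) :
    volume.real ((fun x => x + v) '' K) = volume.real K := by
  simp [Measure.real, Set.image_add_right, measure_preimage_add_right]

theorem hull_union_ne_top {K K' : Set (Euc 2)} (hK : IsCompact K) (hK' : IsCompact K') :
    volume (convexHull ℝ (K ∪ K')) ≠ ⊤ :=
  (isBounded_convexHull.2 (hK.union hK').isBounded).measure_lt_top.ne

theorem dd_add (u x y : Euc 2) : dd u (x + y) = dd u x + dd u y := (ddL u).map_add x y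

theorem image_add_hull_subset {K : Set (Euc 2)} (hK : Convex ℝ K) (v : Euc 2) :
    ∀ z ∈ convexHull ℝ (K ∪ (fun x => x + v) '' K), ∃ k ∈ K, ∃ s : ℝ, 0 ≤ s ∧ s ≤ 1 ∧
      z = k + s • v := by
  intro z hz
  have : convexHull ℝ (K ∪ (fun x => x + v) '' K) ⊆ K + segment ℝ 0 v := by
    refine convexHull_min ?_ (hK.add (convex_segment 0 v))
    rintro x (hx | ⟨x, hx, rfl⟩)
    · exact ⟨x, hx, 0, left_mem_segment ℝ 0 v, add_zero x⟩
    · exact ⟨x, hx, v, right_mem_segment ℝ 0 v, rfl⟩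
  obtain ⟨k, hk, w, ⟨p, q, hp, hq, hpq, rfl⟩, rfl⟩ := this hz
  exact ⟨k, hk, q, hq, by linarith, by simp⟩

/-- The chord `xy` cuts `K` into two parts. When `dd v (x - y)` is positive, the hull contains one
part, the parallelogram swept by the chord, and the other part shifted by `v`; these do not overlap.
-/
theorem area_hull_translate_ge {K : Set (Euc 2)} (hKc : IsCompact K)
    {x y : Euc 2} (hx : x ∈ K) (hy : y ∈ K) (v : Euc 2) :
    volume.real K + dd v (x - y) ≤ volume.real (convexHull ℝ (K ∪ (fun x => x + v) '' K)) := by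
  set C := convexHull ℝ (K ∪ (fun x => x + v) '' K) with hC
  have hcont : Continuous fun x : Euc 2 => x + v := by fun_prop
  have hCtop : volume C ≠ ⊤ := hull_union_ne_top hKc (hKc.image hcont)
  have hKC : K ⊆ C := Set.subset_union_left.trans (subset_convexHull ℝ _)
  have hKC' : (fun x => x + v) '' K ⊆ C := Set.subset_union_right.trans (subset_convexHull ℝ _)
  rcases le_or_gt (dd v (x - y)) 0 with hD | hD
  · have := measureReal_mono hKC hCtop
    linarith
  have hxy : y ≠ x := by rintro rfl; simp [dd] at hD
  have hf := ddL_ne_zero (sub_ne_zero.2 hxy.symm)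
  have hDv : dd (x - y) v < 0 := by rw [dd_neg_comm]; linarith
  let Q := convexHull ℝ {x, y, x + v, y + v}
  have hQC : Q ⊆ C := by
    refine convexHull_min ?_ (convex_convexHull ℝ _)
    rintro p (rfl | rfl | rfl | rfl)
    exacts [hKC hx, hKC hy, hKC' ⟨x, hx, rfl⟩, hKC' ⟨y, hy, rfl⟩]
  have hQ : dd v (x - y) ≤ volume.real Q := by
    have := four_point_area (convex_convexHull ℝ {x, y, x + v, y + v})
      (finite_hull_ne_top (by simp)) (a := x + v) (b := y) (x := x) (y := y + v)
      (subset_convexHull ℝ _ (by simp)) (subset_convexHull ℝ _ (by simp))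
      (subset_convexHull ℝ _ (by simp)) (subset_convexHull ℝ _ (by simp))
    have h2 := (abs_le.1 this).2
    have : dd (x + v - y) (x - (y + v)) = 2 * dd v (x - y) := by simp [dd]; ring
    linarith
  have hcut : ∀ p, tri y x p = ddL (x - y) p - ddL (x - y) y := tri_eq_ddL y x
  have h1 := area_add_le hf (ddL (x - y) y) hCtop (S := C ∩ {p | tri y x p ≤ 0})
    (T := K ∩ {p | 0 ≤ tri y x p}) Set.inter_subset_left (Set.inter_subset_left.trans hKC)
    (fun p hp => by have := hp.2; simp only [Set.mem_ofPred_eq, hcut] at this; linarith)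
    (fun p hp => by have := hp.2; simp only [Set.mem_ofPred_eq, hcut] at this; linarith)
  -- The second cut is along the shifted chord line, which separates the parallelogram from the
  -- shifted part of `K`.
  have h2 := area_add_le hf (ddL (x - y) (y + v)) (C := C ∩ {p | tri y x p ≤ 0})
    (S := (fun x => x + v) '' (K ∩ {p | tri y x p ≤ 0})) (T := Q)
    ((measure_mono Set.inter_subset_left).trans_lt hCtop.lt_top).ne
    (by
      rintro _ ⟨p, ⟨hp, hp'⟩, rfl⟩
      refine ⟨hKC' ⟨p, hp, rfl⟩, ?_⟩
      simp only [Set.mem_ofPred_eq] at hp' ⊢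
      rw [tri_add_right]; linarith)
    (fun p hp => ⟨hQC hp, tri_nonpos_of_mem_hull (by
      rintro p (rfl | rfl | rfl | rfl)
      · exact (tri_self₂ _ _).le
      · exact (tri_self₁ _ _).le
      · rw [tri_add_right, tri_self₂]; linarith
      · rw [tri_add_right, tri_self₁]; linarith) p hp⟩)
    (by
      rintro _ ⟨p, ⟨hp, hp'⟩, rfl⟩
      simp only [Set.mem_ofPred_eq, hcut] at hp'
      simp only [map_add]; linarith)
    (fun p hp => by
      refine convexHull_min (t := {z | ddL (x - y) (y + v) ≤ ddL (x - y) z}) ?_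
        (convex_halfSpace_ge (ddL (x - y)).isLinear _) hp
      have hxy' : dd (x - y) x = dd (x - y) y := by simp [dd]; ring
      rintro p (rfl | rfl | rfl | rfl) <;>
        simp only [Set.mem_ofPred_eq, ddL_apply, dd_add, hxy'] <;> linarith)
  have h3 : volume.real K ≤ volume.real (K ∩ {p | tri y x p ≤ 0}) +
      volume.real (K ∩ {p | 0 ≤ tri y x p}) := by
    refine area_le_cut ?_ ?_ ?_
    · exact ((measure_mono Set.inter_subset_left).trans_lt hKc.measure_lt_top).ne
    · exact ((measure_mono Set.inter_subset_left).trans_lt hKc.measure_lt_top).ne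
    · intro p hp
      rcases le_total (tri y x p) 0 with h | h
      exacts [Or.inl ⟨hp, h⟩, Or.inr ⟨hp, h⟩]
  rw [area_translate] at h2
  linarith

theorem exists_smul_of_dd_eq_zero {v p : Euc 2} (hv : v ≠ 0) (h : dd v p = 0) :
    ∃ r : ℝ, p = r • v := by
  have hn := (sq_norm_pos hv).ne'
  refine ⟨(v 0 * p 0 + v 1 * p 1) / (v 0 ^ 2 + v 1 ^ 2), ?_⟩
  simp only [dd] at h
  apply euc_ext <;> simp only [PiLp.smul_apply, smul_eq_mul] <;> field_simp
  · linear_combination -v 1 * h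
  · linear_combination v 0 * h

/-- Take `x`, `y` on the two support lines of `K` parallel to `v`. Every line parallel to `v` that
meets `K` then meets the chord `xy`, so the three pieces of the lower bound cover the whole hull. -/
theorem area_hull_translate_le {K : Set (Euc 2)} (hK : Convex ℝ K) (hKc : IsCompact K)
    (hne : K.Nonempty) (v : Euc 2) {M : ℝ} (hM : ∀ x ∈ K, ∀ y ∈ K, dd v (x - y) ≤ M) :
    volume.real (convexHull ℝ (K ∪ (fun x => x + v) '' K)) ≤ volume.real K + M := by
  set C := convexHull ℝ (K ∪ (fun x => x + v) '' K) with hC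
  have hM0 : 0 ≤ M := by
    obtain ⟨x, hx⟩ := hne
    have := hM x hx x hx
    simpa [dd] using this
  by_cases hv : v = 0
  · subst hv
    have : C = K := by simp [hC, hK.convexHull_eq]
    rw [this]; linarith
  have hc : Continuous fun x : Euc 2 => dd v x := by unfold dd; fun_prop
  obtain ⟨x, hx, hxmax⟩ := hKc.exists_isMaxOn hne hc.continuousOn
  obtain ⟨y, hy, hymin⟩ := hKc.exists_isMinOn hne hc.continuousOn
  have hlv : ∀ k ∈ K, dd v y ≤ dd v k ∧ dd v k ≤ dd v x := fun k hk => ⟨hymin hk, hxmax hk⟩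
  -- Zero width means that `K` lies on a line parallel to `v`, and the hull stays on that line.
  rcases (hlv x hx).1.eq_or_lt with heq | hlt
  · have : volume C = 0 := by
      refine measure_mono_null ?_ (line_null (ddL_ne_zero hv) (dd v y))
      intro z hz
      obtain ⟨k, hk, s, -, -, rfl⟩ := image_add_hull_subset hK v z hz
      simp only [Set.mem_ofPred_eq, ddL_apply, dd_add, dd_smul, dd_self, mul_zero, add_zero]
      linarith [hlv k hk]
    have h0 : volume.real C = 0 := by simp [Measure.real, this]
    rw [h0]
    have : 0 ≤ volume.real K := measureReal_nonneg
    linarith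
  set D := dd v (x - y) with hDdef
  have hD : D = dd v x - dd v y := dd_sub _ _ _
  have hDpos : 0 < D := by linarith
  have hDv : dd (x - y) v = -D := dd_neg_comm _ _
  have hxy : y ≠ x := by rintro rfl; exact lt_irrefl _ hlt
  have hf := ddL_ne_zero (sub_ne_zero.2 hxy.symm)
  have hcut : ∀ p, tri y x p = ddL (x - y) p - ddL (x - y) y := tri_eq_ddL y x
  let Q := convexHull ℝ {y, y + v, x + v, x}
  have hQ : volume.real Q = D := by
    have e : ∀ a b : Euc 2, dd (a - b) v = -dd v (a - b) := fun a b => dd_neg_comm _ _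
    have f1 : tri y (y + v) (x + v) = D := by simp [hDdef, tri, dd]; ring
    have f2 : tri y (y + v) x = D := by simp [hDdef, tri, dd]
    have f3 : tri y (x + v) x = D := by simp [hDdef, tri, dd]; ring
    have f4 : tri (y + v) (x + v) x = D := by simp [hDdef, tri, dd]; ring
    rw [area_quad (by rw [f1]; exact hDpos.le) (by rw [f2]; exact hDpos.le)
      (by rw [f3]; exact hDpos.le) (by rw [f4]; exact hDpos.le), f1, f3]
    ring
  let Kp := K ∩ {p | 0 ≤ tri y x p}
  let Km := K ∩ {p | tri y x p ≤ 0}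
  have hKp : volume Kp ≠ ⊤ :=
    ((measure_mono Set.inter_subset_left).trans_lt hKc.measure_lt_top).ne
  have hKm : volume ((fun x => x + v) '' Km) ≠ ⊤ := by
    rw [Set.image_add_right, measure_preimage_add_right]
    exact ((measure_mono Set.inter_subset_left).trans_lt hKc.measure_lt_top).ne
  have hQt : volume Q ≠ ⊤ := finite_hull_ne_top (by simp)
  have hsum : volume.real Km + volume.real Kp ≤ volume.real K :=
    area_add_le hf (ddL (x - y) y) hKc.measure_lt_top.ne Set.inter_subset_left
      Set.inter_subset_left
      (fun p hp => by have := hp.2; simp only [Set.mem_ofPred_eq, hcut] at this; linarith)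
      (fun p hp => by have := hp.2; simp only [Set.mem_ofPred_eq, hcut] at this; linarith)
  have hcov : C ⊆ Kp ∪ (Q ∪ (fun x => x + v) '' Km) := by
    intro z hz
    obtain ⟨k, hk, s, hs0, hs1, rfl⟩ := image_add_hull_subset hK v z hz
    set τ := (dd v k - dd v y) / D with hτ
    have hτ0 : 0 ≤ τ := div_nonneg (by linarith [hlv k hk]) hDpos.le
    have hτ1 : τ ≤ 1 := by rw [hτ, div_le_one hDpos]; linarith [hlv k hk]
    have hτD : τ * D = dd v k - dd v y := by rw [hτ]; field_simp
    set p := (1 - τ) • y + τ • x with hp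
    have hpK : p ∈ K := hK hy hx (by linarith) hτ0 (by ring)
    obtain ⟨r, hr⟩ := exists_smul_of_dd_eq_zero hv (p := k - p) (by
      have : dd v p = (1 - τ) * dd v y + τ * dd v x := by
        rw [hp]; simp [dd]; ring
      rw [dd_sub, this, sub_eq_zero]; linear_combination -hτD + τ * hD)
    have hkp : k = p + r • v := by rw [← hr]; abel
    have htri : ∀ c : ℝ, tri y x (p + c • v) = -(c * D) := by
      intro c
      rw [tri_add_right, dd_smul, hDv, hp, tri_combo _ _ _ _ (by ring), tri_self₁, tri_self₂]
      ring
    have hmem : ∀ c : ℝ, (0 ≤ c ∧ c ≤ r ∨ r ≤ c ∧ c ≤ 0) → p + c • v ∈ K := by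
      intro c hc
      by_cases hr0 : r = 0
      · have : c = 0 := by rcases hc with h | h <;> linarith
        rw [this, zero_smul, add_zero]; exact hpK
      · have := hK hpK hk (a := 1 - c / r) (b := c / r) (by
          rw [sub_nonneg]
          rcases hc with h | h
          · exact div_le_one_of_le₀ h.2 (by linarith)
          · exact div_le_one_of_ge h.1 (by linarith)) (by
          rcases hc with h | h
          · exact div_nonneg h.1 (by linarith)
          · exact div_nonneg_of_nonpos h.2 (by linarith)) (by ring)
        convert this using 1
        have h5 : c / r * r = c := by field_simp
        clear_value p
        rw [hkp, smul_add, smul_smul, h5]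
        module
    have hz' : k + s • v = p + (r + s) • v := by rw [hkp]; module
    rw [hz']
    -- The point is `p + (r + s) • v` with `p` on the chord: it lies in `K` if `r + s ≤ 0`, in the
    -- parallelogram if `0 ≤ r + s ≤ 1`, and in the shifted part of `K` beyond that.
    rcases le_total (r + s) 0 with h1 | h1
    · left
      refine ⟨hmem _ (Or.inr ⟨by linarith, h1⟩), ?_⟩
      simp only [Set.mem_ofPred_eq, htri]; nlinarith
    · right
      rcases le_total (r + s) 1 with h2 | h2
      · left
        have hp1 : p ∈ Q := (convex_convexHull ℝ _) (subset_convexHull ℝ _ (by simp))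
          (subset_convexHull ℝ _ (by simp)) (by linarith) hτ0 (by ring)
        have hp2 : p + v ∈ Q := by
          have := (convex_convexHull ℝ {y, y + v, x + v, x}) (x := y + v) (y := x + v)
            (subset_convexHull ℝ _ (by simp))
            (subset_convexHull ℝ _ (by simp)) (sub_nonneg.2 hτ1) hτ0 (by ring)
          convert this using 1
          rw [hp]; module
        have := (convex_convexHull ℝ {y, y + v, x + v, x}) hp1 hp2 (sub_nonneg.2 h2) h1 (by ring)
        convert this using 1
        module
      · right
        refine ⟨p + (r + s - 1) • v, ⟨hmem _ (Or.inl ⟨by linarith, by linarith⟩), ?_⟩, ?_⟩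
        · simp only [Set.mem_ofPred_eq, htri]; nlinarith
        · module
  have h1 := area_le_cut hKp (measure_union_lt_top hQt.lt_top hKm.lt_top).ne hcov
  have h2 := measureReal_union_le (μ := volume) Q ((fun x => x + v) '' Km)
  rw [area_translate, hQ] at h2
  have := hM x hx y hy
  linarith

/-! ### The translation constant; triangles and quadrangles -/

theorem area_le_relHull_mul {S : Set (Euc 2 ≃ᵢ Euc 2)} {K : Set (Euc 2)}
    (hK : Bornology.IsBounded K) (hvol : 0 < volume.real K) {σ : Euc 2 ≃ᵢ Euc 2} (hσ : σ ∈ S)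
    (hne : (K ∩ σ '' K).Nonempty) :
    volume.real (convexHull ℝ (K ∪ σ '' K)) ≤ relHull S K * volume.real K := by
  have := le_csSup (bddAbove_hullVolumes S hK) ⟨σ, hσ, hne, rfl⟩
  rw [relHull]
  calc _ ≤ sSup (hullVolumes S K) := this
    _ = _ := by field_simp

theorem relHull_le {S : Set (Euc 2 ≃ᵢ Euc 2)} {K : Set (Euc 2)} (hvol : 0 < volume.real K)
    (hex : ∃ σ ∈ S, (K ∩ σ '' K).Nonempty) {c : ℝ}
    (h : ∀ σ ∈ S, (K ∩ σ '' K).Nonempty →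
      volume.real (convexHull ℝ (K ∪ σ '' K)) ≤ c * volume.real K) : relHull S K ≤ c := by
  obtain ⟨σ, hσ, hne⟩ := hex
  have : sSup (hullVolumes S K) ≤ c * volume.real K := by
    refine csSup_le ⟨_, σ, hσ, hne, rfl⟩ ?_
    rintro x ⟨τ, hτ, hne', rfl⟩
    exact h τ hτ hne'
  rw [relHull, one_div, inv_mul_le_iff₀ hvol, mul_comm]
  exact this

/-- Translation by `p - q` carries `q` to `p`, so it is admissible. -/
theorem le_cTr_mul {K : Set (Euc 2)} (hKc : IsCompact K) (hvol : 0 < volume.real K)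
    {p q x y : Euc 2} (hp : p ∈ K) (hq : q ∈ K) (hx : x ∈ K) (hy : y ∈ K) :
    volume.real K + dd (p - q) (x - y) ≤ cTr K * volume.real K := by
  refine (area_hull_translate_ge hKc hx hy (p - q)).trans ?_
  exact area_le_relHull_mul (σ := IsometryEquiv.addRight (p - q)) hKc.isBounded hvol ⟨_, rfl⟩
    ⟨p, hp, q, hq, by simp⟩

theorem cTr_le {K : Set (Euc 2)} (hK : Convex ℝ K) (hKc : IsCompact K)
    (hvol : 0 < volume.real K) {M c : ℝ}
    (hM : ∀ p ∈ K, ∀ q ∈ K, ∀ x ∈ K, ∀ y ∈ K, dd (p - q) (x - y) ≤ M)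
    (hc : volume.real K + M ≤ c * volume.real K) : cTr K ≤ c := by
  have hne : K.Nonempty := by
    by_contra h
    rw [Set.not_nonempty_iff_eq_empty] at h
    simp [h] at hvol
  refine relHull_le hvol ?_ ?_
  · obtain ⟨x, hx⟩ := hne
    exact ⟨IsometryEquiv.addRight 0, ⟨0, rfl⟩, x, hx, x, hx, by simp⟩
  · rintro σ ⟨v, rfl⟩ ⟨p, hp, q, hq, hpq⟩
    have hv : v = p - q := by
      rw [← hpq]; simp
    subst hv
    exact (area_hull_translate_le hK hKc hne _ fun x hx y hy => hM p hp q hq x hx y hy).trans hc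

theorem cTr_le_three {K : Set (Euc 2)} (hK : Convex ℝ K) (hKc : IsCompact K)
    (hvol : 0 < volume.real K) : cTr K ≤ 3 :=
  cTr_le hK hKc hvol (fun _ hp _ hq _ hx _ hy => (abs_le.1 (four_point_area hK
    hKc.measure_lt_top.ne hp hq hx hy)).2) (by linarith)

theorem isCompact_hull_range {n : ℕ} (w : Fin n → Euc 2) :
    IsCompact (convexHull ℝ (Set.range w)) := (Set.finite_range w).isCompact_convexHull (𝕜 := ℝ)

theorem mem_hull_range {n : ℕ} (w : Fin n → Euc 2) (i : Fin n) :
    w i ∈ convexHull ℝ (Set.range w) := subset_convexHull ℝ _ ⟨i, rfl⟩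

/-- Strictly counterclockwise vertex sequences. -/
def IsCCW {n : ℕ} (w : Fin n → Euc 2) : Prop :=
  ∀ i j k, i < j → j < k → 0 < tri (w i) (w j) (w k)

theorem IsCCW.area {n : ℕ} {w : Fin (n + 2) → Euc 2} (hw : IsCCW w) :
    volume.real (convexHull ℝ (Set.range w)) =
      (∑ i : Fin n, tri (w 0) (w i.succ.castSucc) (w i.succ.succ)) / 2 :=
  shoelace n w fun i j k hij hjk => (hw i j k hij hjk).le

theorem IsCCW.area_pos {n : ℕ} {w : Fin (n + 3) → Euc 2} (hw : IsCCW w) :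
    0 < volume.real (convexHull ℝ (Set.range w)) := by
  rw [hw.area]
  refine div_pos (Finset.sum_pos (fun i _ => hw _ _ _ ?_ ?_) Finset.univ_nonempty) two_pos
  · simp [Fin.lt_def]
  · simp [Fin.lt_def]

theorem IsCCW.area_three {w : Fin 3 → Euc 2} (hw : IsCCW w) :
    volume.real (convexHull ℝ (Set.range w)) = tri (w 0) (w 1) (w 2) / 2 := by
  have := hw.area
  simpa using this

theorem IsCCW.area_four {w : Fin 4 → Euc 2} (hw : IsCCW w) :
    volume.real (convexHull ℝ (Set.range w)) =
      (tri (w 0) (w 1) (w 2) + tri (w 0) (w 2) (w 3)) / 2 := by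
  have := hw.area
  rwa [Fin.sum_univ_two] at this

theorem IsCCW.area_five {w : Fin 5 → Euc 2} (hw : IsCCW w) :
    volume.real (convexHull ℝ (Set.range w)) =
      (tri (w 0) (w 1) (w 2) + tri (w 0) (w 2) (w 3) + tri (w 0) (w 3) (w 4)) / 2 := by
  have := hw.area
  rwa [Fin.sum_univ_three] at this

theorem cTr_three {w : Fin 3 → Euc 2} (hw : IsCCW w) :
    cTr (convexHull ℝ (Set.range w)) = 3 := by
  have hpos := hw.area_pos
  refine le_antisymm (cTr_le_three (convex_convexHull ℝ _) (isCompact_hull_range w) hpos) ?_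
  have h := le_cTr_mul (isCompact_hull_range w) hpos (mem_hull_range w 1)
    (mem_hull_range w 0) (mem_hull_range w 2) (mem_hull_range w 0)
  have e : dd (w 1 - w 0) (w 2 - w 0) = 2 * volume.real (convexHull ℝ (Set.range w)) := by
    rw [hw.area_three, tri]; ring
  rw [e] at h
  exact le_of_mul_le_mul_right (by linarith) hpos

/-- The determinant of the two diagonals is exactly twice the area, so every convex quadrangle
attains the four-point bound. -/
theorem cTr_four {w : Fin 4 → Euc 2} (hw : IsCCW w) :
    cTr (convexHull ℝ (Set.range w)) = 3 := by
  have hpos := hw.area_pos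
  refine le_antisymm (cTr_le_three (convex_convexHull ℝ _) (isCompact_hull_range w) hpos) ?_
  have h := le_cTr_mul (isCompact_hull_range w) hpos (mem_hull_range w 2)
    (mem_hull_range w 0) (mem_hull_range w 3) (mem_hull_range w 1)
  have e : dd (w 2 - w 0) (w 3 - w 1) = 2 * volume.real (convexHull ℝ (Set.range w)) := by
    rw [hw.area_four]; simp [tri, dd]; ring
  rw [e] at h
  exact le_of_mul_le_mul_right (by linarith) hpos

/-- The determinant is affine in each of the four points separately, so an upper bound passes from
`T` to its hull one argument at a time. -/
theorem hull_dd_le {T : Set (Euc 2)} {M : ℝ}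
    (h : ∀ p ∈ T, ∀ q ∈ T, ∀ x ∈ T, ∀ y ∈ T, dd (p - q) (x - y) ≤ M) :
    ∀ p ∈ convexHull ℝ T, ∀ q ∈ convexHull ℝ T, ∀ x ∈ convexHull ℝ T, ∀ y ∈ convexHull ℝ T,
      dd (p - q) (x - y) ≤ M := by
  have ext : ∀ f : Euc 2 → ℝ, (∀ a b : Euc 2, ∀ s t : ℝ, s + t = 1 →
      f (s • a + t • b) = s * f a + t * f b) → (∀ a ∈ T, f a ≤ M) →
      ∀ a ∈ convexHull ℝ T, f a ≤ M := by
    intro f hf hT a ha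
    refine convexHull_min (t := {z | f z ≤ M}) hT ?_ ha
    intro a ha b hb s t hs ht hst
    simp only [Set.mem_ofPred_eq] at *
    rw [hf a b s t hst]
    calc s * f a + t * f b ≤ s * M + t * M := by gcongr
      _ = M := by rw [← add_mul, hst, one_mul]
  have aff : ∀ s t : ℝ, s + t = 1 → t = 1 - s := fun s t h => by linarith
  intro p hp q hq x hx y hy
  refine ext (fun p => dd (p - q) (x - y)) (fun a b s t hst => by
    rw [aff s t hst]; simp [dd]; ring) (fun p hp => ?_) p hp
  refine ext (fun q => dd (p - q) (x - y)) (fun a b s t hst => by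
    rw [aff s t hst]; simp [dd]; ring) (fun q hq => ?_) q hq
  refine ext (fun x => dd (p - q) (x - y)) (fun a b s t hst => by
    rw [aff s t hst]; simp [dd]; ring) (fun x hx => ?_) x hx
  exact ext (fun y => dd (p - q) (x - y)) (fun a b s t hst => by
    rw [aff s t hst]; simp [dd]; ring) (fun y hy => h p hp q hq x hx y hy) y hy

/-! ### The golden pentagon -/

/-- The golden ratio. -/
noncomputable def phi : ℝ := (1 + √5) / 2

theorem phi_sq : phi ^ 2 = phi + 1 := by
  have := Real.sq_sqrt (show (0 : ℝ) ≤ 5 by norm_num)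
  rw [phi]; linarith

theorem phi_bounds : (1.6 : ℝ) < phi ∧ phi < 1.62 := by
  have h := phi_sq
  have h0 : 0 < phi := by rw [phi]; positivity
  constructor <;> nlinarith

/-- An affine regular pentagon with vertices in `ℚ(√5)`. -/
noncomputable def goldenPentagon : Fin 5 → Euc 2 :=
  ![!₂[0, 0], !₂[1, 0], !₂[phi, 1], !₂[1, phi], !₂[0, 1]]

theorem goldenPentagon_isCCW : IsCCW goldenPentagon := by
  have h := phi_sq
  obtain ⟨h1, h2⟩ := phi_bounds
  intro i j k hij hjk
  fin_cases i <;> fin_cases j <;> fin_cases k <;> simp at hij hjk <;>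
    simp [goldenPentagon, tri_def] <;> nlinarith

theorem goldenPentagon_convexIndependent : ConvexIndependent ℝ goldenPentagon := by
  have h := phi_sq
  obtain ⟨h1, h2⟩ := phi_bounds
  refine convexIndependent_of_separated fun i => ⟨goldenPentagon (i - 1), goldenPentagon (i + 1),
    ?_, ?_⟩
  · fin_cases i <;> simp [goldenPentagon, tri_def] <;> nlinarith
  · intro j hj
    fin_cases i <;> fin_cases j <;> simp at hj <;> simp [goldenPentagon, tri_def] <;> nlinarith

theorem goldenPentagon_area :
    volume.real (convexHull ℝ (Set.range goldenPentagon)) = (phi + 2) / 2 := by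
  have h := phi_sq
  rw [goldenPentagon_isCCW.area_five]
  simp [goldenPentagon, tri_def]
  linarith

/-- Up to sign there are only the zero vector, five sides and five diagonals, which turns the check
over four vertices into a check over pairs from a list of eleven vectors. -/
theorem goldenPentagon_diff (i j : Fin 5) : ∃ s : ℝ, (s = 1 ∨ s = -1) ∧
    ∃ d ∈ ({(0, 0), (1, 0), (0, 1), (phi, 1), (1, phi), (phi - 1, 1), (0, phi), (1, -1), (phi, 0),
      (phi - 1, 1 - phi), (1, phi - 1)} : Set (ℝ × ℝ)),
      (goldenPentagon i - goldenPentagon j) 0 = s * d.1 ∧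
      (goldenPentagon i - goldenPentagon j) 1 = s * d.2 := by
  have key : ∀ d ∈ ({(0, 0), (1, 0), (0, 1), (phi, 1), (1, phi), (phi - 1, 1), (0, phi), (1, -1),
      (phi, 0), (phi - 1, 1 - phi), (1, phi - 1)} : Set (ℝ × ℝ)), ∀ e : Euc 2,
      (e 0 = d.1 ∧ e 1 = d.2 ∨ e 0 = -d.1 ∧ e 1 = -d.2) → ∃ s : ℝ, (s = 1 ∨ s = -1) ∧
    ∃ d ∈ ({(0, 0), (1, 0), (0, 1), (phi, 1), (1, phi), (phi - 1, 1), (0, phi), (1, -1), (phi, 0),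
      (phi - 1, 1 - phi), (1, phi - 1)} : Set (ℝ × ℝ)), e 0 = s * d.1 ∧ e 1 = s * d.2 := by
    rintro d hd e (⟨h0, h1⟩ | ⟨h0, h1⟩)
    · exact ⟨1, Or.inl rfl, d, hd, by simp [h0], by simp [h1]⟩
    · exact ⟨-1, Or.inr rfl, d, hd, by simp [h0], by simp [h1]⟩
  let M : Fin 5 → Fin 5 → ℝ × ℝ :=
    ![![(0, 0), (1, 0), (phi, 1), (1, phi), (0, 1)],
      ![(1, 0), (0, 0), (phi - 1, 1), (0, phi), (1, -1)],
      ![(phi, 1), (phi - 1, 1), (0, 0), (phi - 1, 1 - phi), (phi, 0)],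
      ![(1, phi), (0, phi), (phi - 1, 1 - phi), (0, 0), (1, phi - 1)],
      ![(0, 1), (1, -1), (phi, 0), (1, phi - 1), (0, 0)]]
  refine key (M i j) ?_ _ ?_
  · fin_cases i <;> fin_cases j <;> simp [M]
  · fin_cases i <;> fin_cases j <;> simp [M, goldenPentagon]

theorem cTr_goldenPentagon_le :
    cTr (convexHull ℝ (Set.range goldenPentagon)) ≤ (9 + 2 * phi) / 5 := by
  have h := phi_sq
  obtain ⟨h1, h2⟩ := phi_bounds
  -- The largest determinant is `phi + 1 = phi ^ 2`, attained by the diagonals `(phi, 0)` and `(0,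
  -- phi)`.
  refine cTr_le (convex_convexHull ℝ _) (isCompact_hull_range _) goldenPentagon_isCCW.area_pos
    (M := phi + 1) (hull_dd_le ?_) ?_
  · rintro _ ⟨i, rfl⟩ _ ⟨j, rfl⟩ _ ⟨k, rfl⟩ _ ⟨l, rfl⟩
    obtain ⟨s, hs, d, hd, hd0, hd1⟩ := goldenPentagon_diff i j
    obtain ⟨t, ht, e, he, he0, he1⟩ := goldenPentagon_diff k l
    have key : |d.1 * e.2 - d.2 * e.1| ≤ phi + 1 := by
      rw [abs_le]
      rcases hd with rfl | rfl | rfl | rfl | rfl | rfl | rfl | rfl | rfl | rfl | rfl <;>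
      rcases he with rfl | rfl | rfl | rfl | rfl | rfl | rfl | rfl | rfl | rfl | rfl <;>
      constructor <;> linarith
    rw [abs_le] at key
    rw [dd, hd0, hd1, he0, he1]
    rcases hs with rfl | rfl <;> rcases ht with rfl | rfl <;> linarith
  · rw [goldenPentagon_area]; linarith

/-! ### Recognizing affine regular polygons -/

/-- The affine map with origin `o` and columns `p`, `q`. -/
noncomputable def frameEquiv (o p q : Euc 2) (h : dd p q ≠ 0) : Euc 2 ≃ᵃ[ℝ] Euc 2 :=
  ((frameL p q).equivOfDetNeZero (by rwa [frameL_det])).toAffineEquiv.trans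
    (AffineEquiv.constVAdd ℝ (Euc 2) o)

/-- The vertices of the standard regular `m`-gon. -/
noncomputable def stdVertex (m : ℕ) (k : Fin m) : Euc 2 :=
  !₂[Real.cos (2 * Real.pi * (k : ℝ) / m), Real.sin (2 * Real.pi * (k : ℝ) / m)]

/-- Two polygons with the same coordinates `n` in two affine frames correspond under the map that
takes one frame to the other. -/
theorem isAffineRegularGon_of_frame {m : ℕ} {w n : Fin m → Euc 2} {o p q o' p' q' : Euc 2}
    (h : dd p q ≠ 0) (h' : dd p' q' ≠ 0)
    (hw : ∀ k, w k = o + (n k 0 • p + n k 1 • q))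
    (hs : ∀ k, stdVertex m k = o' + (n k 0 • p' + n k 1 • q')) :
    IsAffineRegularGon m (convexHull ℝ (Set.range w)) := by
  have hw' : convexHull ℝ (Set.range w) =
      frameEquiv o p q h '' convexHull ℝ (Set.range n) := by
    have := (frameEquiv o p q h).toAffineMap.image_convexHull (Set.range n)
    rw [← Set.range_comp] at this
    rw [show w = (frameEquiv o p q h) ∘ n from funext hw]
    exact this.symm
  have hs' : stdRegularGon m = frameEquiv o' p' q' h' '' convexHull ℝ (Set.range n) := by
    have := (frameEquiv o' p' q' h').toAffineMap.image_convexHull (Set.range n)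
    rw [← Set.range_comp] at this
    change convexHull ℝ (Set.range (stdVertex m)) = _
    rw [show stdVertex m = (frameEquiv o' p' q' h') ∘ n from funext hs]
    exact this.symm
  refine ⟨(frameEquiv o' p' q' h').symm.trans (frameEquiv o p q h), ?_⟩
  rw [hw', hs', ← Set.image_comp]
  congr 1
  ext x
  simp

theorem sin_two_pi_div_pos {m : ℕ} (hm : 3 ≤ m) : 0 < Real.sin (2 * Real.pi / m) := by
  have hm' : (3 : ℝ) ≤ m := by exact_mod_cast hm
  have hpi := Real.pi_pos
  refine Real.sin_pos_of_pos_of_lt_pi (by positivity) ?_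
  rw [div_lt_iff₀ (by linarith)]
  nlinarith

theorem stdVertex_zero (m : ℕ) [NeZero m] : stdVertex m 0 = !₂[1, 0] := by
  simp [stdVertex]

theorem cos_lt_one_of_sin_pos {x : ℝ} (h : 0 < Real.sin x) : Real.cos x < 1 := by
  have := Real.sin_sq_add_cos_sq x
  nlinarith

theorem isAffineRegularGon_three {w : Fin 3 → Euc 2} (hw : IsCCW w) :
    IsAffineRegularGon 3 (convexHull ℝ (Set.range w)) := by
  have h1 : stdVertex 3 1 = !₂[Real.cos (2 * Real.pi / 3), Real.sin (2 * Real.pi / 3)] := by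
    simp [stdVertex]
  have h2 : stdVertex 3 2 = !₂[Real.cos (2 * Real.pi / 3), -Real.sin (2 * Real.pi / 3)] := by
    have : 2 * Real.pi * ((2 : Fin 3) : ℕ) / (3 : ℕ) = 2 * Real.pi - 2 * Real.pi / 3 := by
      push_cast; simp; ring
    rw [stdVertex, this, Real.cos_two_pi_sub, Real.sin_two_pi_sub]
  have hs : 0 < Real.sin (2 * Real.pi / 3) := by simpa using sin_two_pi_div_pos (m := 3) le_rfl
  have hc := cos_lt_one_of_sin_pos hs
  refine isAffineRegularGon_of_frame (n := ![0, !₂[1, 0], !₂[0, 1]]) (o := w 0) (p := w 1 - w 0)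
    (q := w 2 - w 0) (o' := stdVertex 3 0) (p' := stdVertex 3 1 - stdVertex 3 0)
    (q' := stdVertex 3 2 - stdVertex 3 0) (hw 0 1 2 (by decide) (by decide)).ne' ?_ ?_ ?_
  · rw [h1, h2, stdVertex_zero]
    simp only [dd, PiLp.sub_apply]
    simp
    nlinarith
  · intro k; fin_cases k <;> simp
  · intro k; fin_cases k <;> simp

theorem isAffineRegularGon_four {w : Fin 4 → Euc 2} (h : 0 < tri (w 0) (w 1) (w 3))
    (hw : w 0 + w 2 = w 1 + w 3) : IsAffineRegularGon 4 (convexHull ℝ (Set.range w)) := by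
  have h1 : stdVertex 4 1 = !₂[0, 1] := by
    have : 2 * Real.pi * ((1 : Fin 4) : ℕ) / (4 : ℕ) = Real.pi / 2 := by
      push_cast; simp; ring
    rw [stdVertex, this, Real.cos_pi_div_two, Real.sin_pi_div_two]
  have h2 : stdVertex 4 2 = !₂[-1, 0] := by
    have : 2 * Real.pi * ((2 : Fin 4) : ℕ) / (4 : ℕ) = Real.pi := by
      push_cast; simp; ring
    rw [stdVertex, this, Real.cos_pi, Real.sin_pi]
  have h3 : stdVertex 4 3 = !₂[0, -1] := by
    have : 2 * Real.pi * ((3 : Fin 4) : ℕ) / (4 : ℕ) = 2 * Real.pi - Real.pi / 2 := by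
      push_cast; simp; ring
    rw [stdVertex, this, Real.cos_two_pi_sub, Real.sin_two_pi_sub, Real.cos_pi_div_two,
      Real.sin_pi_div_two]
  have hw2 : w 2 = w 1 + w 3 - w 0 := by rw [← hw]; abel
  refine isAffineRegularGon_of_frame (n := ![0, !₂[1, 0], !₂[1, 1], !₂[0, 1]]) (o := w 0)
    (p := w 1 - w 0) (q := w 3 - w 0) (o' := !₂[1, 0]) (p' := !₂[-1, 1])
    (q' := !₂[-1, -1]) h.ne' ?_ ?_ ?_
  · simp [dd]
  · intro k; fin_cases k
    · simp
    · simp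
    · simp [hw2]; abel
    · simp
  · intro k; fin_cases k
    · simp [stdVertex_zero]
    · apply euc_ext <;> simp [h1]
    · apply euc_ext <;> simp [h2]
    · apply euc_ext <;> simp [h3]

theorem cos_two_pi_div_five : Real.cos (2 * Real.pi / 5) = (phi - 1) / 2 := by
  have : 2 * Real.pi / 5 = 2 * (Real.pi / 5) := by ring
  rw [this, Real.cos_two_mul, Real.cos_pi_div_five, show (1 + √5) / 4 = phi / 2 by rw [phi]; ring]
  have := phi_sq
  linear_combination this / 2

theorem isAffineRegularGon_five {w : Fin 5 → Euc 2} (h : dd (w 1 - w 0) (w 4 - w 0) ≠ 0)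
    (h2 : w 2 = w 0 + (phi • (w 1 - w 0) + (w 4 - w 0)))
    (h3 : w 3 = w 0 + ((w 1 - w 0) + phi • (w 4 - w 0))) :
    IsAffineRegularGon 5 (convexHull ℝ (Set.range w)) := by
  set s := Real.sin (2 * Real.pi / 5) with hs
  have hs0 : 0 < s := by simpa using sin_two_pi_div_pos (m := 5) (by norm_num)
  have hp := phi_sq
  obtain ⟨hp1, hp2⟩ := phi_bounds
  have hc := cos_two_pi_div_five
  have hc2 : Real.cos (2 * (2 * Real.pi / 5)) = -phi / 2 := by
    rw [Real.cos_two_mul, hc]; linear_combination hp / 2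
  have hs2 : Real.sin (2 * (2 * Real.pi / 5)) = s * (phi - 1) := by
    rw [Real.sin_two_mul, hc]; ring
  have v1 : stdVertex 5 1 = !₂[(phi - 1) / 2, s] := by
    rw [← hc]; simp [stdVertex, hs]
  have v2 : stdVertex 5 2 = !₂[-phi / 2, s * (phi - 1)] := by
    have : 2 * Real.pi * ((2 : Fin 5) : ℕ) / (5 : ℕ) = 2 * (2 * Real.pi / 5) := by
      push_cast; simp; ring
    rw [stdVertex, this, hc2, hs2]
  have v3 : stdVertex 5 3 = !₂[-phi / 2, -(s * (phi - 1))] := by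
    have : 2 * Real.pi * ((3 : Fin 5) : ℕ) / (5 : ℕ) =
        2 * Real.pi - 2 * (2 * Real.pi / 5) := by
      push_cast; simp; ring
    rw [stdVertex, this, Real.cos_two_pi_sub, Real.sin_two_pi_sub, hc2, hs2]
  have v4 : stdVertex 5 4 = !₂[(phi - 1) / 2, -s] := by
    have : 2 * Real.pi * ((4 : Fin 5) : ℕ) / (5 : ℕ) = 2 * Real.pi - 2 * Real.pi / 5 := by
      push_cast; simp; ring
    rw [stdVertex, this, Real.cos_two_pi_sub, Real.sin_two_pi_sub, hc]
  refine isAffineRegularGon_of_frame (n := goldenPentagon) (o := w 0) (p := w 1 - w 0)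
    (q := w 4 - w 0) (o' := !₂[1, 0]) (p' := !₂[(phi - 1) / 2 - 1, s])
    (q' := !₂[(phi - 1) / 2 - 1, -s]) h ?_ ?_ ?_
  · simp only [dd]; simp; nlinarith
  · intro k; fin_cases k
    · simp [goldenPentagon]
    · simp [goldenPentagon]
    · simp [goldenPentagon, h2]
    · simp [goldenPentagon, h3]
    · simp [goldenPentagon]
  · intro k; fin_cases k
    · simp [goldenPentagon, stdVertex_zero]
    · apply euc_ext <;> simp [goldenPentagon, v1]
    · apply euc_ext <;> simp [goldenPentagon, v2] <;> linarith
    · apply euc_ext <;> simp [goldenPentagon, v3] <;> linarith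
    · apply euc_ext <;> simp [goldenPentagon, v4]

/-! ### Ears of a pentagon and Gauss's relation -/

/-- Twice the area of the ear of a pentagon at its `i`-th vertex. -/
def ear (w : Fin 5 → Euc 2) (i : Fin 5) : ℝ := tri (w (i + 4)) (w i) (w (i + 1))

/-- Twice the area of a pentagon. -/
def pentArea (w : Fin 5 → Euc 2) : ℝ :=
  tri (w 0) (w 1) (w 2) + tri (w 0) (w 2) (w 3) + tri (w 0) (w 3) (w 4)

/-- Gauss's pentagon formula, a polynomial identity in the ten coordinates. -/
theorem gauss_pentagon (w : Fin 5 → Euc 2) :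
    pentArea w ^ 2 - pentArea w * (ear w 0 + ear w 1 + ear w 2 + ear w 3 + ear w 4) +
      (ear w 0 * ear w 1 + ear w 1 * ear w 2 + ear w 2 * ear w 3 + ear w 3 * ear w 4 +
        ear w 4 * ear w 0) = 0 := by
  simp only [pentArea, ear, tri_def]
  simp
  ring

/-- Two ears at nonadjacent vertices share one vertex and do not overlap; what they leave of the
pentagon is a nondegenerate triangle. -/
theorem ear_add_ear_lt {w : Fin 5 → Euc 2} (hw : IsCCW w) :
    ear w 0 + ear w 2 < pentArea w ∧ ear w 1 + ear w 3 < pentArea w ∧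
    ear w 2 + ear w 4 < pentArea w ∧ ear w 3 + ear w 0 < pentArea w ∧
    ear w 4 + ear w 1 < pentArea w := by
  have h0 := hw 1 3 4 (by decide) (by decide)
  have h1 := hw 0 2 4 (by decide) (by decide)
  have h2 := hw 0 1 3 (by decide) (by decide)
  have h3 := hw 1 2 4 (by decide) (by decide)
  have h4 := hw 0 2 3 (by decide) (by decide)
  simp only [pentArea, ear, tri_def] at *
  simp
  refine ⟨?_, ?_, ?_, ?_, ?_⟩ <;> linarith

/-- In the frame at `w 0` with axes to its neighbours, equality of ears 0, 1 and 4 leaves one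
unknown coordinate each for `w 2` and `w 3`. Ears 2 and 3 give `(α - 1) β = 1 = α (β - 1)`, hence `α
= β`, and positivity selects the golden ratio. -/
theorem pentagon_of_ears_eq {w : Fin 5 → Euc 2} (hw : IsCCW w) {T : ℝ}
    (h : ∀ i, ear w i = T) : IsAffineRegularGon 5 (convexHull ℝ (Set.range w)) := by
  have hT : 0 < T := by
    rw [← h 1]; exact hw 0 1 2 (by decide) (by decide)
  set p := w 1 - w 0 with hp
  set q := w 4 - w 0 with hq
  have e0 : dd p q = T := by
    rw [← h 0]; simp [ear, tri_def, dd, hp, hq]; ring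
  have e1 : dd p (w 2 - w 0) = T := by
    rw [← h 1]; simp [ear, tri_def, dd, hp]
  have e4 : dd (w 3 - w 0) q = T := by
    rw [← h 4]; simp [ear, tri_def, dd, hq]; ring
  have cramer : ∀ z : Euc 2, z = (dd z q / T) • p + (dd p z / T) • q := by
    intro z
    have : T • z = dd z q • p + dd p z • q := by
      rw [← e0]; apply euc_ext <;> simp [dd] <;> ring
    have := congrArg (fun v => T⁻¹ • v) this
    simp only [smul_add, smul_smul, inv_mul_cancel₀ hT.ne', one_smul] at this
    rw [div_eq_inv_mul, div_eq_inv_mul]; exact this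
  set α := dd (w 2 - w 0) q / T with hα
  set β := dd p (w 3 - w 0) / T with hβ
  have hw2 : w 2 = w 0 + (α • p + q) := by
    have := cramer (w 2 - w 0)
    rw [e1, div_self hT.ne', one_smul] at this
    rw [← this]; abel
  have hw3 : w 3 = w 0 + (p + β • q) := by
    have := cramer (w 3 - w 0)
    rw [e4, div_self hT.ne', one_smul] at this
    rw [← this]; abel
  have hα0 : 0 < α := div_pos (hw 0 2 4 (by decide) (by decide)) hT
  have hw1 : w 1 = w 0 + p := by rw [hp]; abel
  have hw4 : w 4 = w 0 + q := by rw [hq]; abel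
  have e2 : (α - 1) * β * T = T := by
    calc (α - 1) * β * T = (α - 1) * β * dd p q := by rw [e0]
      _ = ear w 2 := by
        clear_value α β p q
        simp [ear, tri_def, hw1, hw2, hw3, dd]; ring
      _ = T := h 2
  have e3 : α * (β - 1) * T = T := by
    calc α * (β - 1) * T = α * (β - 1) * dd p q := by rw [e0]
      _ = ear w 3 := by
        clear_value α β p q
        simp [ear, tri_def, hw4, hw2, hw3, dd]; ring
      _ = T := h 3
  have e2' : (α - 1) * β = 1 := by
    apply mul_right_cancel₀ hT.ne'; rw [e2, one_mul]
  have e3' : α * (β - 1) = 1 := by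
    apply mul_right_cancel₀ hT.ne'; rw [e3, one_mul]
  have hαβ : α = β := by linarith
  have hsq := phi_sq
  have hα' : α = phi := by
    have : (α - phi) * (α + phi - 1) = 0 := by
      rw [← hαβ] at e2'; linear_combination e2' - hsq
    rcases mul_eq_zero.1 this with h | h
    · linarith
    · have := phi_bounds.1; linarith
  refine isAffineRegularGon_five (by rw [← hp, ← hq, e0]; exact hT.ne') ?_ ?_
  · rw [← hα']; exact hw2
  · rw [← hα', hαβ]; exact hw3

/-- For the deficits `yᵢ = t A - Tᵢ ≥ 0`, Gauss's relation becomes `(1 - 2 t) A ∑ yᵢ = -∑ yᵢ yᵢ₊₁`,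
whose sides have opposite signs. The constant term drops out because `t` is a root of `1 - 5 t + 5 t
^ 2`. -/
theorem ears_eq_of_le {A T₀ T₁ T₂ T₃ T₄ : ℝ} (hA : 0 < A)
    (hG : A ^ 2 - A * (T₀ + T₁ + T₂ + T₃ + T₄) +
      (T₀ * T₁ + T₁ * T₂ + T₂ * T₃ + T₃ * T₄ + T₄ * T₀) = 0) {t : ℝ} (ht : t = (3 - phi) / 5)
    (h0 : T₀ ≤ t * A) (h1 : T₁ ≤ t * A) (h2 : T₂ ≤ t * A) (h3 : T₃ ≤ t * A) (h4 : T₄ ≤ t * A) :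
    T₀ = t * A ∧ T₁ = t * A ∧ T₂ = t * A ∧ T₃ = t * A ∧ T₄ = t * A := by
  have hq : 1 - 5 * t + 5 * t ^ 2 = 0 := by
    rw [ht]; linear_combination phi_sq / 5
  have ht2 : 0 < 1 - 2 * t := by have := phi_bounds.1; rw [ht]; linarith
  obtain ⟨y₀, rfl⟩ : ∃ y, T₀ = t * A - y := ⟨t * A - T₀, by ring⟩
  obtain ⟨y₁, rfl⟩ : ∃ y, T₁ = t * A - y := ⟨t * A - T₁, by ring⟩
  obtain ⟨y₂, rfl⟩ : ∃ y, T₂ = t * A - y := ⟨t * A - T₂, by ring⟩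
  obtain ⟨y₃, rfl⟩ : ∃ y, T₃ = t * A - y := ⟨t * A - T₃, by ring⟩
  obtain ⟨y₄, rfl⟩ : ∃ y, T₄ = t * A - y := ⟨t * A - T₄, by ring⟩
  have hk : (1 - 2 * t) * A * (y₀ + y₁ + y₂ + y₃ + y₄) =
      -(y₀ * y₁ + y₁ * y₂ + y₂ * y₃ + y₃ * y₄ + y₄ * y₀) := by
    linear_combination hG - A ^ 2 * hq
  have p0 : 0 ≤ y₀ := by linarith
  have p1 : 0 ≤ y₁ := by linarith
  have p2 : 0 ≤ y₂ := by linarith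
  have p3 : 0 ≤ y₃ := by linarith
  have p4 : 0 ≤ y₄ := by linarith
  have hpos : 0 < (1 - 2 * t) * A := mul_pos ht2 hA
  have : 0 ≤ y₀ * y₁ + y₁ * y₂ + y₂ * y₃ + y₃ * y₄ + y₄ * y₀ := by positivity
  have hs : y₀ + y₁ + y₂ + y₃ + y₄ ≤ 0 := by
    by_contra h
    push Not at h
    have := mul_pos hpos h
    linarith
  refine ⟨?_, ?_, ?_, ?_, ?_⟩ <;> linarith

/-- For the excesses `yᵢ = Tᵢ - t A ≥ 0` the relation is `(1 - 2 t) A ∑ yᵢ = ∑ yᵢ yᵢ₊₁`, so signs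
alone do not decide. The bounds on nonadjacent ears give `yᵢ₋₁ + yᵢ₊₁ < (1 - 2 t) A`; multiplying by
`yᵢ` and summing shows that twice the right side is at most the left side, so both vanish. -/
theorem ears_eq_of_ge {A T₀ T₁ T₂ T₃ T₄ : ℝ} (hA : 0 < A)
    (hG : A ^ 2 - A * (T₀ + T₁ + T₂ + T₃ + T₄) +
      (T₀ * T₁ + T₁ * T₂ + T₂ * T₃ + T₃ * T₄ + T₄ * T₀) = 0) {t : ℝ} (ht : t = (3 - phi) / 5)
    (h0 : t * A ≤ T₀) (h1 : t * A ≤ T₁) (h2 : t * A ≤ T₂) (h3 : t * A ≤ T₃) (h4 : t * A ≤ T₄)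
    (s0 : T₀ + T₂ < A) (s1 : T₁ + T₃ < A) (s2 : T₂ + T₄ < A) (s3 : T₃ + T₀ < A)
    (s4 : T₄ + T₁ < A) :
    T₀ = t * A ∧ T₁ = t * A ∧ T₂ = t * A ∧ T₃ = t * A ∧ T₄ = t * A := by
  have hq : 1 - 5 * t + 5 * t ^ 2 = 0 := by
    rw [ht]; linear_combination phi_sq / 5
  have ht2 : 0 < 1 - 2 * t := by have := phi_bounds.1; rw [ht]; linarith
  obtain ⟨y₀, rfl⟩ : ∃ y, T₀ = t * A + y := ⟨T₀ - t * A, by ring⟩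
  obtain ⟨y₁, rfl⟩ : ∃ y, T₁ = t * A + y := ⟨T₁ - t * A, by ring⟩
  obtain ⟨y₂, rfl⟩ : ∃ y, T₂ = t * A + y := ⟨T₂ - t * A, by ring⟩
  obtain ⟨y₃, rfl⟩ : ∃ y, T₃ = t * A + y := ⟨T₃ - t * A, by ring⟩
  obtain ⟨y₄, rfl⟩ : ∃ y, T₄ = t * A + y := ⟨T₄ - t * A, by ring⟩
  have hk : (1 - 2 * t) * A * (y₀ + y₁ + y₂ + y₃ + y₄) =
      y₀ * y₁ + y₁ * y₂ + y₂ * y₃ + y₃ * y₄ + y₄ * y₀ := by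
    linear_combination -hG + A ^ 2 * hq
  have p0 : 0 ≤ y₀ := by linarith
  have p1 : 0 ≤ y₁ := by linarith
  have p2 : 0 ≤ y₂ := by linarith
  have p3 : 0 ≤ y₃ := by linarith
  have p4 : 0 ≤ y₄ := by linarith
  have hpos : 0 < (1 - 2 * t) * A := mul_pos ht2 hA
  have m0 : y₁ * (y₀ + y₂) ≤ y₁ * ((1 - 2 * t) * A) := mul_le_mul_of_nonneg_left (by linarith) p1
  have m1 : y₂ * (y₁ + y₃) ≤ y₂ * ((1 - 2 * t) * A) := mul_le_mul_of_nonneg_left (by linarith) p2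
  have m2 : y₃ * (y₂ + y₄) ≤ y₃ * ((1 - 2 * t) * A) := mul_le_mul_of_nonneg_left (by linarith) p3
  have m3 : y₄ * (y₃ + y₀) ≤ y₄ * ((1 - 2 * t) * A) := mul_le_mul_of_nonneg_left (by linarith) p4
  have m4 : y₀ * (y₄ + y₁) ≤ y₀ * ((1 - 2 * t) * A) := mul_le_mul_of_nonneg_left (by linarith) p0
  have hs : y₀ + y₁ + y₂ + y₃ + y₄ ≤ 0 := by
    by_contra h
    push Not at h
    have := mul_pos hpos h
    nlinarith
  refine ⟨?_, ?_, ?_, ?_, ?_⟩ <;> linarith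

theorem forall_fin_five {p : Fin 5 → Prop} (h : p 0 ∧ p 1 ∧ p 2 ∧ p 3 ∧ p 4) : ∀ i, p i := by
  intro i
  fin_cases i
  exacts [h.1, h.2.1, h.2.2.1, h.2.2.2.1, h.2.2.2.2]

theorem IsCCW.pentArea_eq {w : Fin 5 → Euc 2} (hw : IsCCW w) :
    pentArea w = 2 * volume.real (convexHull ℝ (Set.range w)) := by
  rw [hw.area_five, pentArea]; ring

/-- The vertices used are those of the quadrangle obtained by removing vertex `i`. The determinant
of its diagonals is twice its area, that is, `pentArea w - ear w i`. -/
theorem le_cTr_five_mul {w : Fin 5 → Euc 2} (hw : IsCCW w) (i : Fin 5) :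
    3 * pentArea w - 2 * ear w i ≤ cTr (convexHull ℝ (Set.range w)) * pentArea w := by
  have h := le_cTr_mul (isCompact_hull_range w) hw.area_pos (mem_hull_range w (i + 3))
    (mem_hull_range w (i + 1)) (mem_hull_range w (i + 4)) (mem_hull_range w (i + 2))
  have e : dd (w (i + 3) - w (i + 1)) (w (i + 4) - w (i + 2)) = pentArea w - ear w i := by
    fin_cases i <;> simp [dd, pentArea, ear, tri_def] <;> ring
  rw [e] at h
  have h2 : volume.real (convexHull ℝ (Set.range w)) = pentArea w / 2 := by
    rw [hw.pentArea_eq]; ring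
  rw [h2] at h
  linarith

/-- The threshold equals `3 - 2 t` with `t = (3 - phi) / 5`, so it forces every ear to be at least
`t` times the area. -/
theorem ears_eq_of_cTr_le {w : Fin 5 → Euc 2} (hw : IsCCW w)
    (h : cTr (convexHull ℝ (Set.range w)) ≤ (9 + 2 * phi) / 5) :
    ∀ i, ear w i = (3 - phi) / 5 * pentArea w := by
  have hA : 0 < pentArea w := by rw [hw.pentArea_eq]; have := hw.area_pos; linarith
  have hge : ∀ i, (3 - phi) / 5 * pentArea w ≤ ear w i := by
    intro i
    have h1 := le_cTr_five_mul hw i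
    have h2 := mul_le_mul_of_nonneg_right h hA.le
    linarith
  obtain ⟨s0, s1, s2, s3, s4⟩ := ear_add_ear_lt hw
  exact forall_fin_five (ears_eq_of_ge hA (gauss_pentagon w) rfl (hge 0) (hge 1) (hge 2) (hge 3)
    (hge 4) s0 s1 s2 s3 s4)

theorem le_cTr_five {w : Fin 5 → Euc 2} (hw : IsCCW w) :
    (9 + 2 * phi) / 5 ≤ cTr (convexHull ℝ (Set.range w)) := by
  by_contra h
  push Not at h
  have hA : 0 < pentArea w := by rw [hw.pentArea_eq]; have := hw.area_pos; linarith
  have h1 := ears_eq_of_cTr_le hw h.le 0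
  have h2 := le_cTr_five_mul hw 0
  have h3 := mul_lt_mul_of_pos_right h hA
  linarith

/-! ### Reflections about points: reduction to vertices and lower bounds -/

theorem mem_flatReflections_zero {σ : Euc 2 ≃ᵢ Euc 2} (h : σ ∈ flatReflections 2 0) :
    ∃ p : Euc 2, ∀ x, σ x = (2 : ℝ) • p - x := by
  obtain ⟨F, hF, hdim, rfl⟩ := h
  have ⟨⟨p, hp⟩⟩ := hF
  refine ⟨p, fun x => ?_⟩
  have hdir : F.direction = ⊥ := Submodule.finrank_eq_zero.1 hdim
  have h1 : F.direction.reflection (x - p) = -(x - p) := by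
    apply Submodule.reflection_mem_subspace_orthogonalComplement_eq_neg
    rw [hdir]; simp
  change EuclideanGeometry.reflection F x = _
  rw [EuclideanGeometry.reflection_apply_of_mem F x hp]
  simp only [vsub_eq_sub, vadd_eq_add, h1]
  module

theorem exists_pointReflection (p : Euc 2) :
    ∃ σ ∈ flatReflections 2 0, ∀ x, σ x = (2 : ℝ) • p - x := by
  have hne : Nonempty (AffineSubspace.mk' p (⊥ : Submodule ℝ (Euc 2))) :=
    ⟨p, AffineSubspace.self_mem_mk' p _⟩
  refine ⟨(EuclideanGeometry.reflection
    (AffineSubspace.mk' p (⊥ : Submodule ℝ (Euc 2)))).toIsometryEquiv, ⟨_, hne, by simp, rfl⟩, ?_⟩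
  intro x
  have h1 : (AffineSubspace.mk' p (⊥ : Submodule ℝ (Euc 2))).direction.reflection (x - p) =
      -(x - p) := by
    apply Submodule.reflection_mem_subspace_orthogonalComplement_eq_neg
    simp
  change EuclideanGeometry.reflection _ x = _
  rw [EuclideanGeometry.reflection_apply_of_mem _ x (AffineSubspace.self_mem_mk' p _)]
  simp only [vsub_eq_sub, vadd_eq_add, h1]
  module

theorem image_pointReflection (p : Euc 2) (K : Set (Euc 2)) :
    (fun x => (2 : ℝ) • p - x) '' K = (fun x => (2 : ℝ) • p - x) ⁻¹' K :=
  congrFun (Set.image_eq_preimage_of_inverse (fun x => by simp) (fun x => by simp)) K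

theorem area_pointReflection (p : Euc 2) {K : Set (Euc 2)} (hK : MeasurableSet K) :
    volume.real ((fun x => (2 : ℝ) • p - x) '' K) = volume.real K := by
  rw [image_pointReflection, Measure.real, Measure.real,
    (Measure.measurePreserving_sub_left volume ((2 : ℝ) • p)).measure_preimage hK.nullMeasurableSet]

theorem le_cRefl_zero_mul {K : Set (Euc 2)} (hKc : IsCompact K) (hvol : 0 < volume.real K)
    {p : Euc 2} (hp : p ∈ K) :
    volume.real (convexHull ℝ (K ∪ (fun x => (2 : ℝ) • p - x) '' K)) ≤
      cRefl 0 K * volume.real K := by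
  obtain ⟨σ, hσ, h⟩ := exists_pointReflection p
  have := area_le_relHull_mul hKc.isBounded hvol hσ ⟨p, hp, p, hp, by rw [h]; module⟩
  rwa [show (σ : Euc 2 → Euc 2) = fun x => (2 : ℝ) • p - x from funext h] at this

theorem cRefl_zero_le {K : Set (Euc 2)} (hK : Convex ℝ K) (hvol : 0 < volume.real K) {c : ℝ}
    (h : ∀ p ∈ K, volume.real (convexHull ℝ (K ∪ (fun x => (2 : ℝ) • p - x) '' K)) ≤
      c * volume.real K) : cRefl 0 K ≤ c := by
  refine relHull_le hvol ?_ ?_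
  · have hne : K.Nonempty := by
      by_contra h
      rw [Set.not_nonempty_iff_eq_empty] at h
      simp [h] at hvol
    obtain ⟨p, hp⟩ := hne
    obtain ⟨σ, hσ, h⟩ := exists_pointReflection p
    exact ⟨σ, hσ, p, hp, p, hp, by rw [h]; module⟩
  · rintro σ hσ ⟨x, hx, y, hy, hxy⟩
    obtain ⟨p, hp⟩ := mem_flatReflections_zero hσ
    -- The centre is the midpoint of `y` and its image `x`, both in `K`; hence admissible centres
    -- are exactly the points of `K`.
    have hpK : p ∈ K := by
      have := hK hx hy (a := 1 / 2) (b := 1 / 2) (by norm_num) (by norm_num) (by norm_num)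
      convert this using 1
      rw [← hxy, hp]; module
    rw [show (σ : Euc 2 → Euc 2) = fun x => (2 : ℝ) • p - x from funext hp]
    exact h p hpK

/-- The affine map `x ↦ L x + v` commutes with convex hulls. -/
theorem hull_union_image_hull (L : Euc 2 →ₗ[ℝ] Euc 2) (v : Euc 2) (T : Set (Euc 2)) :
    convexHull ℝ (convexHull ℝ T ∪ (fun x => L x + v) '' convexHull ℝ T) =
      convexHull ℝ (T ∪ (fun x => x + v) '' (L '' T)) := by
  have h := (L.toAffineMap + AffineMap.const ℝ (Euc 2) v).image_convexHull T
  have e : ((L.toAffineMap + AffineMap.const ℝ (Euc 2) v : Euc 2 →ᵃ[ℝ] Euc 2) : Euc 2 → Euc 2) =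
      fun x => L x + v := by ext1 x; simp
  rw [e] at h
  rw [h, convexHull_convexHull_union_left, convexHull_convexHull_union_right, Set.image_image]

theorem pointReflection_eq (p : Euc 2) :
    (fun x : Euc 2 => (2 : ℝ) • p - x) =
      fun x => (-LinearMap.id : Euc 2 →ₗ[ℝ] Euc 2) x + (2 : ℝ) • p := by
  ext1 x; simp [sub_eq_neg_add]

/-- Moving the centre translates the reflected copy, so the hull area is convex in the centre. Its
sublevel sets are convex, and one that contains `T` contains the hull. -/
theorem cRefl_zero_le_of_vertices {T : Set (Euc 2)} (hT : T.Finite)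
    (hvol : 0 < volume.real (convexHull ℝ T)) {c : ℝ}
    (h : ∀ p ∈ T, volume.real (convexHull ℝ (T ∪ (fun x => (2 : ℝ) • p - x) '' T)) ≤
      c * volume.real (convexHull ℝ T)) : cRefl 0 (convexHull ℝ T) ≤ c := by
  refine cRefl_zero_le (convex_convexHull ℝ T) hvol ?_
  have hne : T.Nonempty := by
    by_contra h
    rw [Set.not_nonempty_iff_eq_empty] at h
    simp [h] at hvol
  set L : Euc 2 →ₗ[ℝ] Euc 2 := -LinearMap.id with hL
  have hc := convexOn_area_hull hT (hT.image L) hne (hne.image L)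
  have hc2 := (hc.comp_linearMap ((2 : ℝ) • LinearMap.id)).convex_le (c * volume.real (convexHull ℝ T))
  intro p hp
  rw [pointReflection_eq, hull_union_image_hull]
  refine (convexHull_min (fun q hq => ?_) hc2 hp).2
  refine ⟨Set.mem_univ _, ?_⟩
  have := h q hq
  rw [pointReflection_eq] at this
  simpa [← hL, Set.image_image] using this

/-- The lines `va` and `vd` divide the plane into four sectors. Two opposite ones contain `K` and
its image; each of the other two contains a triangle in the hull with area half of `tri v a d`. -/
theorem area_hull_pointReflection_ge {K : Set (Euc 2)} (hKc : IsCompact K)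
    {v a d : Euc 2} (hv : v ∈ K) (ha : a ∈ K) (hd : d ∈ K) (hD : 0 < tri v a d)
    (h1 : ∀ k ∈ K, 0 ≤ tri v a k) (h2 : ∀ k ∈ K, 0 ≤ tri v k d) :
    2 * volume.real K + tri v a d ≤
      volume.real (convexHull ℝ (K ∪ (fun x => (2 : ℝ) • v - x) '' K)) := by
  set τ : Euc 2 → Euc 2 := fun x => (2 : ℝ) • v - x with hτ
  set C := convexHull ℝ (K ∪ τ '' K) with hC
  have hcont : Continuous τ := by fun_prop
  have hCtop : volume C ≠ ⊤ := hull_union_ne_top hKc (hKc.image hcont)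
  have hKC : K ⊆ C := Set.subset_union_left.trans (subset_convexHull ℝ _)
  have hKC' : τ '' K ⊆ C := Set.subset_union_right.trans (subset_convexHull ℝ _)
  have hCc : Convex ℝ C := convex_convexHull ℝ _
  have hva : v ≠ a := by rintro rfl; simp [tri_def] at hD
  have hvd : v ≠ d := by rintro rfl; simp [tri_def] at hD
  have hneg : ∀ x y, tri v x (τ y) = -tri v x y := by intro x y; simp [hτ, tri_def]; ring
  have hfa := ddL_ne_zero (sub_ne_zero.2 hva.symm)
  have hfd := ddL_ne_zero (sub_ne_zero.2 hvd.symm)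
  have hcut : ∀ x p, tri v x p = ddL (x - v) p - ddL (x - v) v := fun x => tri_eq_ddL v x
  have hsub : ∀ s : Set (Euc 2), volume (C ∩ s) ≠ ⊤ := fun s =>
    ((measure_mono Set.inter_subset_left).trans_lt hCtop.lt_top).ne
  have key1 := area_add_le hfa (ddL (a - v) v) hCtop (S := C ∩ {p | tri v a p ≤ 0})
    (T := C ∩ {p | 0 ≤ tri v a p}) Set.inter_subset_left Set.inter_subset_left
    (fun p hp => by have := hp.2; simp only [Set.mem_ofPred_eq, hcut] at this; linarith)
    (fun p hp => by have := hp.2; simp only [Set.mem_ofPred_eq, hcut] at this; linarith)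
  have hT1 : convexHull ℝ {v, d, τ a} ⊆ C ∩ {p | 0 ≤ tri v a p} := by
    intro p hp
    refine ⟨convexHull_min ?_ hCc hp, tri_nonneg_of_mem_hull ?_ p hp⟩
    · rintro q (rfl | rfl | rfl)
      exacts [hKC hv, hKC hd, hKC' ⟨a, ha, rfl⟩]
    · rintro q (rfl | rfl | rfl)
      · exact (tri_self₁ _ _).ge
      · exact hD.le
      · rw [hneg, tri_self₂, neg_zero]
  have hT2 : convexHull ℝ {v, τ d, a} ⊆ C ∩ {p | tri v a p ≤ 0} := by
    intro p hp
    refine ⟨convexHull_min ?_ hCc hp, tri_nonpos_of_mem_hull ?_ p hp⟩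
    · rintro q (rfl | rfl | rfl)
      exacts [hKC hv, hKC' ⟨d, hd, rfl⟩, hKC ha]
    · rintro q (rfl | rfl | rfl)
      · exact (tri_self₁ _ _).le
      · rw [hneg]; linarith
      · exact (tri_self₂ _ _).le
  have hside : ∀ q ∈ K, tri v d q ≤ 0 := fun q hq => by
    have := h2 q hq; rw [tri_swap] at this; linarith
  have key2 := area_add_le hfd (ddL (d - v) v) (hsub {p | 0 ≤ tri v a p}) (S := K)
    (fun p hp => ⟨hKC hp, h1 p hp⟩) hT1
    (fun p hp => by have := hside p hp; rw [hcut] at this; linarith)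
    (fun p hp => by
      have := tri_nonneg_of_mem_hull (a := v) (b := d) (T := {v, d, τ a}) (by
        rintro q (rfl | rfl | rfl)
        · exact (tri_self₁ _ _).ge
        · exact (tri_self₂ _ _).ge
        · rw [hneg, tri_swap]; linarith) p hp
      rw [hcut] at this; linarith)
  have key3 := area_add_le hfd (ddL (d - v) v) (hsub {p | tri v a p ≤ 0}) (T := τ '' K)
    hT2 (by
      rintro _ ⟨p, hp, rfl⟩
      refine ⟨hKC' ⟨p, hp, rfl⟩, ?_⟩
      simp only [Set.mem_ofPred_eq, hneg]
      linarith [h1 p hp])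
    (fun p hp => by
      have := tri_nonpos_of_mem_hull (a := v) (b := d) (T := {v, τ d, a}) (by
        rintro q (rfl | rfl | rfl)
        · exact (tri_self₁ _ _).le
        · rw [hneg, tri_self₂, neg_zero]
        · rw [tri_swap]; linarith) p hp
      rw [hcut] at this; linarith)
    (by
      rintro _ ⟨p, hp, rfl⟩
      have h3 := hneg d p
      have h4 := hcut d (τ p)
      have := hside p hp
      linarith)
  have e1 : volume.real (convexHull ℝ {v, d, τ a}) = tri v a d / 2 := by
    rw [triangle_area, hneg, abs_neg, tri_swap, abs_neg, abs_of_pos hD]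
  have e2 : volume.real (convexHull ℝ {v, τ d, a}) = tri v a d / 2 := by
    rw [triangle_area, tri_swap, hneg, neg_neg, abs_of_pos hD]
  rw [e1] at key2
  rw [e2, area_pointReflection v hKc.measurableSet] at key3
  linarith

theorem le_cRefl_zero_mul_of_cone {n : ℕ} {w : Fin n → Euc 2}
    (hvol : 0 < volume.real (convexHull ℝ (Set.range w))) (i j k : Fin n)
    (hD : 0 < tri (w i) (w j) (w k)) (h1 : ∀ l, 0 ≤ tri (w i) (w j) (w l))
    (h2 : ∀ l, 0 ≤ tri (w i) (w l) (w k)) :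
    2 * volume.real (convexHull ℝ (Set.range w)) + tri (w i) (w j) (w k) ≤
      cRefl 0 (convexHull ℝ (Set.range w)) * volume.real (convexHull ℝ (Set.range w)) := by
  refine le_trans ?_ (le_cRefl_zero_mul (isCompact_hull_range w) hvol (mem_hull_range w i))
  refine area_hull_pointReflection_ge (isCompact_hull_range w) (mem_hull_range w i)
    (mem_hull_range w j) (mem_hull_range w k) hD ?_ ?_
  · exact tri_nonneg_of_mem_hull (by rintro _ ⟨l, rfl⟩; exact h1 l)
  · intro p hp
    rw [← tri_rotate, ← tri_rotate]
    exact tri_nonneg_of_mem_hull (by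
      rintro _ ⟨l, rfl⟩; rw [tri_rotate, tri_rotate]; exact h2 l) p hp

/-- Every vertex of a convex polygon sees the polygon between its two neighbours. -/
theorem IsCCW.cone {n : ℕ} {w : Fin n → Euc 2} (hw : IsCCW w) {i j : Fin n}
    (hij : (j : ℕ) = i + 1 ∨ (j : ℕ) = 0 ∧ (i : ℕ) + 1 = n) (l : Fin n) :
    0 ≤ tri (w i) (w j) (w l) := by
  by_cases hli : l = i
  · subst hli; exact (tri_self₁ _ _).ge
  by_cases hlj : l = j
  · subst hlj; exact (tri_self₂ _ _).ge
  have hli' : (l : ℕ) ≠ i := fun h => hli (Fin.ext h)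
  have hlj' : (l : ℕ) ≠ j := fun h => hlj (Fin.ext h)
  have hl := l.isLt
  rcases hij with h | ⟨h, h'⟩
  · rcases lt_or_gt_of_ne hli' with hlt | hlt
    · rw [tri_rotate]
      exact (hw l i j (Fin.lt_def.2 hlt) (Fin.lt_def.2 (by omega))).le
    · exact (hw i j l (Fin.lt_def.2 (by omega)) (Fin.lt_def.2 (by omega))).le
  · rw [← tri_rotate]
    exact (hw j l i (Fin.lt_def.2 (by omega)) (Fin.lt_def.2 (by omega))).le

theorem IsCCW.le_cRefl_zero_mul {n : ℕ} {w : Fin (n + 3) → Euc 2} (hw : IsCCW w)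
    {i j k : Fin (n + 3)} (hij : (j : ℕ) = i + 1 ∨ (j : ℕ) = 0 ∧ (i : ℕ) + 1 = n + 3)
    (hki : (i : ℕ) = k + 1 ∨ (i : ℕ) = 0 ∧ (k : ℕ) + 1 = n + 3)
    (hD : 0 < tri (w i) (w j) (w k)) :
    2 * volume.real (convexHull ℝ (Set.range w)) + tri (w i) (w j) (w k) ≤
      cRefl 0 (convexHull ℝ (Set.range w)) * volume.real (convexHull ℝ (Set.range w)) := by
  refine le_cRefl_zero_mul_of_cone hw.area_pos i j k hD (hw.cone hij) fun l => ?_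
  rw [← tri_rotate, ← tri_rotate]
  exact hw.cone hki l

theorem le_cRefl_zero_three {w : Fin 3 → Euc 2} (hw : IsCCW w) :
    4 ≤ cRefl 0 (convexHull ℝ (Set.range w)) := by
  have h := hw.le_cRefl_zero_mul (i := 0) (j := 1) (k := 2) (by decide) (by decide)
    (hw 0 1 2 (by decide) (by decide))
  have e := hw.area_three
  exact le_of_mul_le_mul_right (by linarith) hw.area_pos

theorem corner_pos {w : Fin 4 → Euc 2} (hw : IsCCW w) (i : Fin 4) :
    0 < tri (w i) (w (i + 1)) (w (i + 3)) := by
  have p0 := hw 0 1 2 (by decide) (by decide)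
  have p1 := hw 0 1 3 (by decide) (by decide)
  have p2 := hw 0 2 3 (by decide) (by decide)
  have p3 := hw 1 2 3 (by decide) (by decide)
  simp only [tri_def] at *
  fin_cases i <;> simp <;> linarith

theorem corner_le_of_cRefl_zero_four {w : Fin 4 → Euc 2} (hw : IsCCW w) (i : Fin 4) :
    2 * volume.real (convexHull ℝ (Set.range w)) + tri (w i) (w (i + 1)) (w (i + 3)) ≤
      cRefl 0 (convexHull ℝ (Set.range w)) * volume.real (convexHull ℝ (Set.range w)) :=
  hw.le_cRefl_zero_mul (n := 1) (by revert i; decide) (by revert i; decide) (corner_pos hw i)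

theorem corner_add {w : Fin 4 → Euc 2} (hw : IsCCW w) (i : Fin 4) :
    tri (w i) (w (i + 1)) (w (i + 3)) + tri (w (i + 2)) (w (i + 3)) (w (i + 1)) =
      2 * volume.real (convexHull ℝ (Set.range w)) := by
  rw [hw.area_four]
  fin_cases i <;> simp [tri_def] <;> ring

/-- Opposite corner determinants add up to twice the area, so all four equal the area. Cramer's rule
in the frame at `w 0` then gives `w 2` both coordinates equal to 1. -/
theorem parallelogram_of_corner_le {w : Fin 4 → Euc 2} (hw : IsCCW w)
    (h : ∀ i, tri (w i) (w (i + 1)) (w (i + 3)) ≤ volume.real (convexHull ℝ (Set.range w))) :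
    w 0 + w 2 = w 1 + w 3 := by
  have hpos := hw.area_pos
  set D := volume.real (convexHull ℝ (Set.range w)) with hD
  have a0 := corner_add hw 0
  have a1 := corner_add hw 1
  have h0 := h 0
  have h1 := h 1
  have h2 := h 2
  have h3 := h 3
  simp only [zero_add, Fin.reduceAdd] at a0 a1 h0 h1 h2 h3
  have e0 : dd (w 1 - w 0) (w 3 - w 0) = D := le_antisymm h0 (by change D ≤ tri _ _ _; linarith)
  have e1 : dd (w 1 - w 0) (w 2 - w 0) = D := by
    change tri _ _ _ = D; rw [← tri_rotate]; linarith
  have e3 : dd (w 2 - w 0) (w 3 - w 0) = D := by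
    change tri _ _ _ = D; rw [tri_rotate]; linarith
  have h4 : D • (w 2 - w 0) = D • ((w 1 - w 0) + (w 3 - w 0)) := by
    rw [smul_add]
    nth_rw 2 [← e3]
    nth_rw 2 [← e1]
    rw [← e0]
    apply euc_ext <;> simp [dd] <;> ring
  have h5 := smul_right_injective _ hpos.ne' h4
  have h6 : w 2 = w 1 + w 3 - w 0 := by
    have := congrArg (fun x => x + w 0) h5
    simp only [sub_add_cancel] at this
    rw [this]; abel
  rw [h6]; abel

theorem parallelogram_of_cRefl_zero_le {w : Fin 4 → Euc 2} (hw : IsCCW w)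
    (h : cRefl 0 (convexHull ℝ (Set.range w)) ≤ 3) : w 0 + w 2 = w 1 + w 3 := by
  refine parallelogram_of_corner_le hw fun i => ?_
  have := corner_le_of_cRefl_zero_four hw i
  have := mul_le_mul_of_nonneg_right h hw.area_pos.le
  linarith

theorem le_cRefl_zero_four {w : Fin 4 → Euc 2} (hw : IsCCW w) :
    3 ≤ cRefl 0 (convexHull ℝ (Set.range w)) := by
  have h0 := corner_le_of_cRefl_zero_four hw 0
  have h2 := corner_le_of_cRefl_zero_four hw 2
  have := corner_add hw 0
  simp only [zero_add, Fin.reduceAdd] at h0 h2 this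
  exact le_of_mul_le_mul_right (by linarith) hw.area_pos

theorem ear_pos {w : Fin 5 → Euc 2} (hw : IsCCW w) (i : Fin 5) : 0 < ear w i := by
  have p0 := hw 0 1 2 (by decide) (by decide)
  have p1 := hw 1 2 3 (by decide) (by decide)
  have p2 := hw 2 3 4 (by decide) (by decide)
  have p3 := hw 0 3 4 (by decide) (by decide)
  have p4 := hw 0 1 4 (by decide) (by decide)
  simp only [tri_def, ear] at *
  fin_cases i <;> simp <;> linarith

theorem ear_le_of_cRefl_zero_five {w : Fin 5 → Euc 2} (hw : IsCCW w) (i : Fin 5) :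
    2 * pentArea w + 2 * ear w i ≤ cRefl 0 (convexHull ℝ (Set.range w)) * pentArea w := by
  have e : ear w i = tri (w i) (w (i + 1)) (w (i + 4)) := (tri_rotate _ _ _).symm
  have h := hw.le_cRefl_zero_mul (n := 2) (i := i) (j := i + 1) (k := i + 4)
    (by clear e; revert i; decide) (by clear e; revert i; decide) (by rw [← e]; exact ear_pos hw i)
  rw [← e] at h
  have h2 : volume.real (convexHull ℝ (Set.range w)) = pentArea w / 2 := by
    rw [hw.pentArea_eq]; ring
  rw [h2] at h
  linarith

/-- The threshold equals `2 + 2 t` with `t = (3 - phi) / 5`, so it forces every ear to be at most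
`t` times the area. -/
theorem ears_eq_of_cRefl_zero_le {w : Fin 5 → Euc 2} (hw : IsCCW w)
    (h : cRefl 0 (convexHull ℝ (Set.range w)) ≤ (16 - 2 * phi) / 5) :
    ∀ i, ear w i = (3 - phi) / 5 * pentArea w := by
  have hA : 0 < pentArea w := by rw [hw.pentArea_eq]; have := hw.area_pos; linarith
  have hle : ∀ i, ear w i ≤ (3 - phi) / 5 * pentArea w := by
    intro i
    have h1 := ear_le_of_cRefl_zero_five hw i
    have h2 := mul_le_mul_of_nonneg_right h hA.le
    linarith
  exact forall_fin_five (ears_eq_of_le hA (gauss_pentagon w) rfl (hle 0) (hle 1) (hle 2) (hle 3)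
    (hle 4))

theorem le_cRefl_zero_five {w : Fin 5 → Euc 2} (hw : IsCCW w) :
    (16 - 2 * phi) / 5 ≤ cRefl 0 (convexHull ℝ (Set.range w)) := by
  by_contra h
  push Not at h
  have hA : 0 < pentArea w := by rw [hw.pentArea_eq]; have := hw.area_pos; linarith
  have h1 := ears_eq_of_cRefl_zero_le hw h.le 0
  have h2 := ear_le_of_cRefl_zero_five hw 0
  have h3 := mul_lt_mul_of_pos_right h hA
  linarith

/-! ### Reflections about points: upper bounds -/

/-- For a vertex `p` the hull is the parallelogram with centre `p` spanned by the opposite side and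
its image; its diagonals cut it into four triangles of the original area. -/
theorem cRefl_zero_three_le {w : Fin 3 → Euc 2} (hw : IsCCW w) :
    cRefl 0 (convexHull ℝ (Set.range w)) ≤ 4 := by
  refine cRefl_zero_le_of_vertices (Set.finite_range w) hw.area_pos ?_
  have key : ∀ p a b : Euc 2, Set.range w = {p, a, b} → tri p a b = tri (w 0) (w 1) (w 2) →
      volume.real (convexHull ℝ (Set.range w ∪ (fun x => (2 : ℝ) • p - x) '' Set.range w)) ≤
      4 * volume.real (convexHull ℝ (Set.range w)) := by
    intro p a b hr ht
    have h012 := hw 0 1 2 (by decide) (by decide)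
    have e1 : tri a b ((2 : ℝ) • p - a) = 2 * tri p a b := by simp [tri_def]; ring
    have e2 : tri a b ((2 : ℝ) • p - b) = 2 * tri p a b := by simp [tri_def]; ring
    have e3 : tri a ((2 : ℝ) • p - a) ((2 : ℝ) • p - b) = 2 * tri p a b := by
      simp [tri_def]; ring
    have e4 : tri b ((2 : ℝ) • p - a) ((2 : ℝ) • p - b) = 2 * tri p a b := by
      simp [tri_def]; ring
    have hq := area_quad (a := a) (b := b) (c := (2 : ℝ) • p - a) (d := (2 : ℝ) • p - b)
      (by rw [e1]; linarith) (by rw [e2]; linarith) (by rw [e3]; linarith) (by rw [e4]; linarith)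
    rw [e1, e3, ht] at hq
    rw [hw.area_three, show 4 * (tri (w 0) (w 1) (w 2) / 2) = (2 * tri (w 0) (w 1) (w 2) +
      2 * tri (w 0) (w 1) (w 2)) / 2 by ring, ← hq]
    refine measureReal_mono (convexHull_min ?_ (convex_convexHull ℝ _))
      (finite_hull_ne_top (by simp))
    set Q := convexHull ℝ {a, b, (2 : ℝ) • p - a, (2 : ℝ) • p - b} with hQ
    have ha : a ∈ Q := subset_convexHull ℝ _ (by simp)
    have hb : b ∈ Q := subset_convexHull ℝ _ (by simp)
    have ha' : (2 : ℝ) • p - a ∈ Q := subset_convexHull ℝ _ (by simp)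
    have hb' : (2 : ℝ) • p - b ∈ Q := subset_convexHull ℝ _ (by simp)
    have hp : p ∈ Q := by
      have := (convex_convexHull ℝ _) ha ha' (a := 1 / 2) (b := 1 / 2) (by norm_num)
        (by norm_num) (by norm_num)
      convert this using 1; module
    have hp' : (2 : ℝ) • p - p ∈ Q := by convert hp using 1; module
    rw [hr]
    rintro x ((rfl | rfl | rfl) | ⟨y, (rfl | rfl | rfl), rfl⟩) <;> assumption
  have hr : Set.range w = {w 0, w 1, w 2} := by
    ext x; simp [Fin.exists_fin_succ, eq_comm]
  rintro _ ⟨i, rfl⟩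
  fin_cases i
  · exact key (w 0) (w 1) (w 2) hr rfl
  · exact key (w 1) (w 2) (w 0) (by rw [hr]; ext x; simp; tauto) (tri_rotate _ _ _)
  · exact key (w 2) (w 0) (w 1) (by rw [hr]; ext x; simp; tauto) (tri_rotate _ _ _).symm

/-- By symmetry the reflection about `p` acts on `K` as the translation by `2 (p - c)`. This vector
is the difference of `p` and its mirror point, so the bound for translates applies. -/
theorem cRefl_zero_le_three_of_symm {K : Set (Euc 2)} (hK : Convex ℝ K) (hKc : IsCompact K)
    (hvol : 0 < volume.real K) {c : Euc 2} (hc : ∀ x ∈ K, (2 : ℝ) • c - x ∈ K) :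
    cRefl 0 K ≤ 3 := by
  refine cRefl_zero_le hK hvol fun p hp => ?_
  have himg : (fun x => (2 : ℝ) • p - x) '' K = (fun x => x + (2 : ℝ) • (p - c)) '' K := by
    ext z
    constructor
    · rintro ⟨x, hx, rfl⟩
      exact ⟨_, hc x hx, by module⟩
    · rintro ⟨x, hx, rfl⟩
      exact ⟨_, hc x hx, by module⟩
  rw [himg]
  refine (area_hull_translate_le hK hKc ⟨p, hp⟩ _ (M := 2 * volume.real K) ?_).trans (by linarith)
  intro x hx y hy
  have := four_point_area hK hKc.measure_lt_top.ne hp (hc p hp) hx hy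
  have e : p - ((2 : ℝ) • c - p) = (2 : ℝ) • (p - c) := by module
  rw [e] at this
  exact (abs_le.1 this).2

/-- The golden pentagon has these six determinants when seen from any of its vertices, so one
computation covers all five centres. -/
theorem area_octagon {p a b c d : Euc 2} (hab : tri p a b = 1) (hac : tri p a c = phi)
    (had : tri p a d = 1) (hbc : tri p b c = phi) (hbd : tri p b d = phi) (hcd : tri p c d = 1) :
    volume.real (convexHull ℝ (Set.range ![a, b, c, d, (2 : ℝ) • p - a, (2 : ℝ) • p - b,
      (2 : ℝ) • p - c, (2 : ℝ) • p - d])) = phi + 3 := by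
  obtain ⟨h1, h2⟩ := phi_bounds
  simp only [tri_def] at hab hac had hbc hbd hcd
  rw [shoelace 6]
  · simp [Fin.sum_univ_succ, tri_def]
    linarith
  · intro i j k hij hjk
    fin_cases i <;> fin_cases j <;> first | (exfalso; revert hij; decide) | skip
    all_goals
      fin_cases k <;> first | (exfalso; revert hjk; decide) | skip
    all_goals
      simp [tri_def]
      linarith

theorem cRefl_zero_goldenPentagon_le :
    cRefl 0 (convexHull ℝ (Set.range goldenPentagon)) ≤ (16 - 2 * phi) / 5 := by
  have hsq := phi_sq
  obtain ⟨h1, h2⟩ := phi_bounds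
  refine cRefl_zero_le_of_vertices (Set.finite_range _) goldenPentagon_isCCW.area_pos ?_
  rintro _ ⟨i, rfl⟩
  have hoct := area_octagon (p := goldenPentagon i) (a := goldenPentagon (i + 1))
    (b := goldenPentagon (i + 2)) (c := goldenPentagon (i + 3)) (d := goldenPentagon (i + 4))
    (by fin_cases i <;> simp [goldenPentagon, tri_def] <;> linarith)
    (by fin_cases i <;> simp [goldenPentagon, tri_def] <;> linarith)
    (by fin_cases i <;> simp [goldenPentagon, tri_def] <;> linarith)
    (by fin_cases i <;> simp [goldenPentagon, tri_def] <;> linarith)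
    (by fin_cases i <;> simp [goldenPentagon, tri_def] <;> linarith)
    (by fin_cases i <;> simp [goldenPentagon, tri_def] <;> linarith)
  rw [goldenPentagon_area, show (16 - 2 * phi) / 5 * ((phi + 2) / 2) = phi + 3 by
    linear_combination -hsq / 5, ← hoct]
  set p := goldenPentagon i with hp
  set O := ![goldenPentagon (i + 1), goldenPentagon (i + 2), goldenPentagon (i + 3),
    goldenPentagon (i + 4), (2 : ℝ) • p - goldenPentagon (i + 1),
    (2 : ℝ) • p - goldenPentagon (i + 2), (2 : ℝ) • p - goldenPentagon (i + 3),
    (2 : ℝ) • p - goldenPentagon (i + 4)] with hO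
  refine measureReal_mono (convexHull_min ?_ (convex_convexHull ℝ _))
    (finite_hull_ne_top (Set.finite_range _))
  have hpm : p ∈ convexHull ℝ (Set.range O) := by
    have := (convex_convexHull ℝ _) (mem_hull_range O 0) (mem_hull_range O 4) (a := 1 / 2)
      (b := 1 / 2) (by norm_num) (by norm_num) (by norm_num)
    convert this using 1
    simp [hO]; module
  have hall : ∀ i j : Fin 5, j = i ∨ j = i + 1 ∨ j = i + 2 ∨ j = i + 3 ∨ j = i + 4 := by
    decide
  rintro x (⟨j, rfl⟩ | ⟨_, ⟨j, rfl⟩, rfl⟩)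
  · rcases hall i j with rfl | rfl | rfl | rfl | rfl
    exacts [hpm, mem_hull_range O 0, mem_hull_range O 1, mem_hull_range O 2, mem_hull_range O 3]
  · rcases hall i j with rfl | rfl | rfl | rfl | rfl
    · convert hpm using 1
      rw [hp]; module
    exacts [mem_hull_range O 4, mem_hull_range O 5, mem_hull_range O 6, mem_hull_range O 7]

/-! ### Orthonormal frames and reflections about lines -/

/-- The dot product of two plane vectors. -/
def dot (p q : Euc 2) : ℝ := p 0 * q 0 + p 1 * q 1

/-- The vector `e` turned by a right angle. -/
def turn (e : Euc 2) : Euc 2 := !₂[-e 1, e 0]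

/-- The point with coordinates `X`, `Y` in the frame with origin `v` and first axis `e`. -/
def frm (e v : Euc 2) (X Y : ℝ) : Euc 2 := v + (X • e + Y • turn e)

theorem tri_frm {e : Euc 2} (he : dot e e = 1) (v : Euc 2) (a b c d f g : ℝ) :
    tri (frm e v a b) (frm e v c d) (frm e v f g) = (c - a) * (g - b) - (d - b) * (f - a) := by
  simp only [dot] at he
  simp [tri_def, frm, turn]
  linear_combination ((c - a) * (g - b) - (d - b) * (f - a)) * he

theorem dd_frm {e : Euc 2} (he : dot e e = 1) (v : Euc 2) (a b c d f g h i : ℝ) :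
    dd (frm e v a b - frm e v c d) (frm e v f g - frm e v h i) =
      (a - c) * (g - i) - (b - d) * (f - h) := by
  simp only [dot] at he
  simp [dd, frm, turn]
  linear_combination ((a - c) * (g - i) - (b - d) * (f - h)) * he

theorem eq_frm {e : Euc 2} (he : dot e e = 1) (v x : Euc 2) :
    x = frm e v (dot e (x - v)) (dd e (x - v)) := by
  simp only [dot] at he
  apply euc_ext <;> simp [frm, turn, dot, dd]
  · linear_combination (v 0 - x 0) * he
  · linear_combination (v 1 - x 1) * he

theorem frm_zero (e v : Euc 2) : frm e v 0 0 = v := by simp [frm]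

theorem frm_neg (e v : Euc 2) (X Y : ℝ) : frm (-e) v X Y = frm e v (-X) (-Y) := by
  apply euc_ext <;> simp [frm, turn]

/-- The reflection about the line through `v` in the direction of the unit vector `e`. -/
def lineRefl (e v x : Euc 2) : Euc 2 := frm e v (dot e (x - v)) (-dd e (x - v))

theorem dot_eq_inner (e x : Euc 2) : inner ℝ e x = dot e x := by
  simp [PiLp.inner_apply, Fin.sum_univ_two, dot, mul_comm]

theorem lineRefl_eq_reflection {e : Euc 2} (he : dot e e = 1) (v x : Euc 2) :
    (ℝ ∙ e).reflection (x - v) + v = lineRefl e v x := by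
  have hn : ‖e‖ = 1 := by
    have h := real_inner_self_eq_norm_sq e
    rw [dot_eq_inner, he] at h
    nlinarith [norm_nonneg e]
  rw [Submodule.reflection_singleton_apply, dot_eq_inner, hn]
  simp only [dot] at he
  apply euc_ext <;> simp [lineRefl, frm, turn, dot, dd]
  · linear_combination (x 0 - v 0) * he
  · linear_combination (x 1 - v 1) * he

theorem exists_unit {e : Euc 2} (he : e ≠ 0) : ∃ r : ℝ, 0 < r ∧ r ^ 2 = dot e e ∧
    dot (r⁻¹ • e) (r⁻¹ • e) = 1 := by
  have h := sq_norm_pos he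
  have h' : 0 < dot e e := by simp only [dot]; nlinarith
  refine ⟨√(dot e e), Real.sqrt_pos.2 h', Real.sq_sqrt h'.le, ?_⟩
  have hs := Real.mul_self_sqrt h'.le
  have : dot ((√(dot e e))⁻¹ • e) ((√(dot e e))⁻¹ • e) =
      (√(dot e e))⁻¹ * (√(dot e e))⁻¹ * dot e e := by simp [dot]; ring
  rw [this, ← mul_inv, hs, inv_mul_cancel₀ h'.ne']

theorem reflection_congr {U V : Submodule ℝ (Euc 2)} [U.HasOrthogonalProjection]
    [V.HasOrthogonalProjection] (h : U = V) (x : Euc 2) : U.reflection x = V.reflection x := by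
  subst h; rfl

theorem mem_flatReflections_one {σ : Euc 2 ≃ᵢ Euc 2} (h : σ ∈ flatReflections 2 1) :
    ∃ e v : Euc 2, dot e e = 1 ∧ (σ : Euc 2 → Euc 2) = lineRefl e v := by
  obtain ⟨F, hF, hdim, rfl⟩ := h
  have ⟨⟨p, hp⟩⟩ := hF
  obtain ⟨⟨e, heF⟩, he0, hspan⟩ := finrank_eq_one_iff'.1 hdim
  have he : e ≠ 0 := fun h => he0 (Subtype.ext h)
  obtain ⟨r, hr, -, hunit⟩ := exists_unit he
  have hdir : F.direction = ℝ ∙ (r⁻¹ • e) := by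
    apply le_antisymm
    · intro x hx
      obtain ⟨c, hc⟩ := hspan ⟨x, hx⟩
      have hc' : c • e = x := congrArg Subtype.val hc
      refine Submodule.mem_span_singleton.2 ⟨c * r, ?_⟩
      rw [smul_smul, mul_assoc, mul_inv_cancel₀ hr.ne', mul_one, hc']
    · rw [Submodule.span_singleton_le_iff_mem]
      exact F.direction.smul_mem _ heF
  refine ⟨r⁻¹ • e, p, hunit, ?_⟩
  ext1 x
  rw [← lineRefl_eq_reflection hunit]
  change EuclideanGeometry.reflection F x = _
  rw [EuclideanGeometry.reflection_apply_of_mem F x hp]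
  simp only [vsub_eq_sub, vadd_eq_add]
  rw [reflection_congr hdir]

theorem exists_lineReflection {e : Euc 2} (he : dot e e = 1) (v : Euc 2) :
    ∃ σ ∈ flatReflections 2 1, (σ : Euc 2 → Euc 2) = lineRefl e v := by
  have hne : Nonempty (AffineSubspace.mk' v (ℝ ∙ e)) := ⟨v, AffineSubspace.self_mem_mk' v _⟩
  have he0 : e ≠ 0 := by rintro rfl; simp [dot] at he
  refine ⟨(EuclideanGeometry.reflection (AffineSubspace.mk' v (ℝ ∙ e))).toIsometryEquiv,
    ⟨_, hne, by rw [AffineSubspace.direction_mk', finrank_span_singleton he0], rfl⟩, ?_⟩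
  ext1 x
  rw [← lineRefl_eq_reflection he]
  change EuclideanGeometry.reflection _ x = _
  rw [EuclideanGeometry.reflection_apply_of_mem _ x (AffineSubspace.self_mem_mk' v _)]
  simp only [vsub_eq_sub, vadd_eq_add]
  rw [reflection_congr (AffineSubspace.direction_mk' v _)]

theorem lineRefl_self (e v : Euc 2) : lineRefl e v v = v := by
  simp [lineRefl, dot, dd, frm]

theorem le_cRefl_one_mul {K : Set (Euc 2)} (hKc : IsCompact K) (hvol : 0 < volume.real K)
    {v e : Euc 2} (hv : v ∈ K) (he : dot e e = 1) :
    volume.real (convexHull ℝ (K ∪ lineRefl e v '' K)) ≤ cRefl 1 K * volume.real K := by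
  obtain ⟨σ, hσ, h⟩ := exists_lineReflection he v
  have := area_le_relHull_mul hKc.isBounded hvol hσ ⟨v, hv, v, hv, by rw [h, lineRefl_self]⟩
  rwa [h] at this

/-- The linear part of the reflection about a line with direction `e`. -/
def lineReflL (e : Euc 2) : Euc 2 →ₗ[ℝ] Euc 2 where
  toFun x := dot e x • e - dd e x • turn e
  map_add' x y := by apply euc_ext <;> simp [dot, dd, turn] <;> ring
  map_smul' c x := by apply euc_ext <;> simp [dot, dd, turn] <;> ring

/-- Shifting the line parallel to itself only translates the mirror image, which makes
`convexOn_area_hull` applicable. -/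
theorem lineRefl_eq {e : Euc 2} (he : dot e e = 1) (v : Euc 2) :
    lineRefl e v = fun x => lineReflL e x + (2 * dd e v) • turn e := by
  ext1 x
  simp only [dot] at he
  apply euc_ext <;> simp [lineRefl, lineReflL, frm, turn, dot, dd]
  · linear_combination -(v 0) * he
  · linear_combination -(v 1) * he

/-- For a fixed direction the hull area is convex in the offset `dd e v`. A line whose reflection
makes the sets meet has its offset between those of the two parallel support lines, because it
passes through the midpoint of a point and its image. -/
theorem cRefl_one_le_of_support {T : Set (Euc 2)} (hT : T.Finite)
    (hvol : 0 < volume.real (convexHull ℝ T)) {c : ℝ}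
    (h : ∀ e : Euc 2, dot e e = 1 → ∀ v ∈ T, (∀ x ∈ T, 0 ≤ dd e (x - v)) →
      volume.real (convexHull ℝ (T ∪ lineRefl e v '' T)) ≤ c * volume.real (convexHull ℝ T)) :
    cRefl 1 (convexHull ℝ T) ≤ c := by
  have hne : T.Nonempty := by
    by_contra h
    rw [Set.not_nonempty_iff_eq_empty] at h
    simp [h] at hvol
  refine relHull_le hvol ?_ ?_
  · obtain ⟨p, hp⟩ := hne
    obtain ⟨σ, hσ, h⟩ := exists_lineReflection (e := !₂[1, 0]) (by simp [dot]) p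
    exact ⟨σ, hσ, p, subset_convexHull ℝ _ hp, p, subset_convexHull ℝ _ hp,
      by rw [h, lineRefl_self]⟩
  rintro σ hσ hmeet
  obtain ⟨e, v, he, hσe⟩ := mem_flatReflections_one hσ
  rw [hσe] at hmeet ⊢
  have hL : ∀ v : Euc 2, convexHull ℝ (convexHull ℝ T ∪ lineRefl e v '' convexHull ℝ T) =
      convexHull ℝ (T ∪ (fun x => x + (2 * dd e v) • turn e) '' (lineReflL e '' T)) := by
    intro v; rw [lineRefl_eq he, hull_union_image_hull]
  have hL' : ∀ v : Euc 2, convexHull ℝ (T ∪ lineRefl e v '' T) =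
      convexHull ℝ (T ∪ (fun x => x + (2 * dd e v) • turn e) '' (lineReflL e '' T)) := by
    intro v; rw [lineRefl_eq he, Set.image_image]
  have hc := convexOn_area_hull hT (hT.image (lineReflL e)) hne (hne.image (lineReflL e))
  have hc2 := (hc.comp_linearMap (LinearMap.toSpanSingleton ℝ (Euc 2) ((2 : ℝ) • turn e))).convex_le
    (c * volume.real (convexHull ℝ T))
  have hmem : ∀ v : Euc 2, dd e v ∈ {x ∈ LinearMap.toSpanSingleton ℝ (Euc 2) ((2 : ℝ) • turn e) ⁻¹'
      Set.univ | ((fun v => volume.real (convexHull ℝ (T ∪ (fun x => x + v) ''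
        (lineReflL e '' T)))) ∘ LinearMap.toSpanSingleton ℝ (Euc 2) ((2 : ℝ) • turn e)) x ≤
        c * volume.real (convexHull ℝ T)} ↔
      volume.real (convexHull ℝ (T ∪ lineRefl e v '' T)) ≤ c * volume.real (convexHull ℝ T) := by
    intro v
    rw [hL' v]
    simp [LinearMap.toSpanSingleton_apply, smul_smul, mul_comm]
  obtain ⟨a, ha, hamin⟩ := Set.exists_min_image T (dd e) hT hne
  obtain ⟨b, hb, hbmax⟩ := Set.exists_max_image T (dd e) hT hne
  have h1 := (hmem a).2 (h e he a ha fun x hx => by rw [dd_sub]; linarith [hamin x hx])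
  -- Replacing `e` by `-e` gives the same reflection and puts `T` on the required side of the upper
  -- support line.
  have h2 := (hmem b).2 (by
    have := h (-e) (by rw [← he]; simp [dot]) b hb fun x hx => by
      have : dd (-e) (x - b) = dd e b - dd e x := by simp [dd]; ring
      rw [this]; linarith [hbmax x hx]
    have e1 : lineRefl (-e) b = lineRefl e b := by
      ext1 x
      apply euc_ext <;> simp [lineRefl, frm, turn, dot, dd] <;> ring
    rwa [e1] at this)
  have hrange : ∀ x ∈ convexHull ℝ T, dd e a ≤ dd e x ∧ dd e x ≤ dd e b := by
    intro x hx
    exact ⟨convexHull_min (t := {z | dd e a ≤ ddL e z}) hamin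
      (convex_halfSpace_ge (ddL e).isLinear _) hx, convexHull_min (t := {z | ddL e z ≤ dd e b})
      hbmax (convex_halfSpace_le (ddL e).isLinear _) hx⟩
  have hv : dd e a ≤ dd e v ∧ dd e v ≤ dd e b := by
    obtain ⟨x, hx, y, hy, hxy⟩ := hmeet
    have h3 : dd e x + dd e y = 2 * dd e v := by
      rw [← hxy]
      simp only [dot] at he
      simp [lineRefl, frm, turn, dot, dd]
      linear_combination (2 * (e 0 * v 1 - e 1 * v 0) - (e 0 * y 1 - e 1 * y 0) -
        (e 0 * v 1 - e 1 * v 0)) * he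
    have := hrange x hx
    have := hrange y hy
    constructor <;> linarith
  have h3 := (hmem v).1 (hc2.ordConnected.out h1 h2 hv)
  rw [hL v, ← hL' v]
  exact h3

/-! ### Reflections about lines: lower bounds -/

/-- Two points and their mirror images span a trapezoid. -/
theorem trapezoid_le {C : Set (Euc 2)} (hC : Convex ℝ C) (hC' : volume C ≠ ⊤) {e v : Euc 2}
    (he : dot e e = 1) {a b c d : ℝ} (h1 : frm e v a b ∈ C) (h2 : frm e v c d ∈ C)
    (h3 : frm e v a (-b) ∈ C) (h4 : frm e v c (-d) ∈ C) :
    (a - c) * (b + d) ≤ volume.real C := by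
  -- The diagonals have determinant twice the claimed value, which avoids any sign conditions on the
  -- coordinates.
  have := four_point_area hC hC' h1 h4 h2 h3
  rw [dd_frm he] at this
  have := (abs_le.1 this).2
  linarith

/-- Lower bound for a line through the apex `v` of a triangle `v b d`. -/
theorem area_lineRefl_triangle_ge {K : Set (Euc 2)} (hKc : IsCompact K) (hvol : 0 < volume.real K)
    {v b d : Euc 2} (hv : v ∈ K) (hb : b ∈ K) (hd : d ∈ K) (hD : 0 < tri v b d) :
    ∃ δ : ℝ, 0 < δ ∧ 2 * tri v b d + δ * (dot (d - v) (d - v) - dot (b - v) (b - v)) ^ 2 ≤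
      cRefl 1 K * volume.real K := by
  set ω := d - b with hω
  set m := (b - v) + (d - v) with hm
  set D := tri v b d with hDdef
  have hdd : dd m ω = 2 * D := by
    simp [hm, hω, hDdef, tri, dd]; ring
  -- For a unit direction `e` the trapezoid bound is `(e · ω) (e · turn m)`, so a direction between
  -- `ω` and `turn m` is wanted. Taking the unnormalized sum keeps everything rational up to the
  -- norm of `f`.
  set f := ω + turn m with hf
  have hff : dot f f = dot ω ω + dot m m + 4 * D := by
    have : dot f f = dot ω ω + dot m m + 2 * dd m ω := by simp [hf, dot, turn, dd]; ring
    rw [this, hdd]; ring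
  have hnn : ∀ x : Euc 2, 0 ≤ dot x x := fun x => by
    simp only [dot]; nlinarith [sq_nonneg (x 0), sq_nonneg (x 1)]
  have hffpos : 0 < dot f f := by
    have := hnn ω
    have := hnn m
    linarith
  have hf0 : f ≠ 0 := by
    intro h; rw [h] at hffpos; simp [dot] at hffpos
  obtain ⟨r, hr, hr2, he⟩ := exists_unit hf0
  set e := r⁻¹ • f with hedef
  refine ⟨(dot f f)⁻¹, by positivity, ?_⟩
  refine le_trans ?_ (le_cRefl_one_mul hKc hvol hv he)
  have hC : ∀ x ∈ K, frm e v (dot e (x - v)) (dd e (x - v)) ∈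
      convexHull ℝ (K ∪ lineRefl e v '' K) := by
    intro x hx
    rw [← eq_frm he]
    exact subset_convexHull ℝ _ (Or.inl hx)
  have hC' : ∀ x ∈ K, frm e v (dot e (x - v)) (-dd e (x - v)) ∈
      convexHull ℝ (K ∪ lineRefl e v '' K) := fun x hx =>
    subset_convexHull ℝ _ (Or.inr ⟨x, hx, rfl⟩)
  have hcont : Continuous (lineRefl e v) := by
    unfold lineRefl frm dot dd; fun_prop
  have key := trapezoid_le (convex_convexHull ℝ _) (hull_union_ne_top hKc (hKc.image hcont)) he
    (hC' d hd) (hC' b hb) (by rw [neg_neg]; exact hC d hd) (by rw [neg_neg]; exact hC b hb)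
  refine le_trans (le_of_eq ?_) key
  have e1 : dot e (d - v) - dot e (b - v) = r⁻¹ * (dot ω ω + 2 * D) := by
    rw [← hdd]; simp [hedef, hf, hω, hm, dot, turn, dd]; ring
  have e2 : -dd e (d - v) + -dd e (b - v) = r⁻¹ * (dot m m + 2 * D) := by
    rw [← hdd]; simp [hedef, hf, hω, hm, dot, turn, dd]; ring
  rw [e1, e2, ← hr2]
  have e3 : dot (d - v) (d - v) - dot (b - v) (b - v) = dot m ω := by
    simp [hω, hm, dot]; ring
  -- Lagrange's identity; its term `dot m ω ^ 2` is the asymmetry that survives in the bound, with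
  -- `δ = 1 / |f| ^ 2`.
  have e4 : dot m ω ^ 2 + (2 * D) ^ 2 = dot m m * dot ω ω := by
    rw [← hdd]; simp only [dot, dd]; ring
  rw [e3]
  rw [← hr2] at hff
  field_simp
  rw [hff]
  linear_combination e4

theorem dist_eq_of_dot_eq {a b c d : Euc 2} (h : dot (a - b) (a - b) = dot (c - d) (c - d)) :
    dist a b = dist c d := by
  rw [EuclideanSpace.dist_eq, EuclideanSpace.dist_eq]
  congr 1
  simp only [dot, PiLp.sub_apply] at h
  simp only [Fin.sum_univ_two, Real.dist_eq, sq_abs]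
  linarith

theorem le_cRefl_one_three {w : Fin 3 → Euc 2} (hw : IsCCW w) :
    4 ≤ cRefl 1 (convexHull ℝ (Set.range w)) := by
  have hpos := hw.area_pos
  obtain ⟨δ, hδ, h⟩ := area_lineRefl_triangle_ge (isCompact_hull_range w) hpos
    (mem_hull_range w 0) (mem_hull_range w 1) (mem_hull_range w 2)
    (hw 0 1 2 (by decide) (by decide))
  have e := hw.area_three
  have := mul_nonneg hδ.le (sq_nonneg (dot (w 2 - w 0) (w 2 - w 0) - dot (w 1 - w 0) (w 1 - w 0)))
  exact le_of_mul_le_mul_right (by linarith) hpos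

/-- The main term already equals four times the area, so the asymmetry term at each vertex must
vanish. -/
theorem isosceles_of_cRefl_one_le {w : Fin 3 → Euc 2} (hw : IsCCW w)
    (hc : cRefl 1 (convexHull ℝ (Set.range w)) ≤ 4) {i j k : Fin 3}
    (hD : tri (w i) (w j) (w k) = tri (w 0) (w 1) (w 2)) :
    dot (w k - w i) (w k - w i) = dot (w j - w i) (w j - w i) := by
  have hpos := hw.area_pos
  have e := hw.area_three
  obtain ⟨δ, hδ, h⟩ := area_lineRefl_triangle_ge (isCompact_hull_range w) hpos
    (mem_hull_range w i) (mem_hull_range w j) (mem_hull_range w k)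
    (by rw [hD]; exact hw 0 1 2 (by decide) (by decide))
  have h2 := mul_le_mul_of_nonneg_right hc hpos.le
  rw [hD] at h
  set s := dot (w k - w i) (w k - w i) - dot (w j - w i) (w j - w i) with hs
  have h3 : δ * s ^ 2 ≤ 0 := by linarith
  have h4 : s ^ 2 ≤ 0 := by
    by_contra h
    push Not at h
    have := mul_pos hδ h
    linarith
  have h5 : s = 0 := by nlinarith [sq_nonneg s]
  linarith

theorem tri_eq_zero_of_collinear {a b c : Euc 2} (h : Collinear ℝ {a, b, c}) : tri a b c = 0 := by
  obtain ⟨p, v, h⟩ := (collinear_iff_exists_forall_eq_smul_vadd _).1 h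
  obtain ⟨r, rfl⟩ := h a (by simp)
  obtain ⟨s, rfl⟩ := h b (by simp)
  obtain ⟨t, rfl⟩ := h c (by simp)
  simp [tri_def]
  ring

theorem isEquilateral_of_cRefl_one_le {w : Fin 3 → Euc 2} (hw : IsCCW w)
    (hc : cRefl 1 (convexHull ℝ (Set.range w)) ≤ 4) :
    IsEquilateralTriangle (convexHull ℝ (Set.range w)) := by
  have h0 := isosceles_of_cRefl_one_le hw hc (i := 0) (j := 1) (k := 2) rfl
  have h1 := isosceles_of_cRefl_one_le hw hc (i := 1) (j := 2) (k := 0) (tri_rotate _ _ _)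
  have hr : Set.range w = {w 0, w 1, w 2} := by
    ext x; simp [Fin.exists_fin_succ, eq_comm]
  refine ⟨w 0, w 1, w 2, ?_, by rw [hr], dist_eq_of_dot_eq ?_, dist_eq_of_dot_eq ?_⟩
  · rw [affineIndependent_iff_not_collinear_set]
    exact fun h => (hw 0 1 2 (by decide) (by decide)).ne' (tri_eq_zero_of_collinear h)
  · simp only [dot, PiLp.sub_apply] at *; linarith
  · simp only [dot, PiLp.sub_apply] at *; linarith

theorem tri_frm_horizontal {e : Euc 2} (he : dot e e = 1) (v : Euc 2) (a b c f g : ℝ) :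
    tri (frm e v a b) (frm e v c b) (frm e v f g) = (c - a) * (g - b) := by
  rw [tri_frm he]; ring

theorem frm_ne_frm {e : Euc 2} (he : dot e e = 1) (v : Euc 2) {a b c : ℝ} (hac : a < c) :
    frm e v a b ≠ frm e v c b := by
  intro h
  have h1 := tri_frm_horizontal he v a b c 0 (b + 1)
  rw [h, tri_self₃] at h1
  linarith

/-- A rectangle of height `2 y` with a triangle of height `z` on each horizontal side; two
horizontal cuts separate the three pieces. -/
theorem hexagon_le {C : Set (Euc 2)} (hC : Convex ℝ C) (hC' : volume C ≠ ⊤) {e v : Euc 2}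
    (he : dot e e = 1) {xb xd xa y z : ℝ} (hx : xb < xd) (hy : 0 ≤ y) (hz : 0 ≤ z)
    (h1 : frm e v xb (-y) ∈ C) (h2 : frm e v xd (-y) ∈ C) (h3 : frm e v xb y ∈ C)
    (h4 : frm e v xd y ∈ C) (h5 : frm e v xa (-(y + z)) ∈ C) (h6 : frm e v xa (y + z) ∈ C) :
    (xd - xb) * (y + y) + (xd - xb) * z ≤ volume.real C := by
  have hx' : 0 ≤ xd - xb := by linarith
  let R : Set (Euc 2) := {frm e v xb (-y), frm e v xd (-y), frm e v xb y, frm e v xd y}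
  let T : Set (Euc 2) := {frm e v xb (-y), frm e v xd (-y), frm e v xb y, frm e v xd y,
    frm e v xa (y + z)}
  have hTC : convexHull ℝ T ⊆ C := by
    refine convexHull_min ?_ hC
    rintro p (rfl | rfl | rfl | rfl | rfl) <;> assumption
  have k1 := area_add_le_of_line (frm_ne_frm he v (b := -y) hx) hC hC'
    (S := {frm e v xb (-y), frm e v xd (-y), frm e v xa (-(y + z))}) (T := T)
    (by rintro p (rfl | rfl | rfl) <;> assumption)
    ((subset_convexHull ℝ _).trans hTC)
    (by
      rintro p (rfl | rfl | rfl) <;> rw [tri_frm_horizontal he] <;>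
        exact mul_nonpos_of_nonneg_of_nonpos hx' (by linarith))
    (by
      rintro p (rfl | rfl | rfl | rfl | rfl) <;> rw [tri_frm_horizontal he] <;>
        exact mul_nonneg hx' (by linarith))
  have k2 := area_add_le_of_line (frm_ne_frm he v (b := y) hx) (convex_convexHull ℝ T)
    (finite_hull_ne_top (by simp [T]))
    (S := R) (T := {frm e v xb y, frm e v xd y, frm e v xa (y + z)})
    (by rintro p (rfl | rfl | rfl | rfl) <;> exact subset_convexHull ℝ _ (by simp [T]))
    (by rintro p (rfl | rfl | rfl) <;> exact subset_convexHull ℝ _ (by simp [T]))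
    (by
      rintro p (rfl | rfl | rfl | rfl) <;> rw [tri_frm_horizontal he] <;>
        exact mul_nonpos_of_nonneg_of_nonpos hx' (by linarith))
    (by
      rintro p (rfl | rfl | rfl) <;> rw [tri_frm_horizontal he] <;>
        exact mul_nonneg hx' (by linarith))
  have k3 := trapezoid_le (convex_convexHull ℝ R) (finite_hull_ne_top (by simp [R])) he
    (v := v) (a := xd) (b := y) (c := xb) (d := y) (subset_convexHull ℝ _ (by simp [R]))
    (subset_convexHull ℝ _ (by simp [R])) (subset_convexHull ℝ _ (by simp [R]))
    (subset_convexHull ℝ _ (by simp [R]))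
  rw [triangle_area, tri_frm_horizontal he] at k1 k2
  have a1 : (xd - xb) * (-(y + z) - -y) = -((xd - xb) * z) := by ring
  have a2 : (xd - xb) * (y + z - y) = (xd - xb) * z := by ring
  have hz' := mul_nonneg hx' hz
  rw [a1, abs_neg, abs_of_nonneg hz'] at k1
  rw [a2, abs_of_nonneg hz'] at k2
  linarith

/-- Lower bound for a line through a corner of a quadrangle, parallel to the opposite diagonal. -/
theorem area_lineRefl_corner_ge {K : Set (Euc 2)} (hKc : IsCompact K) (hvol : 0 < volume.real K)
    {v a b d : Euc 2} (hv : v ∈ K) (ha : a ∈ K) (hb : b ∈ K) (hd : d ∈ K) (hD : 0 < tri v b d)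
    (hD' : 0 < tri a d b) :
    2 * tri v b d + tri a d b ≤ cRefl 1 K * volume.real K := by
  have hbd : d - b ≠ 0 := by
    intro h
    obtain rfl := sub_eq_zero.1 h
    rw [tri_self₂] at hD
    exact lt_irrefl _ hD
  -- The axis is parallel to the diagonal `bd` of length `r`, so `b` and `d` have equal distance
  -- from it. The quotients by `r` below are the heights of the triangles `v b d` and `a d b` over
  -- that diagonal.
  obtain ⟨r, hr, hr2, he⟩ := exists_unit hbd
  have hyb : dd (r⁻¹ • (d - b)) (b - v) = -(r⁻¹ * tri v b d) := by
    simp [tri, dd]; ring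
  have hyd : dd (r⁻¹ • (d - b)) (d - v) = -(r⁻¹ * tri v b d) := by
    simp [tri, dd]; ring
  have hya : dd (r⁻¹ • (d - b)) (a - v) = -(r⁻¹ * tri v b d + r⁻¹ * tri a d b) := by
    simp [tri, dd]; ring
  have hx : dot (r⁻¹ • (d - b)) (d - v) - dot (r⁻¹ • (d - b)) (b - v) = r := by
    have : dot (r⁻¹ • (d - b)) (d - v) - dot (r⁻¹ • (d - b)) (b - v) =
        r⁻¹ * dot (d - b) (d - b) := by
      simp [dot]; ring
    rw [this, ← hr2]; field_simp
  have hrD : 0 < r⁻¹ * tri v b d := by positivity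
  have hrE : 0 < r⁻¹ * tri a d b := by positivity
  have hrr : r * (r⁻¹ * tri v b d) = tri v b d := by field_simp
  have hrrE : r * (r⁻¹ * tri a d b) = tri a d b := by field_simp
  generalize r⁻¹ * tri v b d = y at *
  generalize r⁻¹ * tri a d b = z at *
  generalize r⁻¹ • (d - b) = e at *
  refine le_trans ?_ (le_cRefl_one_mul hKc hvol hv he)
  have hcont : Continuous (lineRefl e v) := by
    unfold lineRefl frm dot dd; fun_prop
  have hC1 : ∀ x ∈ K, frm e v (dot e (x - v)) (dd e (x - v)) ∈
      convexHull ℝ (K ∪ lineRefl e v '' K) := by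
    intro x hx
    rw [← eq_frm he]
    exact subset_convexHull ℝ _ (Or.inl hx)
  have hC2 : ∀ x ∈ K, frm e v (dot e (x - v)) (-dd e (x - v)) ∈
      convexHull ℝ (K ∪ lineRefl e v '' K) := fun x hx =>
    subset_convexHull ℝ _ (Or.inr ⟨x, hx, rfl⟩)
  have h := hexagon_le (xb := dot e (b - v)) (xd := dot e (d - v)) (xa := dot e (a - v))
    (convex_convexHull ℝ _) (hull_union_ne_top hKc (hKc.image hcont)) he (by linarith) hrD.le hrE.le
    (hyb ▸ hC1 b hb) (hyd ▸ hC1 d hd) (by simpa only [hyb, neg_neg] using hC2 b hb)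
    (by simpa only [hyd, neg_neg] using hC2 d hd) (hya ▸ hC1 a ha)
    (by simpa only [hya, neg_neg] using hC2 a ha)
  rw [hx] at h
  linarith

/-- The two triangles on the diagonal make up the quadrangle, so the hexagon bound becomes the same
inequality as for point reflections, and `parallelogram_of_corner_le` can be reused. -/
theorem cRefl_one_corner_ge {w : Fin 4 → Euc 2} (hw : IsCCW w) (i : Fin 4) :
    2 * volume.real (convexHull ℝ (Set.range w)) + tri (w i) (w (i + 1)) (w (i + 3)) ≤
      cRefl 1 (convexHull ℝ (Set.range w)) * volume.real (convexHull ℝ (Set.range w)) := by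
  have h := area_lineRefl_corner_ge (isCompact_hull_range w) hw.area_pos (mem_hull_range w i)
    (mem_hull_range w (i + 2)) (mem_hull_range w (i + 1)) (mem_hull_range w (i + 3))
    (corner_pos hw i) (by
      have := corner_pos hw (i + 2)
      rwa [(by decide : ∀ i : Fin 4, i + 2 + 1 = i + 3),
        (by decide : ∀ i : Fin 4, i + 2 + 3 = i + 1)] at this)
  have := corner_add hw i
  linarith

theorem le_cRefl_one_four {w : Fin 4 → Euc 2} (hw : IsCCW w) :
    3 ≤ cRefl 1 (convexHull ℝ (Set.range w)) := by
  have h0 := cRefl_one_corner_ge hw 0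
  have h2 := cRefl_one_corner_ge hw 2
  have := corner_add hw 0
  simp only [zero_add, Fin.reduceAdd] at h0 h2 this
  exact le_of_mul_le_mul_right (by linarith) hw.area_pos

theorem parallelogram_of_cRefl_one_le {w : Fin 4 → Euc 2} (hw : IsCCW w)
    (h : cRefl 1 (convexHull ℝ (Set.range w)) ≤ 3) : w 0 + w 2 = w 1 + w 3 := by
  refine parallelogram_of_corner_le hw fun i => ?_
  have := cRefl_one_corner_ge hw i
  have := mul_le_mul_of_nonneg_right h hw.area_pos.le
  linarith

/-- Two trapezoids with the common side from `(xa, -ya)` to `(xa, ya)`. -/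
theorem two_trapezoids_le {C : Set (Euc 2)} (hC : Convex ℝ C) (hC' : volume C ≠ ⊤) {e v : Euc 2}
    (he : dot e e = 1) {xa xb xd ya yb yd : ℝ} (hy : 0 < ya) (hd : xd < xa → 0 ≤ yd + ya)
    (hb : xa < xb → 0 ≤ ya + yb)
    (h1 : frm e v xb yb ∈ C) (h2 : frm e v xb (-yb) ∈ C) (h3 : frm e v xd yd ∈ C)
    (h4 : frm e v xd (-yd) ∈ C) (h5 : frm e v xa ya ∈ C) (h6 : frm e v xa (-ya) ∈ C) :
    (xd - xa) * (yd + ya) + (xa - xb) * (ya + yb) ≤ volume.real C := by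
  have k1 := trapezoid_le hC hC' he h3 h5 h4 h6
  have k2 := trapezoid_le hC hC' he h5 h1 h6 h2
  -- If `xa` lies outside the interval from `xb` to `xd`, one of the two terms is nonpositive and a
  -- single trapezoid suffices.
  rcases lt_or_ge xd xa with hda | hda
  · have := mul_nonneg (sub_nonneg.2 hda.le) (hd hda)
    linarith
  rcases lt_or_ge xa xb with hab | hab
  · have := mul_nonneg (sub_nonneg.2 hab.le) (hb hab)
    linarith
  let S : Set (Euc 2) := {frm e v xd yd, frm e v xd (-yd), frm e v xa ya, frm e v xa (-ya)}
  let T : Set (Euc 2) := {frm e v xb yb, frm e v xb (-yb), frm e v xa ya, frm e v xa (-ya)}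
  have hne : frm e v xa (-ya) ≠ frm e v xa ya := by
    intro h
    have h1 := tri_frm he v xa (-ya) xa ya (xa + 1) 0
    rw [h, tri_self₃] at h1
    linarith
  have htri : ∀ f g, tri (frm e v xa (-ya)) (frm e v xa ya) (frm e v f g) =
      2 * ya * (xa - f) := by
    intro f g; rw [tri_frm he]; ring
  have k := area_add_le_of_line hne hC hC' (S := S) (T := T)
    (by rintro p (rfl | rfl | rfl | rfl) <;> assumption)
    (by rintro p (rfl | rfl | rfl | rfl) <;> assumption)
    (by
      rintro p (rfl | rfl | rfl | rfl) <;> rw [htri] <;>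
        exact mul_nonpos_of_nonneg_of_nonpos (by linarith) (by linarith))
    (by
      rintro p (rfl | rfl | rfl | rfl) <;> rw [htri] <;>
        exact mul_nonneg (by linarith) (by linarith))
  have k3 := trapezoid_le (convex_convexHull ℝ S) (finite_hull_ne_top (by simp [S])) he
    (v := v) (a := xd) (b := yd) (c := xa) (d := ya) (subset_convexHull ℝ _ (by simp [S]))
    (subset_convexHull ℝ _ (by simp [S])) (subset_convexHull ℝ _ (by simp [S]))
    (subset_convexHull ℝ _ (by simp [S]))
  have k4 := trapezoid_le (convex_convexHull ℝ T) (finite_hull_ne_top (by simp [T])) he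
    (v := v) (a := xa) (b := ya) (c := xb) (d := yb) (subset_convexHull ℝ _ (by simp [T]))
    (subset_convexHull ℝ _ (by simp [T])) (subset_convexHull ℝ _ (by simp [T]))
    (subset_convexHull ℝ _ (by simp [T]))
  linarith

/-- Lower bound for a line through the corner `v` of a parallelogram `v b a d`. -/
theorem area_lineRefl_parallelogram_ge {K : Set (Euc 2)} (hKc : IsCompact K)
    (hvol : 0 < volume.real K) {v a b d : Euc 2} (hv : v ∈ K) (ha : a ∈ K) (hb : b ∈ K)
    (hd : d ∈ K) (hpar : v + a = b + d) (hD : 0 < tri v b d) :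
    ∃ δ : ℝ, 0 < δ ∧ 3 * tri v b d + δ * (dot (d - v) (d - v) - dot (b - v) (b - v)) ^ 2 ≤
      cRefl 1 K * volume.real K := by
  obtain rfl : a = b + d - v := by rw [← hpar]; abel
  obtain ⟨D, hDdef⟩ : ∃ D, D = tri v b d := ⟨_, rfl⟩
  -- The direction is the one used for triangles, now the sum of one diagonal and the turned other
  -- one. All frame coordinates are linear in `u`, `y` and `x`, which are tied together by
  -- Lagrange's identity `huy`.
  obtain ⟨u, hu⟩ : ∃ u, u = dot (d - b) (d - b) + 2 * D := ⟨_, rfl⟩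
  obtain ⟨y, hy⟩ : ∃ y, y = dot (b + d - v - v) (b + d - v - v) + 2 * D := ⟨_, rfl⟩
  obtain ⟨x, hx⟩ : ∃ x, x = dot (d - v) (d - v) - dot (b - v) (b - v) := ⟨_, rfl⟩
  rw [← hDdef] at hD
  rw [← hDdef, ← hx]
  have hnn : ∀ x : Euc 2, 0 ≤ dot x x := fun x => by
    simp only [dot]; nlinarith [sq_nonneg (x 0), sq_nonneg (x 1)]
  have hu0 : 0 < u := by have := hnn (d - b); linarith
  have hy0 : 0 < y := by have := hnn (b + d - v - v); linarith
  have hff : dot (d - b + turn (b + d - v - v)) (d - b + turn (b + d - v - v)) = u + y := by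
    rw [hu, hy, hDdef]; simp [dot, turn, dd, tri]; ring
  have huy : u * y = x ^ 2 + 2 * D * (u + y) := by
    rw [hu, hy, hx, hDdef]; simp [dot, dd, tri]; ring
  have hf0 : d - b + turn (b + d - v - v) ≠ 0 := by
    intro h; rw [h] at hff; simp [dot] at hff; linarith
  obtain ⟨r, hr, hr2, he⟩ := exists_unit hf0
  rw [hff] at hr2
  have xb : dot (r⁻¹ • (d - b + turn (b + d - v - v))) (b - v) = r⁻¹ * ((x - u) / 2) := by
    rw [hx, hu, hDdef]; simp [dot, turn, dd, tri]; ring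
  have xd : dot (r⁻¹ • (d - b + turn (b + d - v - v))) (d - v) = r⁻¹ * ((x + u) / 2) := by
    rw [hx, hu, hDdef]; simp [dot, turn, dd, tri]; ring
  have xa : dot (r⁻¹ • (d - b + turn (b + d - v - v))) (b + d - v - v) = r⁻¹ * x := by
    rw [hx]; simp [dot, turn]; ring
  have yb : dd (r⁻¹ • (d - b + turn (b + d - v - v))) (b - v) = -(r⁻¹ * ((y - x) / 2)) := by
    rw [hx, hy, hDdef]; simp [dot, turn, dd, tri]; ring
  have yd : dd (r⁻¹ • (d - b + turn (b + d - v - v))) (d - v) = -(r⁻¹ * ((y + x) / 2)) := by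
    rw [hx, hy, hDdef]; simp [dot, turn, dd, tri]; ring
  have ya : dd (r⁻¹ • (d - b + turn (b + d - v - v))) (b + d - v - v) = -(r⁻¹ * y) := by
    rw [hy, hDdef]; simp [dot, turn, dd, tri]; ring
  clear hff hf0
  generalize r⁻¹ • (d - b + turn (b + d - v - v)) = e at *
  refine ⟨(u + y)⁻¹, by positivity, ?_⟩
  refine le_trans ?_ (le_cRefl_one_mul hKc hvol hv he)
  have hcont : Continuous (lineRefl e v) := by
    unfold lineRefl frm dot dd; fun_prop
  have hC1 : ∀ x ∈ K, frm e v (dot e (x - v)) (dd e (x - v)) ∈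
      convexHull ℝ (K ∪ lineRefl e v '' K) := by
    intro x hx
    rw [← eq_frm he]
    exact subset_convexHull ℝ _ (Or.inl hx)
  have hC2 : ∀ x ∈ K, frm e v (dot e (x - v)) (-dd e (x - v)) ∈
      convexHull ℝ (K ∪ lineRefl e v '' K) := fun x hx =>
    subset_convexHull ℝ _ (Or.inr ⟨x, hx, rfl⟩)
  have hri : 0 < r⁻¹ := inv_pos.2 hr
  have h := two_trapezoids_le (xb := r⁻¹ * ((x - u) / 2)) (xd := r⁻¹ * ((x + u) / 2))
    (xa := r⁻¹ * x) (ya := r⁻¹ * y) (yb := r⁻¹ * ((y - x) / 2)) (yd := r⁻¹ * ((y + x) / 2))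
    (convex_convexHull ℝ _) (hull_union_ne_top hKc (hKc.image hcont)) he (by positivity)
    (fun h => by
      have := lt_of_mul_lt_mul_left h hri.le
      rw [← mul_add]; exact mul_nonneg hri.le (by linarith))
    (fun h => by
      have := lt_of_mul_lt_mul_left h hri.le
      rw [← mul_add]; exact mul_nonneg hri.le (by linarith))
    (by simpa only [xb, yb, neg_neg] using hC2 b hb) (by simpa only [xb, yb] using hC1 b hb)
    (by simpa only [xd, yd, neg_neg] using hC2 d hd) (by simpa only [xd, yd] using hC1 d hd)
    (by simpa only [xa, ya, neg_neg] using hC2 _ ha) (by simpa only [xa, ya] using hC1 _ ha)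
  refine le_trans (le_of_eq ?_) h
  -- The trapezoids add up to `(3 u y - x ^ 2) / (2 (u + y))`, which by `huy` equals `3 D + x ^ 2 /
  -- (u + y)`.
  rw [← hr2] at huy ⊢
  field_simp
  linear_combination -6 * huy

theorem isRhombus_of_cRefl_one_le {w : Fin 4 → Euc 2} (hw : IsCCW w) (hi : ConvexIndependent ℝ w)
    (hc : cRefl 1 (convexHull ℝ (Set.range w)) ≤ 3) :
    IsRhombus (convexHull ℝ (Set.range w)) := by
  have hpar := parallelogram_of_cRefl_one_le hw hc
  have hpos := hw.area_pos
  have hD := hw 0 1 3 (by decide) (by decide)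
  have hvol : volume.real (convexHull ℝ (Set.range w)) = tri (w 0) (w 1) (w 3) := by
    rw [hw.area_four]
    have h2 : w 2 = w 1 + w 3 - w 0 := by rw [← hpar]; abel
    rw [h2]; simp [tri_def]; ring
  obtain ⟨δ, hδ, h⟩ := area_lineRefl_parallelogram_ge (isCompact_hull_range w) hpos
    (mem_hull_range w 0) (mem_hull_range w 2) (mem_hull_range w 1) (mem_hull_range w 3) hpar hD
  have h2 := mul_le_mul_of_nonneg_right hc hpos.le
  have h3 : δ * (dot (w 3 - w 0) (w 3 - w 0) - dot (w 1 - w 0) (w 1 - w 0)) ^ 2 ≤ 0 := by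
    linarith
  have h5 : dot (w 3 - w 0) (w 3 - w 0) - dot (w 1 - w 0) (w 1 - w 0) = 0 :=
    pow_eq_zero_iff two_ne_zero |>.1
      (le_antisymm (nonpos_of_mul_nonpos_right h3 hδ) (sq_nonneg _))
  have hr : Set.range w = {w 0, w 1, w 2, w 3} := by
    ext x; simp [Fin.exists_fin_succ, eq_comm]
  have hw' : ![w 0, w 1, w 2, w 3] = w := by
    ext i; fin_cases i <;> rfl
  have e0 := congrArg (fun p : Euc 2 => p 0) hpar
  have e1 := congrArg (fun p : Euc 2 => p 1) hpar
  simp only [PiLp.add_apply] at e0 e1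
  simp only [dot, PiLp.sub_apply] at h5
  have s0 : w 2 0 = w 1 0 + w 3 0 - w 0 0 := by linarith
  have s1 : w 2 1 = w 1 1 + w 3 1 - w 0 1 := by linarith
  refine ⟨w 0, w 1, w 2, w 3, by rwa [hw'], by rw [hr], dist_eq_of_dot_eq ?_,
    dist_eq_of_dot_eq ?_, dist_eq_of_dot_eq ?_⟩ <;>
    simp only [dot, PiLp.sub_apply, s0, s1] <;> linarith

/-! ### Reflections about lines: the equilateral triangle and the square -/

theorem shoelace_frm {e : Euc 2} (he : dot e e = 1) (v : Euc 2) {n : ℕ} (X Y : Fin (n + 2) → ℝ)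
    (h : ∀ i j k, i < j → j < k →
      0 ≤ (X j - X i) * (Y k - Y i) - (Y j - Y i) * (X k - X i)) :
    volume.real (convexHull ℝ (Set.range fun i => frm e v (X i) (Y i))) =
      (∑ i : Fin n, ((X i.succ.castSucc - X 0) * (Y i.succ.succ - Y 0) -
        (Y i.succ.castSucc - Y 0) * (X i.succ.succ - X 0))) / 2 := by
  rw [shoelace n _ fun i j k hij hjk => by rw [tri_frm he]; exact h i j k hij hjk]
  simp only [tri_frm he]

/-- The origin of the frame lies between two segments that are symmetric about the axis. -/
theorem frm_origin_mem {C : Set (Euc 2)} (hC : Convex ℝ C) {e v : Euc 2} {a b c d : ℝ}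
    (ha : a ≤ 0) (hc : 0 ≤ c) (hac : a < c) (h1 : frm e v a b ∈ C) (h2 : frm e v a (-b) ∈ C)
    (h3 : frm e v c d ∈ C) (h4 : frm e v c (-d) ∈ C) : v ∈ C := by
  have k1 := hC h1 h2 (a := 1 / 2) (b := 1 / 2) (by norm_num) (by norm_num) (by norm_num)
  have k2 := hC h3 h4 (a := 1 / 2) (b := 1 / 2) (by norm_num) (by norm_num) (by norm_num)
  have hp : 0 < c - a := by linarith
  have k3 := hC k1 k2 (a := c / (c - a)) (b := -a / (c - a)) (by positivity)
    (div_nonneg (by linarith) hp.le) (by field_simp; ring)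
  convert k3 using 1
  apply euc_ext <;> simp [frm, turn] <;> field_simp <;> ring

theorem volume_hull_mono {S : Set (Euc 2)} {ι : Type*} [Finite ι] {w : ι → Euc 2}
    (h : S ⊆ convexHull ℝ (Set.range w)) :
    volume.real (convexHull ℝ S) ≤ volume.real (convexHull ℝ (Set.range w)) :=
  measureReal_mono (convexHull_min h (convex_convexHull ℝ _)) (finite_hull_ne_top (Set.finite_range w))

theorem sq_det_of_gram {x y x' y' : ℝ} (h1 : x ^ 2 + y ^ 2 = 1) (h2 : x' ^ 2 + y' ^ 2 = 1)
    (h3 : x * x' + y * y' = 1 / 2) : (x' * y - x * y') ^ 2 = 3 / 4 := by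
  have : (x' * y - x * y') ^ 2 = (x ^ 2 + y ^ 2) * (x' ^ 2 + y' ^ 2) - (x * x' + y * y') ^ 2 := by
    ring
  rw [this, h1, h2, h3]; norm_num

/-- Here `v` lies inside the trapezoid spanned by the other points, of area `(x' - x) (y + y')`. For
unit vectors at an angle of 60 degrees the factors are at most 1 and `√3`. -/
theorem area_reflected_triangle_le_of_between {e : Euc 2} (he : dot e e = 1) (v : Euc 2)
    {x y x' y' : ℝ} (h1 : x ^ 2 + y ^ 2 = 1) (h2 : x' ^ 2 + y' ^ 2 = 1)
    (h3 : x * x' + y * y' = 1 / 2) (hy : 0 ≤ y) (hy' : 0 ≤ y') (hxx : x ≤ x') (hx : x ≤ 0) (hx' : 0 ≤ x') :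
    volume.real (convexHull ℝ {v, frm e v x y, frm e v x (-y), frm e v x' y', frm e v x' (-y')}) ≤
      √3 := by
  have h4 := sq_det_of_gram h1 h2 h3
  have h30 := Real.sqrt_nonneg 3
  have hlt : x < x' := by
    refine lt_of_le_of_ne hxx ?_
    rintro rfl
    have : x = 0 := le_antisymm hx hx'
    subst this
    norm_num at h4
  let X : Fin 4 → ℝ := ![x, x', x', x]
  let Y : Fin 4 → ℝ := ![-y, -y', y', y]
  refine (volume_hull_mono (w := fun i => frm e v (X i) (Y i)) ?_).trans ?_
  · have m := mem_hull_range fun i => frm e v (X i) (Y i)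
    have m0 := m 0
    have m1 := m 1
    have m2 := m 2
    have m3 := m 3
    rintro p (rfl | rfl | rfl | rfl | rfl)
    · exact frm_origin_mem (convex_convexHull ℝ _) hx hx' hlt m3 m0 m2 m1
    all_goals assumption
  · have p1 := mul_nonneg (sub_nonneg.2 hxx) hy
    have p2 := mul_nonneg (sub_nonneg.2 hxx) hy'
    rw [shoelace_frm he]
    · simp [X, Y, Fin.sum_univ_succ]
      have q1 : (y + y') ^ 2 ≤ 3 := by nlinarith [sq_nonneg (x + x')]
      have q2 : (x' - x) ^ 2 ≤ 1 := by nlinarith [sq_nonneg (y - y')]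
      have q3 : y + y' ≤ √3 := Real.le_sqrt_of_sq_le q1
      have q4 : x' - x ≤ 1 := by nlinarith
      have q5 := mul_le_mul q3 q4 (by linarith) h30
      linarith
    · intro i j k hij hjk
      fin_cases i <;> fin_cases j <;> fin_cases k <;> simp at hij hjk <;> simp [X, Y] <;>
        linarith

/-- Now `v` is a vertex of a pentagon of area `(x' y - x y') + x' y'`. The first term is at most `√3
/ 2`, the second at most `1 / 2`. -/
theorem area_reflected_triangle_le_of_right {e : Euc 2} (he : dot e e = 1) (v : Euc 2)
    {x y x' y' : ℝ} (h1 : x ^ 2 + y ^ 2 = 1) (h2 : x' ^ 2 + y' ^ 2 = 1)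
    (h3 : x * x' + y * y' = 1 / 2) (hy : 0 ≤ y) (hy' : 0 ≤ y') (hxx : x ≤ x') (hx : 0 ≤ x) :
    volume.real (convexHull ℝ {v, frm e v x y, frm e v x (-y), frm e v x' y', frm e v x' (-y')}) ≤
      √3 := by
  have h4 := sq_det_of_gram h1 h2 h3
  have h33 := Real.sq_sqrt (show (0 : ℝ) ≤ 3 by norm_num)
  have hx' := hx.trans hxx
  let X : Fin 5 → ℝ := ![0, x, x', x', x]
  let Y : Fin 5 → ℝ := ![0, -y, -y', y', y]
  refine (volume_hull_mono (w := fun i => frm e v (X i) (Y i)) ?_).trans ?_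
  · have m := mem_hull_range fun i => frm e v (X i) (Y i)
    have m0 := m 0
    have m1 := m 1
    have m2 := m 2
    have m3 := m 3
    have m4 := m 4
    rintro p (rfl | rfl | rfl | rfl | rfl)
    · change frm e p 0 0 ∈ _ at m0
      rwa [frm_zero] at m0
    all_goals assumption
  · have p1 := mul_nonneg (sub_nonneg.2 hxx) hy
    have p2 := mul_nonneg (sub_nonneg.2 hxx) hy'
    have p3 := mul_nonneg hx hy
    have p4 := mul_nonneg hx hy'
    have p5 := mul_nonneg hx' hy
    have p6 := mul_nonneg hx' hy'
    have hyy : y' ≤ y := by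
      apply le_of_sq_le_sq _ hy
      nlinarith
    have p7 := mul_nonneg (sub_nonneg.2 hyy) hx
    have hs : 0 ≤ x' * y - x * y' := by linarith
    rw [shoelace_frm he]
    · simp [X, Y, Fin.sum_univ_succ]
      have q1 : x' * y - x * y' ≤ √3 / 2 := by
        apply le_of_sq_le_sq _ (by positivity)
        rw [h4, div_pow, h33]; norm_num
      have q2 : 1 ≤ √3 := by
        apply Real.le_sqrt_of_sq_le; norm_num
      have q3 : x' * y' ≤ 1 / 2 := by nlinarith [sq_nonneg (x' - y')]
      linarith
    · intro i j k hij hjk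
      fin_cases i <;> fin_cases j <;> fin_cases k <;> simp at hij hjk <;> simp [X, Y] <;>
        linarith

theorem area_reflected_triangle_le_of_nonneg {e : Euc 2} (he : dot e e = 1) (v : Euc 2)
    {x y x' y' : ℝ} (h1 : x ^ 2 + y ^ 2 = 1) (h2 : x' ^ 2 + y' ^ 2 = 1)
    (h3 : x * x' + y * y' = 1 / 2) (hy : 0 ≤ y) (hy' : 0 ≤ y') (hxx : x ≤ x') (hx' : 0 ≤ x') :
    volume.real (convexHull ℝ {v, frm e v x y, frm e v x (-y), frm e v x' y', frm e v x' (-y')}) ≤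
      √3 := by
  rcases le_total x 0 with hx | hx
  · exact area_reflected_triangle_le_of_between he v h1 h2 h3 hy hy' hxx hx hx'
  · exact area_reflected_triangle_le_of_right he v h1 h2 h3 hy hy' hxx hx

/-- If both abscissas are nonpositive, reversing the axis and exchanging the two points leads back
to the previous case, since the point set is symmetric about the axis. -/
theorem area_reflected_triangle_le {e : Euc 2} (he : dot e e = 1) (v : Euc 2)
    {x y x' y' : ℝ} (h1 : x ^ 2 + y ^ 2 = 1) (h2 : x' ^ 2 + y' ^ 2 = 1)
    (h3 : x * x' + y * y' = 1 / 2) (hy : 0 ≤ y) (hy' : 0 ≤ y') (hxx : x ≤ x') :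
    volume.real (convexHull ℝ {v, frm e v x y, frm e v x (-y), frm e v x' y', frm e v x' (-y')}) ≤
      √3 := by
  rcases le_total 0 x' with hx' | hx'
  · exact area_reflected_triangle_le_of_nonneg he v h1 h2 h3 hy hy' hxx hx'
  · have he' : dot (-e) (-e) = 1 := by rw [← he]; simp [dot]
    have := area_reflected_triangle_le_of_nonneg he' v (x := -x') (y := y') (x' := -x) (y' := y)
      (by linarith) (by linarith) (by linarith) hy' hy (by linarith) (by linarith)
    simp only [frm_neg, neg_neg] at this
    convert this using 4
    ext p
    simp only [Set.mem_insert_iff, Set.mem_singleton_iff]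
    tauto

theorem area_lineRefl_equilateral_le {e : Euc 2} (he : dot e e = 1) {v a b : Euc 2}
    (ha : dot (a - v) (a - v) = 1) (hb : dot (b - v) (b - v) = 1)
    (hab : dot (a - v) (b - v) = 1 / 2) (ha0 : 0 ≤ dd e (a - v)) (hb0 : 0 ≤ dd e (b - v)) :
    volume.real (convexHull ℝ ({v, a, b} ∪ lineRefl e v '' {v, a, b})) ≤ √3 := by
  wlog hle : dot e (a - v) ≤ dot e (b - v) generalizing a b
  · rw [Set.pair_comm a b]
    exact this hb ha (by rw [← hab]; simp [dot]; ring) hb0 ha0 (le_of_not_ge hle)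
  have hdot : ∀ p q : Euc 2, dot e p * dot e q + dd e p * dd e q = dot p q := by
    intro p q
    simp only [dot, dd] at *
    linear_combination (p 0 * q 0 + p 1 * q 1) * he
  have h := area_reflected_triangle_le he v (by rw [sq, sq, hdot, ha]) (by rw [sq, sq, hdot, hb])
    (by rw [hdot, hab]) ha0 hb0 hle
  rw [← eq_frm he, ← eq_frm he] at h
  convert h using 4
  simp only [Set.image_insert_eq, Set.image_singleton, lineRefl_self]
  simp only [lineRefl]
  ext p
  simp only [Set.mem_insert_iff, Set.mem_singleton_iff, Set.mem_union]
  tauto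

/-- The hull is a hexagon made of two trapezoids, of total area `2 + 2 s t`, and `2 s t ≤ s ^ 2 + t
^ 2 = 1`. -/
theorem area_reflected_square_le {e : Euc 2} (he : dot e e = 1) (v : Euc 2) {s t : ℝ}
    (h1 : s ^ 2 + t ^ 2 = 1) (hs : 0 ≤ s) (ht : 0 ≤ t) :
    volume.real (convexHull ℝ {v, frm e v s t, frm e v s (-t), frm e v (s - t) (s + t),
      frm e v (s - t) (-(s + t)), frm e v (-t) s, frm e v (-t) (-s)}) ≤ 3 := by
  let X : Fin 6 → ℝ := ![-t, s - t, s, s, s - t, -t]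
  let Y : Fin 6 → ℝ := ![-s, -(s + t), -t, t, s + t, s]
  have hst := mul_nonneg hs ht
  refine (volume_hull_mono (w := fun i => frm e v (X i) (Y i)) ?_).trans ?_
  · have m := mem_hull_range fun i => frm e v (X i) (Y i)
    have m0 := m 0
    have m1 := m 1
    have m2 := m 2
    have m3 := m 3
    have m4 := m 4
    have m5 := m 5
    rintro p (rfl | rfl | rfl | rfl | rfl | rfl | rfl)
    · refine frm_origin_mem (convex_convexHull ℝ _) (neg_nonpos.2 ht) hs ?_ m5 m0 m3 m2
      by_contra hcon
      have : s = 0 := by linarith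
      have : t = 0 := by linarith
      subst s t
      norm_num at h1
    all_goals assumption
  · rw [shoelace_frm he]
    · simp [X, Y, Fin.sum_univ_succ]
      nlinarith [sq_nonneg (s - t)]
    · intro i j k hij hjk
      have h0 := sq_nonneg s
      have h0' := sq_nonneg t
      fin_cases i <;> fin_cases j <;> fin_cases k <;> simp at hij hjk <;> simp [X, Y] <;>
        linarith

theorem area_lineRefl_square_le {e : Euc 2} (he : dot e e = 1) {v p : Euc 2} (hp : dot p p = 1)
    (h1 : 0 ≤ dd e p) (h2 : 0 ≤ dd e (turn p)) :
    volume.real (convexHull ℝ ({v, v + p, v + p + turn p, v + turn p} ∪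
      lineRefl e v '' {v, v + p, v + p + turn p, v + turn p})) ≤ 3 := by
  have e1 : dd e (turn p) = dot e p := by simp [dd, dot, turn]
  rw [e1] at h2
  have hdot : dot e p ^ 2 + dd e p ^ 2 = 1 := by
    rw [← hp]
    simp only [dot, dd] at *
    linear_combination (p 0 ^ 2 + p 1 ^ 2) * he
  have h := area_reflected_square_le he v hdot h2 h1
  have f1 : ∀ q : Euc 2, v + q = frm e v (dot e q) (dd e q) := by
    intro q
    have := eq_frm he v (v + q)
    rwa [add_sub_cancel_left] at this
  have g1 : ∀ q : Euc 2, lineRefl e v (v + q) = frm e v (dot e q) (-dd e q) := by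
    intro q; rw [lineRefl, add_sub_cancel_left]
  have e2 : dot e (turn p) = -dd e p := by simp [dd, dot, turn]; ring
  have e3 : dot e (p + turn p) = dot e p - dd e p := by rw [sub_eq_add_neg, ← e2]; simp [dot]; ring
  have e4 : dd e (p + turn p) = dot e p + dd e p := by rw [← e1]; simp [dd]; ring
  rw [add_assoc]
  simp only [Set.image_insert_eq, Set.image_singleton, lineRefl_self, g1]
  rw [f1 p, f1 (turn p), f1 (p + turn p)]
  rw [e1, e2, e3, e4]
  convert h using 4
  ext q
  simp only [Set.mem_insert_iff, Set.mem_singleton_iff, Set.mem_union]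
  tauto

/-- An equilateral triangle with unit sides. -/
noncomputable def unitTriangle : Fin 3 → Euc 2 := ![!₂[0, 0], !₂[1, 0], !₂[1 / 2, √3 / 2]]

/-- The unit square. -/
noncomputable def unitSquare : Fin 4 → Euc 2 := ![!₂[0, 0], !₂[1, 0], !₂[1, 1], !₂[0, 1]]

theorem unitTriangle_isCCW : IsCCW unitTriangle := by
  have : 0 < √3 := by positivity
  intro i j k hij hjk
  fin_cases i <;> fin_cases j <;> fin_cases k <;> simp at hij hjk <;>
    simp [unitTriangle, tri_def]

theorem unitSquare_isCCW : IsCCW unitSquare := by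
  intro i j k hij hjk
  fin_cases i <;> fin_cases j <;> fin_cases k <;> simp at hij hjk <;>
    simp [unitSquare, tri_def]

theorem unitTriangle_convexIndependent : ConvexIndependent ℝ unitTriangle := by
  have : 0 < √3 := by positivity
  refine convexIndependent_of_separated fun i => ⟨unitTriangle (i - 1), unitTriangle (i + 1),
    ?_, ?_⟩
  · fin_cases i <;> simp [unitTriangle, tri_def] <;> linarith
  · intro j hj
    fin_cases i <;> fin_cases j <;> simp at hj <;> simp [unitTriangle, tri_def] <;> linarith

theorem unitSquare_convexIndependent : ConvexIndependent ℝ unitSquare := by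
  refine convexIndependent_of_separated fun i => ⟨unitSquare (i - 1), unitSquare (i + 1),
    ?_, ?_⟩
  · fin_cases i <;> simp [unitSquare, tri_def]
  · intro j hj
    fin_cases i <;> fin_cases j <;> simp at hj <;> simp [unitSquare, tri_def]

theorem unitTriangle_area : volume.real (convexHull ℝ (Set.range unitTriangle)) = √3 / 4 := by
  rw [unitTriangle_isCCW.area_three]
  simp [unitTriangle, tri_def]
  ring

theorem unitSquare_area : volume.real (convexHull ℝ (Set.range unitSquare)) = 1 := by
  rw [unitSquare_isCCW.area_four]
  simp [unitSquare, tri_def]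

theorem cRefl_one_unitTriangle_le : cRefl 1 (convexHull ℝ (Set.range unitTriangle)) ≤ 4 := by
  have h3 := Real.sq_sqrt (show (0 : ℝ) ≤ 3 by norm_num)
  refine cRefl_one_le_of_support (Set.finite_range _) unitTriangle_isCCW.area_pos ?_
  rintro e he _ ⟨i, rfl⟩ h
  rw [unitTriangle_area]
  have hr : Set.range unitTriangle =
      {unitTriangle i, unitTriangle (i + 1), unitTriangle (i + 2)} := by
    ext x
    fin_cases i <;> simp [Fin.exists_fin_succ, eq_comm] <;> tauto
  rw [hr]
  refine (area_lineRefl_equilateral_le he ?_ ?_ ?_ (h _ ⟨_, rfl⟩) (h _ ⟨_, rfl⟩)).trans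
    (by linarith) <;>
    fin_cases i <;> simp [unitTriangle, dot] <;> linarith

theorem cRefl_one_unitSquare_le : cRefl 1 (convexHull ℝ (Set.range unitSquare)) ≤ 3 := by
  refine cRefl_one_le_of_support (Set.finite_range _) unitSquare_isCCW.area_pos ?_
  rintro e he _ ⟨i, rfl⟩ h
  rw [unitSquare_area, mul_one]
  have e1 : unitSquare i + (unitSquare (i + 1) - unitSquare i) = unitSquare (i + 1) := by abel
  have e3 : unitSquare i + turn (unitSquare (i + 1) - unitSquare i) = unitSquare (i + 3) := by
    fin_cases i <;> apply euc_ext <;> simp [unitSquare, turn]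
  have e2 : unitSquare i + (unitSquare (i + 1) - unitSquare i) +
      turn (unitSquare (i + 1) - unitSquare i) = unitSquare (i + 2) := by
    fin_cases i <;> apply euc_ext <;> simp [unitSquare, turn]
  have hr : Set.range unitSquare =
      {unitSquare i, unitSquare (i + 1), unitSquare (i + 2), unitSquare (i + 3)} := by
    ext x
    fin_cases i <;> simp [Fin.exists_fin_succ, eq_comm] <;> tauto
  have k := area_lineRefl_square_le he (v := unitSquare i)
    (p := unitSquare (i + 1) - unitSquare i) (by fin_cases i <;> simp [unitSquare, dot])
    (h _ ⟨_, rfl⟩) (by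
      have := h (unitSquare (i + 3)) ⟨_, rfl⟩
      rwa [← e3, add_sub_cancel_left] at this)
  rwa [e2, e1, e3, ← hr] at k

theorem cRefl_zero_unitSquare_le : cRefl 0 (convexHull ℝ (Set.range unitSquare)) ≤ 3 := by
  refine cRefl_zero_le_three_of_symm (convex_convexHull ℝ _) (isCompact_hull_range _)
    unitSquare_isCCW.area_pos (c := !₂[1 / 2, 1 / 2]) fun x hx => ?_
  have hconv : Convex ℝ {x | (2 : ℝ) • !₂[1 / 2, 1 / 2] - x ∈ convexHull ℝ (Set.range unitSquare)} :=
    (convex_convexHull ℝ _).affine_preimage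
      (AffineMap.const ℝ (Euc 2) ((2 : ℝ) • (!₂[1 / 2, 1 / 2] : Euc 2)) - AffineMap.id ℝ (Euc 2))
  refine convexHull_min ?_ hconv hx
  rintro _ ⟨i, rfl⟩
  have h : (2 : ℝ) • !₂[1 / 2, 1 / 2] - unitSquare i = unitSquare (i + 2) := by
    fin_cases i <;> apply euc_ext <;> simp [unitSquare]
  rw [Set.mem_ofPred_eq, h]
  exact mem_hull_range _ _

/-! ### The minima and their equality cases -/

theorem isLeast_image_convexGons {m : ℕ} (hm : 2 ≤ m) {F : Set (Euc 2) → ℝ} {c : ℝ}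
    (hle : ∀ w : Fin (m + 1) → Euc 2, IsCCW w → c ≤ F (convexHull ℝ (Set.range w)))
    {w : Fin (m + 1) → Euc 2} (hw : IsCCW w) (hi : ConvexIndependent ℝ w)
    (hF : F (convexHull ℝ (Set.range w)) ≤ c) : IsLeast (F '' convexGons (m + 1)) c := by
  refine ⟨⟨_, ⟨by omega, w, hi, rfl⟩, le_antisymm hF (hle w hw)⟩, ?_⟩
  rintro _ ⟨P, hP, rfl⟩
  obtain ⟨u, -, rfl, hu⟩ := exists_ccw_of_mem_convexGons hP
  exact hle u hu

theorem sqrt_five_eq : √5 = 2 * phi - 1 := by rw [phi]; ring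

theorem five_translates_eq : (10 + √5) / 5 = (9 + 2 * phi) / 5 := by rw [sqrt_five_eq]; ring

theorem five_reflections_eq : 2 + 8 * Real.sin (Real.pi / 5) ^ 2 / 5 = (16 - 2 * phi) / 5 := by
  have h := phi_sq
  rw [Real.sin_sq, Real.cos_pi_div_five, sqrt_five_eq]
  nlinarith

theorem theorem5 :
    -- translates
    (IsLeast (cTr '' convexGons 3) 3 ∧
      IsLeast (cTr '' convexGons 4) 3 ∧
      IsLeast (cTr '' convexGons 5) ((10 + Real.sqrt 5) / 5) ∧
      (∀ P ∈ convexGons 3, cTr P = 3) ∧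
      (∀ P ∈ convexGons 4, cTr P = 3) ∧
      (∀ P ∈ convexGons 5, cTr P = (10 + Real.sqrt 5) / 5 → IsAffineRegularGon 5 P)) ∧
    -- reflections about points
    (IsLeast (cRefl 0 '' convexGons 3) 4 ∧
      IsLeast (cRefl 0 '' convexGons 4) 3 ∧
      IsLeast (cRefl 0 '' convexGons 5) (2 + 8 * Real.sin (Real.pi / 5) ^ 2 / 5) ∧
      (∀ P ∈ convexGons 3, cRefl 0 P = 4 → IsAffineRegularGon 3 P) ∧
      (∀ P ∈ convexGons 4, cRefl 0 P = 3 → IsAffineRegularGon 4 P) ∧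
      (∀ P ∈ convexGons 5, cRefl 0 P = 2 + 8 * Real.sin (Real.pi / 5) ^ 2 / 5 →
        IsAffineRegularGon 5 P)) ∧
    -- reflections about lines
    (IsLeast (cRefl 1 '' convexGons 3) 4 ∧
      IsLeast (cRefl 1 '' convexGons 4) 3 ∧
      (∀ P ∈ convexGons 3, cRefl 1 P = 4 → IsEquilateralTriangle P) ∧
      (∀ P ∈ convexGons 4, cRefl 1 P = 3 → IsRhombus P)) := by
  rw [five_translates_eq, five_reflections_eq]
  refine ⟨⟨?_, ?_, ?_, ?_, ?_, ?_⟩, ⟨?_, ?_, ?_, ?_, ?_, ?_⟩, ⟨?_, ?_, ?_, ?_⟩⟩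
  · exact isLeast_image_convexGons le_rfl (fun w hw => (cTr_three hw).ge) unitTriangle_isCCW
      unitTriangle_convexIndependent (cTr_three unitTriangle_isCCW).le
  · exact isLeast_image_convexGons (by norm_num) (fun w hw => (cTr_four hw).ge) unitSquare_isCCW
      unitSquare_convexIndependent (cTr_four unitSquare_isCCW).le
  · exact isLeast_image_convexGons (by norm_num) (fun w hw => le_cTr_five hw)
      goldenPentagon_isCCW goldenPentagon_convexIndependent cTr_goldenPentagon_le
  · intro P hP
    obtain ⟨w, -, rfl, hw⟩ := exists_ccw_of_mem_convexGons hP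
    exact cTr_three hw
  · intro P hP
    obtain ⟨w, -, rfl, hw⟩ := exists_ccw_of_mem_convexGons hP
    exact cTr_four hw
  · intro P hP h
    obtain ⟨w, -, rfl, hw⟩ := exists_ccw_of_mem_convexGons hP
    exact pentagon_of_ears_eq hw (ears_eq_of_cTr_le hw h.le)
  · exact isLeast_image_convexGons le_rfl (fun w hw => le_cRefl_zero_three hw) unitTriangle_isCCW
      unitTriangle_convexIndependent (cRefl_zero_three_le unitTriangle_isCCW)
  · exact isLeast_image_convexGons (by norm_num) (fun w hw => le_cRefl_zero_four hw)
      unitSquare_isCCW unitSquare_convexIndependent cRefl_zero_unitSquare_le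
  · exact isLeast_image_convexGons (by norm_num) (fun w hw => le_cRefl_zero_five hw)
      goldenPentagon_isCCW goldenPentagon_convexIndependent cRefl_zero_goldenPentagon_le
  · intro P hP _
    obtain ⟨w, -, rfl, hw⟩ := exists_ccw_of_mem_convexGons hP
    exact isAffineRegularGon_three hw
  · intro P hP h
    obtain ⟨w, -, rfl, hw⟩ := exists_ccw_of_mem_convexGons hP
    exact isAffineRegularGon_four (hw 0 1 3 (by decide) (by decide))
      (parallelogram_of_cRefl_zero_le hw h.le)
  · intro P hP h
    obtain ⟨w, -, rfl, hw⟩ := exists_ccw_of_mem_convexGons hP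
    exact pentagon_of_ears_eq hw (ears_eq_of_cRefl_zero_le hw h.le)
  · exact isLeast_image_convexGons le_rfl (fun w hw => le_cRefl_one_three hw) unitTriangle_isCCW
      unitTriangle_convexIndependent cRefl_one_unitTriangle_le
  · exact isLeast_image_convexGons (by norm_num) (fun w hw => le_cRefl_one_four hw)
      unitSquare_isCCW unitSquare_convexIndependent cRefl_one_unitSquare_le
  · intro P hP h
    obtain ⟨w, -, rfl, hw⟩ := exists_ccw_of_mem_convexGons hP
    exact isEquilateral_of_cRefl_one_le hw h.le
  · intro P hP h
    obtain ⟨w, hi, rfl, hw⟩ := exists_ccw_of_mem_convexGons hP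
    exact isRhombus_of_cRefl_one_le hw hi h.le
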